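/- Theorem. For a positive integer $n$ and integers $a_1,a_2,a_3,b$, let $\mathrm{eq}(a_1,a_2,a_3,b)$ denote the equation $a_1x_1+a_2x_2+a_3x_3=b$. An exact $r$-coloring of $\mathbb{Z}_n=\mathbb{Z}/n\mathbb{Z}$ is a surjective function $c:\mathbb{Z}_n\to\{1,\dots,r\}$. A rainbow solution of the equation for $c$ is a triple $(s_1,s_2,s_3)\in\mathbb{Z}_n^3$ with $a_1s_1+a_2s_2+a_3s_3\equiv b \pmod n$ and $c(s_1),c(s_2),c(s_3)$ pairwise distinct. The rainbow number $\mathrm{rb}(\mathbb{Z}_n,\mathrm{eq}(a_1,a_2,a_3,b))$ is the smallest positive integer $r$ such that every exact $r$-coloring of $\mathbb{Z}_n$ has a rainbow solution; since there is no exact $(n+1)$-coloring, it is at most $n+1$, and it equals $n+1$ if an exact $n$-coloring has no rainbow solution. Let $p$ be a prime, let $t\ge 2$ be an integer, and let $a_1,a_2,a_3$ be integers such that $a_1a_2a_3$ is a unit modulo $p$. Then $$\mathrm{rb}(\mathbb{Z}_p,\mathrm{eq}(a_1,a_2,a_3,0))+\mathrm{rb}(\mathbb{Z}_t,\mathrm{eq}(a_1,a_2,a_3,0))-2\le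 \mathrm{rb}(\mathbb{Z}_{pt},\mathrm{eq}(a_1,a_2,a_3,0)).$$ -/

import Mathlib

namespace RainbowNumber

/-- The linear equation `eq(a₁, a₂, a₃, b)`, that is `a₁ x₁ + a₂ x₂ + a₃ x₃ = b`, with integer
coefficients; the same equation is considered modulo different `n`. -/
structure LinEq where
  a₁ : ℤ
  a₂ : ℤ
  a₃ : ℤ
  b : ℤ

/-- The ordered triple `(s₁, s₂, s₃)` is a solution in `ℤ/nℤ` of the equation `e`. -/
def LinEq.IsSolution (e : LinEq) {n : ℕ} (s₁ s₂ s₃ : ZMod n) : Prop :=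
  (e.a₁ : ZMod n) * s₁ + (e.a₂ : ZMod n) * s₂ + (e.a₃ : ZMod n) * s₃ = (e.b : ZMod n)

/-- The coloring `c` of `ℤ/nℤ` has a rainbow solution of `e`: a solution whose three members
receive pairwise distinct colors. -/
def HasRainbowSolution (e : LinEq) {n r : ℕ} (c : ZMod n → Fin r) : Prop :=
  ∃ s₁ s₂ s₃ : ZMod n, e.IsSolution s₁ s₂ s₃ ∧
    c s₁ ≠ c s₂ ∧ c s₁ ≠ c s₃ ∧ c s₂ ≠ c s₃

/-- Every exact (that is, surjective) `r`-coloring of `ℤ/nℤ` has a rainbow solution of `e`. -/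
def ForcesRainbow (n : ℕ) (e : LinEq) (r : ℕ) : Prop :=
  ∀ c : ZMod n → Fin r, Function.Surjective c → HasRainbowSolution e c

/-- The rainbow number of `ℤ/nℤ` for `e`: the smallest positive integer `r` such that every exact
`r`-coloring of `ℤ/nℤ` has a rainbow solution of `e`. For `n ≥ 1` there is no exact
`(n + 1)`-coloring, so the minimum is over a nonempty set and is at most `n + 1`
(see `forcesRainbow_succ` and `rb_eq_succ`). -/
noncomputable def rb (n : ℕ) (e : LinEq) : ℕ :=
  sInf {r : ℕ | 0 < r ∧ ForcesRainbow n e r}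

/-- The set defining `rb n e` contains `n + 1`. -/
theorem forcesRainbow_succ (n : ℕ) (hn : n ≠ 0) (e : LinEq) : ForcesRainbow n e (n + 1) := by
  intro c hc
  have : NeZero n := ⟨hn⟩
  have h := Fintype.card_le_of_surjective c hc
  rw [ZMod.card, Fintype.card_fin] at h
  omega

/-- The usual convention: if some exact `n`-coloring of `ℤ/nℤ` has no rainbow solution, then the
rainbow number is `n + 1`. -/
theorem rb_eq_succ (n : ℕ) (hn : n ≠ 0) (e : LinEq) (h : ¬ ForcesRainbow n e n) :
    rb n e = n + 1 := by
  have : NeZero n := ⟨hn⟩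
  have hinj : ∃ c : ZMod n → Fin n, Function.Injective c ∧ ¬ HasRainbowSolution e c := by
    unfold ForcesRainbow at h
    push Not at h
    obtain ⟨c, hc, hr⟩ := h
    refine ⟨c, ?_, hr⟩
    exact ((Fintype.bijective_iff_surjective_and_card c).2
      ⟨hc, by rw [ZMod.card, Fintype.card_fin]⟩).1
  obtain ⟨c, hc, hr⟩ := hinj
  apply le_antisymm
  · exact Nat.sInf_le ⟨Nat.succ_pos n, forcesRainbow_succ n hn e⟩
  · refine le_csInf ⟨n + 1, Nat.succ_pos n, forcesRainbow_succ n hn e⟩ ?_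
    rintro r ⟨hr0, hf⟩
    by_contra hlt
    have : NeZero r := ⟨hr0.ne'⟩
    have hcard : Fintype.card (Fin r) ≤ Fintype.card (ZMod n) := by
      rw [ZMod.card, Fintype.card_fin]; omega
    obtain ⟨g⟩ := Function.Embedding.nonempty_of_card_le hcard
    obtain ⟨s₁, s₂, s₃, hs, h12, h13, h23⟩ :=
      hf (Function.invFun g) (Function.invFun_surjective g.injective)
    exact hr ⟨s₁, s₂, s₃, hs, fun q => h12 (congrArg _ (hc q)),
      fun q => h13 (congrArg _ (hc q)), fun q => h23 (congrArg _ (hc q))⟩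

end RainbowNumber

/-! The multiples of `p` form a copy of `ℤ/tℤ` in `ℤ/ptℤ`. Color them by an extremal rainbow-free
coloring of `ℤ/tℤ`, and color every other element through its residue by an extremal rainbow-free
coloring `c` of `ℤ/pℤ`. If `0` is alone in its `c`-color, this is rainbow-free: the coefficients are
units modulo `p`, so a solution with two members divisible by `p` has all three divisible and comes
from `ℤ/tℤ`, while any other rainbow solution would reduce to one for `c`. Only the color of `0` is
lost, so rb(t) - 1 + rb(p) - 2 colors survive.

The work lies in isolating `0` (`exists_rainbowFree_zero`). For `5 ≤ p`, four colors always produce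
a rainbow solution (`Quad.false`), and a rainbow-free partition into three classes forces a proper
nonempty set of nonzero residues stable under all maps `x ↦ -(a i / a j) * x` (`inv_of_part`); then
`{0}`, this set and the remaining residues form the required coloring.

Both facts are additive combinatorics. Freeness says that a sumset of dilates of two classes misses
a dilate of the third, so its size exceeds the Cauchy–Davenport bound by at most one. For a proper
subset and `d ≠ 0`, `bd X d` counts the runs of `X` along steps of `d`. If one class is a
progression of difference `d`, the others have at most two runs in each direction `a i / a j * d`.
If it is not, `vosper` makes the sumset bound an equality, the third class is a dilate of the
complement of the sumset, and `bd_add_eq` carries small run counts from class to class; the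
directions of few runs then form an invariant set. Singleton classes are treated by commuting affine
maps, classes of two or three elements by counting directions, and `p = 7` by a finite check. With
four classes, merging two of them gives many three-class partitions, whose boundaries satisfy
incompatible linear relations. -/

namespace RainbowNumber
open Finset Pointwise

/-! ### Boundaries of subsets of `ℤ/pℤ` -/

section Boundary

variable {p : ℕ} [Fact p.Prime]

/-- The number of elements of `X` that the translation by `d` moves out of `X`. -/
def bd (X : Finset (ZMod p)) (d : ZMod p) : ℕ := #{x ∈ X | x + d ∉ X}

/-- `X` is an arithmetic progression: for some nonzero difference it has a single run. -/
def IsAP (X : Finset (ZMod p)) : Prop := ∃ d : ZMod p, d ≠ 0 ∧ bd X d = 1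

theorem mem_vadd_iff (X : Finset (ZMod p)) (d x : ZMod p) : x ∈ d +ᵥ X ↔ x - d ∈ X := by
  rw [mem_vadd_finset]
  constructor
  · rintro ⟨y, hy, rfl⟩
    simpa using hy
  · intro h
    exact ⟨x - d, h, by simp⟩

theorem bd_eq_card_sdiff (X : Finset (ZMod p)) (d : ZMod p) : bd X d = #((d +ᵥ X) \ X) := by
  unfold bd
  refine card_bij (fun x _ => x + d) ?_ ?_ ?_
  · intro x hx
    rw [mem_filter] at hx
    simp [mem_vadd_iff, hx.1, hx.2]
  · intro x _ y _ h
    exact add_right_cancel h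
  · intro y hy
    rw [mem_sdiff, mem_vadd_iff] at hy
    exact ⟨y - d, by simp [hy.1, hy.2], by simp⟩

theorem card_union_vadd (X : Finset (ZMod p)) (d : ZMod p) :
    #(X ∪ (d +ᵥ X)) = #X + bd X d := by
  rw [bd_eq_card_sdiff, ← card_union_of_disjoint disjoint_sdiff, union_sdiff_self_eq_union]

theorem card_inter_vadd (X : Finset (ZMod p)) (d : ZMod p) :
    #(X ∩ (d +ᵥ X)) + bd X d = #X := by
  have h1 := card_union_add_card_inter X (d +ᵥ X)
  rw [card_union_vadd, card_vadd_finset] at h1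
  omega

theorem add_pair_eq (X : Finset (ZMod p)) (d : ZMod p) : X + {0, d} = X ∪ (d +ᵥ X) := by
  ext x
  simp only [mem_add, mem_insert, mem_singleton, mem_union, mem_vadd_iff]
  constructor
  · rintro ⟨y, hy, z, rfl | rfl, rfl⟩
    · left; simpa using hy
    · right; simpa using hy
  · rintro (h | h)
    · exact ⟨x, h, 0, Or.inl rfl, by simp⟩
    · exact ⟨x - d, h, d, Or.inr rfl, by simp⟩

theorem card_add_pair (X : Finset (ZMod p)) (d : ZMod p) : #(X + {0, d}) = #X + bd X d := by
  rw [add_pair_eq, card_union_vadd]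

theorem bd_neg (X : Finset (ZMod p)) (d : ZMod p) : bd X (-d) = bd X d := by
  have h1 := card_union_vadd X (-d)
  have h2 := card_union_vadd X d
  have h3 : d +ᵥ (X ∪ (-d +ᵥ X)) = X ∪ (d +ᵥ X) := by
    ext x
    simp only [mem_vadd_iff, mem_union]
    rw [show x - d - -d = x by ring]
    tauto
  have h4 := card_vadd_finset d (X ∪ (-d +ᵥ X))
  rw [h3] at h4
  omega

theorem bd_compl (X : Finset (ZMod p)) (d : ZMod p) : bd Xᶜ d = bd X d := by
  rw [← bd_neg X d, bd_eq_card_sdiff, bd_eq_card_sdiff, ← card_vadd_finset d ((-d +ᵥ X) \ X)]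
  congr 1
  ext x
  simp only [mem_sdiff, mem_vadd_iff, mem_compl]
  rw [show x - d - -d = x by ring]
  tauto

theorem bd_smul (X : Finset (ZMod p)) (d : ZMod p) {u : ZMod p} (hu : u ≠ 0) :
    bd (u • X) (u * d) = bd X d := by
  rw [bd_eq_card_sdiff, bd_eq_card_sdiff, ← card_smul_finset₀ hu ((d +ᵥ X) \ X)]
  congr 1
  ext x
  obtain ⟨y, rfl⟩ : ∃ y, x = u • y := ⟨u⁻¹ * x, by simp [hu]⟩
  rw [smul_mem_smul_finset_iff₀ hu, mem_sdiff, mem_sdiff, mem_vadd_iff, mem_vadd_iff,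
    smul_mem_smul_finset_iff₀ hu, smul_eq_mul, ← mul_sub, ← smul_eq_mul,
    smul_mem_smul_finset_iff₀ hu]

theorem bd_vadd (X : Finset (ZMod p)) (c d : ZMod p) : bd (c +ᵥ X) d = bd X d := by
  rw [bd_eq_card_sdiff, bd_eq_card_sdiff, ← card_vadd_finset c ((d +ᵥ X) \ X)]
  congr 1
  ext x
  simp only [mem_sdiff, mem_vadd_iff]
  rw [show x - d - c = x - c - d by ring]

theorem bd_zero (X : Finset (ZMod p)) : bd X 0 = 0 := by
  simp [bd, filter_eq_empty_iff]

theorem bd_le_card (X : Finset (ZMod p)) (d : ZMod p) : bd X d ≤ #X := card_filter_le _ _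

theorem eq_univ_of_add_mem {X : Finset (ZMod p)} {d : ZMod p} (hd : d ≠ 0)
    (hX : X.Nonempty) (h : ∀ x ∈ X, x + d ∈ X) : X = univ := by
  obtain ⟨x, hx⟩ := hX
  have key : ∀ n : ℕ, x + n * d ∈ X := by
    intro n
    induction n with
    | zero => simpa using hx
    | succ n ih =>
      have := h _ ih
      rw [show x + ((n + 1 : ℕ) : ZMod p) * d = x + n * d + d by push_cast; ring]
      exact this
  ext y
  simp only [mem_univ, iff_true]
  have := key ((y - x) * d⁻¹).val
  rw [ZMod.natCast_zmod_val, mul_assoc, inv_mul_cancel₀ hd, mul_one] at this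
  simpa using this

theorem bd_pos {X : Finset (ZMod p)} {d : ZMod p} (hd : d ≠ 0) (hX : X.Nonempty)
    (hX' : #X < p) : 0 < bd X d := by
  by_contra h
  have h0 : bd X d = 0 := by omega
  rw [bd, card_eq_zero, filter_eq_empty_iff] at h0
  have := eq_univ_of_add_mem hd hX (fun x hx => by simpa using h0 hx)
  rw [this, card_univ, ZMod.card] at hX'
  exact lt_irrefl _ hX'

theorem sum_bd (X : Finset (ZMod p)) : ∑ d : ZMod p, bd X d = #X * (p - #X) := by
  have h1 : ∀ d : ZMod p, bd X d = ∑ x ∈ X, if x + d ∉ X then 1 else 0 := by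
    intro d
    rw [bd, card_filter]
  simp_rw [h1]
  rw [sum_comm]
  have h2 : ∀ x ∈ X, ∑ d : ZMod p, (if x + d ∉ X then 1 else 0) = p - #X := by
    intro x _
    rw [← card_filter]
    have h3 : p - #X = #Xᶜ := by rw [card_compl, ZMod.card]
    rw [h3]
    refine card_bij (fun d _ => x + d) ?_ ?_ ?_
    · intro d hd
      simpa using hd
    · intro d _ e _ h
      exact add_left_cancel h
    · intro y hy
      exact ⟨y - x, by simpa using hy, by simp⟩
  rw [sum_congr rfl h2, sum_const, smul_eq_mul]

theorem cauchy_davenport' {X Y : Finset (ZMod p)} (hX : X.Nonempty) (hY : Y.Nonempty)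
    (h : #(X + Y) < p) : #X + #Y ≤ #(X + Y) + 1 := by
  have h1 := ZMod.cauchy_davenport (Fact.out : p.Prime) hX hY
  rcases min_le_iff.1 h1 with h2 | h2 <;> omega

/-- Inclusion–exclusion for three translates of `Y` inside `Y + B`: two of them meet in `#Y - bd Y`
of the difference, and the triple intersection is dropped. -/
theorem sum_three_translates (Y : Finset (ZMod p)) {B : Finset (ZMod p)} {b₁ b₂ b₃ : ZMod p}
    (h1 : b₁ ∈ B) (h2 : b₂ ∈ B) (h3 : b₃ ∈ B) :
    bd Y (b₂ - b₁) + bd Y (b₃ - b₁) + bd Y (b₃ - b₂) ≤ #(Y + B) := by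
  have hsub : ∀ b ∈ B, (b +ᵥ Y) ⊆ Y + B := by
    intro b hb x hx
    rw [mem_vadd_iff] at hx
    exact mem_add.2 ⟨_, hx, b, hb, by ring⟩
  have hint : ∀ b b' : ZMod p, #((b +ᵥ Y) ∩ (b' +ᵥ Y)) + bd Y (b' - b) = #Y := by
    intro b b'
    have e : (b +ᵥ Y) ∩ (b' +ᵥ Y) = b +ᵥ (Y ∩ ((b' - b) +ᵥ Y)) := by
      ext x
      simp only [mem_inter, mem_vadd_iff]
      rw [show x - b - (b' - b) = x - b' by ring]
    rw [e, card_vadd_finset]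
    exact card_inter_vadd Y (b' - b)
  have u1 := card_union_add_card_inter (b₁ +ᵥ Y) (b₂ +ᵥ Y)
  have u2 := card_union_add_card_inter ((b₁ +ᵥ Y) ∪ (b₂ +ᵥ Y)) (b₃ +ᵥ Y)
  have u3 : #(((b₁ +ᵥ Y) ∪ (b₂ +ᵥ Y)) ∩ (b₃ +ᵥ Y)) ≤
      #((b₁ +ᵥ Y) ∩ (b₃ +ᵥ Y)) + #((b₂ +ᵥ Y) ∩ (b₃ +ᵥ Y)) := by
    rw [union_inter_distrib_right]
    exact card_union_le _ _
  have u4 : #((b₁ +ᵥ Y) ∪ (b₂ +ᵥ Y) ∪ (b₃ +ᵥ Y)) ≤ #(Y + B) :=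
    card_le_card (union_subset (union_subset (hsub _ h1) (hsub _ h2)) (hsub _ h3))
  have i12 := hint b₁ b₂
  have i13 := hint b₁ b₃
  have i23 := hint b₂ b₃
  rw [card_vadd_finset] at u1 u2
  rw [card_vadd_finset] at u1
  omega

theorem three_translates {Y B : Finset (ZMod p)} {m : ℕ} (hB : 3 ≤ #B)
    (h : ∀ d ≠ 0, m ≤ bd Y d) : 3 * m ≤ #(Y + B) := by
  obtain ⟨b₁, b₂, b₃, h1, h2, h3, h12, h13, h23⟩ := two_lt_card_iff.1 (show 2 < #B by omega)
  have := sum_three_translates Y h1 h2 h3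
  have := h _ (sub_ne_zero.2 h12.symm)
  have := h _ (sub_ne_zero.2 h13.symm)
  have := h _ (sub_ne_zero.2 h23.symm)
  omega

/-! ### Vosper's theorem -/

/-- Submodularity of `X ↦ #(X + R)`, the engine of the isoperimetric arguments below. -/
theorem card_inter_add_union_add (X Y R : Finset (ZMod p)) :
    #(X ∩ Y + R) + #(X ∪ Y + R) ≤ #(X + R) + #(Y + R) := by
  rw [union_add, ← card_union_add_card_inter (X + R) (Y + R), add_comm]
  exact Nat.add_le_add_left (card_le_card inter_add_subset) _

theorem vadd_add' (X R : Finset (ZMod p)) (d : ZMod p) : (d +ᵥ X) + R = d +ᵥ (X + R) := by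
  ext x
  simp only [mem_add, mem_vadd_iff]
  constructor
  · rintro ⟨y, hy, z, hz, rfl⟩
    exact ⟨y - d, hy, z, hz, by ring⟩
  · rintro ⟨y, hy, z, hz, h⟩
    exact ⟨y + d, by simpa using hy, z, hz, by rw [add_right_comm, h]; ring⟩

/-- `U` witnesses that `R` is critical: `#(U + R) < #U + #R` with `U + R` not too large. -/
def Critical (R U : Finset (ZMod p)) : Prop :=
  2 ≤ #U ∧ #(U + R) + 2 ≤ p ∧ #(U + R) + 1 ≤ #U + #R

theorem exists_min_critical {R X : Finset (ZMod p)} (h : Critical R X) :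
    ∃ U, Critical R U ∧ ∀ V, Critical R V → #U ≤ #V := by
  classical
  obtain ⟨U, hU, hmin⟩ := exists_min_image (univ.filter (Critical R)) card
    ⟨X, by simpa using h⟩
  exact ⟨U, by simpa using hU, fun V hV => hmin V (by simpa using hV)⟩

/-- A critical set of minimal size meets each of its proper translates in at most one element. -/
theorem card_le_bd_add_one_of_min {R U : Finset (ZMod p)} (hR : R.Nonempty) (hU : Critical R U)
    (hmin : ∀ V, Critical R V → #U ≤ #V) {d : ZMod p} (hd : d ≠ 0) : #U ≤ bd U d + 1 := by
  obtain ⟨h1, h2, h3⟩ := hU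
  by_contra hcon
  have hUne : U.Nonempty := card_pos.1 (by omega)
  have hcd := cauchy_davenport' hUne hR (by omega)
  have hI := card_inter_vadd U d
  have hJ := card_union_vadd U d
  have hUp : #U ≤ #(U + R) := card_le_card_add_right hR
  have hb : 0 < bd U d := bd_pos hd hUne (by omega)
  have hsum := card_inter_add_union_add U (d +ᵥ U) R
  rw [vadd_add', card_vadd_finset] at hsum
  have hIsub : #(U ∩ (d +ᵥ U) + R) ≤ #(U + R) :=
    card_le_card (add_subset_add_right inter_subset_left)
  -- The intersection is smaller than `U` and has at least two elements, so by minimality it is not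
  -- critical.
  have hIn : #(U ∩ (d +ᵥ U)) + #R ≤ #(U ∩ (d +ᵥ U) + R) := by
    by_contra hlt
    have := hmin _ (show Critical R (U ∩ (d +ᵥ U)) from ⟨by omega, by omega, by omega⟩)
    omega
  have hJcd := ZMod.cauchy_davenport (Fact.out : p.Prime) (s := U ∪ (d +ᵥ U)) (t := R)
    (hUne.mono subset_union_left) hR
  have hW : #(-(U + R)ᶜ) + #(U + R) = p := by
    rw [card_neg, card_compl, ZMod.card]
    have := card_le_univ (U + R)
    rw [ZMod.card] at this
    omega
  have hWU : #(-(U + R)ᶜ + R) + #U ≤ p := by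
    have hd : Disjoint (-(U + R)ᶜ + R) (-U) := by
      rw [disjoint_left]
      intro x hx hx'
      obtain ⟨w, hw, r, hr, rfl⟩ := mem_add.1 hx
      rw [mem_neg'] at hw hx'
      rw [mem_compl] at hw
      exact hw (mem_add.2 ⟨-(w + r), hx', r, hr, by ring⟩)
    have := card_le_univ ((-(U + R)ᶜ + R) ∪ (-U))
    rwa [card_union_of_disjoint hd, card_neg, ZMod.card] at this
  -- The dual set `-(U + R)ᶜ` is critical as well, hence at least as large as `U`. This keeps the
  -- Cauchy–Davenport minimum for `U ∪ (d +ᵥ U)` below `p`, and submodularity then contradicts it.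
  have := hmin _ (show Critical R (-(U + R)ᶜ) from ⟨by omega, by omega, by omega⟩)
  rcases min_le_iff.1 hJcd with h4 | h4 <;> omega

/-- Adding a pair of difference `d` to `R` enlarges it by `bd R d`, and criticality allows an
increase of only one. -/
theorem isAP_of_critical_pair {R U : Finset (ZMod p)} (hR : R.Nonempty) (h : Critical R U)
    (h2 : #U = 2) : IsAP R := by
  obtain ⟨a, b, hab, rfl⟩ := card_eq_two.1 h2
  obtain ⟨-, h3, h4⟩ := h
  have e : ({a, b} : Finset (ZMod p)) + R = a +ᵥ (R + {0, b - a}) := by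
    ext x
    simp only [mem_add, mem_vadd_iff, mem_insert, mem_singleton]
    constructor
    · rintro ⟨y, rfl | rfl, z, hz, rfl⟩
      · exact ⟨z, hz, 0, Or.inl rfl, by ring⟩
      · exact ⟨z, hz, y - a, Or.inr rfl, by ring⟩
    · rintro ⟨z, hz, y, rfl | rfl, h⟩
      · exact ⟨a, Or.inl rfl, z, hz, by linear_combination h⟩
      · exact ⟨b, Or.inr rfl, z, hz, by linear_combination h⟩
  rw [e, card_vadd_finset, card_add_pair] at h3 h4
  refine ⟨b - a, sub_ne_zero.2 hab.symm, ?_⟩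
  have := bd_pos (sub_ne_zero.2 hab.symm) hR (by omega)
  omega

/-- **Vosper's theorem**. -/
theorem vosper {R X : Finset (ZMod p)} (hR : 2 ≤ #R) (hX : 2 ≤ #X) (h2 : #(X + R) + 2 ≤ p)
    (hAP : ¬ IsAP R) : #X + #R ≤ #(X + R) := by
  by_contra hcon
  obtain ⟨U, hU, hUmin⟩ := exists_min_critical (show Critical R X from ⟨hX, h2, by omega⟩)
  have hRne : R.Nonempty := card_pos.1 (by omega)
  have hUne : U.Nonempty := card_pos.1 (by have := hU.1; omega)
  have hU3 : 3 ≤ #U := by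
    by_contra h
    exact hAP (isAP_of_critical_pair hRne hU (by have := hU.1; omega))
  have hUs := fun d hd => card_le_bd_add_one_of_min hRne hU hUmin (d := d) hd
  obtain ⟨hU1, hU2, hU4⟩ := hU
  rw [add_comm U R] at hU2 hU4
  -- The roles are exchanged: `R` is critical for `U`, so `U` has a minimal critical set `V` of its
  -- own.
  obtain ⟨V, hV, hVmin⟩ := exists_min_critical (show Critical U R from ⟨hR, hU2, by omega⟩)
  have hVs := fun d hd => card_le_bd_add_one_of_min hUne hV hVmin (d := d) hd
  have hV3 : 3 ≤ #V := by
    by_contra h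
    obtain ⟨d, hd, hd1⟩ := isAP_of_critical_pair hUne hV (by have := hV.1; omega)
    have := hUs d hd
    omega
  -- With `u = #U` and `v = #V`, both `3(v - 1)` and `3(u - 1)` are at most `#(V + U) ≤ u + v - 1`;
  -- this gives `u + v ≤ 4`, although both sizes are at least 3.
  have t1 := three_translates (Y := V) (m := #V - 1) hU3 (fun d hd => by have := hVs d hd; omega)
  have t2 := three_translates (Y := U) (m := #U - 1) hV3 (fun d hd => by have := hUs d hd; omega)
  rw [add_comm] at t2
  have := hV.2.2
  omega

/-- The boundary of `X + R` agrees with that of `X` when `R` is not a progression and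
`#(X + R) = #X + #R`. -/
theorem bd_add_eq {R X : Finset (ZMod p)} (hR : 2 ≤ #R) (hAP : ¬ IsAP R)
    (hXR : #(X + R) = #X + #R) {d : ZMod p} (h1 : bd X d + 2 ≤ #X)
    (h2 : #X + #R + bd X d + 2 ≤ p) : bd (X + R) d = bd X d := by
  have hI := card_inter_vadd X d
  have hJ := card_union_vadd X d
  have hsum := card_inter_add_union_add X (d +ᵥ X) R
  rw [vadd_add', card_vadd_finset] at hsum
  have hU : #(X ∪ (d +ᵥ X) + R) = #X + #R + bd (X + R) d := by
    rw [union_add, vadd_add', card_union_vadd, hXR]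
  have hIsub : #(X ∩ (d +ᵥ X) + R) ≤ #(X + R) :=
    card_le_card (add_subset_add_right inter_subset_left)
  -- The Vosper bounds for intersection and union add up to exactly the submodular upper bound, so
  -- both are equalities; the one for the union is the claim.
  have v1 := vosper hR (X := X ∩ (d +ᵥ X)) (by omega) (by omega) hAP
  have v2 := vosper hR (X := X ∪ (d +ᵥ X)) (by omega) (by omega) hAP
  omega

end Boundary
end RainbowNumber

namespace RainbowNumber
open Finset Pointwise

/-! ### Arithmetic progressions and their boundaries -/

section Progressions

variable {p : ℕ} [Fact p.Prime]

theorem IsAP.compl {X : Finset (ZMod p)} (h : IsAP X) : IsAP Xᶜ := by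
  obtain ⟨d, hd, h1⟩ := h
  exact ⟨d, hd, by rw [bd_compl, h1]⟩

/-- The progression `t, t - d, …, t - (n - 1) d`. -/
def seg (t d : ZMod p) (n : ℕ) : Finset (ZMod p) := (range n).image fun i : ℕ => t - i * d

theorem mem_seg {t d x : ZMod p} {n : ℕ} : x ∈ seg t d n ↔ ∃ i < n, t - (i : ZMod p) * d = x := by
  simp [seg]

theorem natCast_mul_ne {d : ZMod p} (hd : d ≠ 0) {n : ℕ} (h0 : 0 < n) (h1 : n < p) :
    (n : ZMod p) * d ≠ 0 := by
  refine mul_ne_zero ?_ hd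
  rw [Ne, ZMod.natCast_eq_zero_iff]
  exact fun h => absurd (Nat.le_of_dvd h0 h) (by omega)

theorem card_seg {t d : ZMod p} (hd : d ≠ 0) {n : ℕ} (hn : n ≤ p) : #(seg t d n) = n := by
  rw [seg, card_image_of_injOn, card_range]
  have key : ∀ i j : ℕ, i < j → j < n → t - (i : ZMod p) * d ≠ t - (j : ZMod p) * d := by
    intro i j hij hj h
    refine natCast_mul_ne hd (n := j - i) (by omega) (by omega) ?_
    rw [Nat.cast_sub hij.le]
    linear_combination h
  intro i hi j hj h
  simp only [coe_range, Set.mem_Iio] at hi hj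
  rcases lt_trichotomy i j with h1 | h1 | h1
  · exact absurd h (key i j h1 hj)
  · exact h1
  · exact absurd h.symm (key j i h1 hi)

theorem exists_eq_seg {X : Finset (ZMod p)} {d : ZMod p} (hd : d ≠ 0) (h : bd X d = 1) :
    ∃ t, X = seg t d #X := by
  have hXp : #X ≤ p := by simpa [ZMod.card] using card_le_univ X
  have hXne : #X < p := by
    by_contra hc
    have : X = univ := by
      rw [← card_eq_iff_eq_univ, ZMod.card]
      omega
    simp [this, bd] at h
  obtain ⟨t, ht⟩ := card_eq_one.1 h
  have ht' : ∀ x, x ∈ X → x + d ∉ X → x = t := by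
    intro x h1 h2
    have : x ∈ ({t} : Finset (ZMod p)) := by rw [← ht]; simp [h1, h2]
    simpa using this
  have htX : t ∈ X := by
    have : t ∈ ({t} : Finset (ZMod p)) := by simp
    rw [← ht, mem_filter] at this
    exact this.1
  refine ⟨t, ?_⟩
  have key : ∀ j ≤ #X, seg t d j ⊆ X := by
    intro j
    induction j with
    | zero => intro _ x hx; simp [mem_seg] at hx
    | succ j ih =>
      intro hj x hx
      have ih' := ih (by omega)
      obtain ⟨i, hi, rfl⟩ := mem_seg.1 hx
      rcases Nat.lt_succ_iff_lt_or_eq.1 hi with h1 | rfl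
      · exact ih' (mem_seg.2 ⟨i, h1, rfl⟩)
      · by_contra hnot
        have hi0 : i ≠ 0 := by
          rintro rfl
          simp [htX] at hnot
        -- If the chain backwards from the unique exit point `t` left `X` too early, the rest of `X`
        -- would be nonempty and stable under translation by `d`, hence everything.
        have hcl : ∀ y ∈ X \ seg t d i, y + d ∈ X \ seg t d i := by
          intro y hy
          rw [mem_sdiff] at hy ⊢
          constructor
          · by_contra hyd
            exact hy.2 (mem_seg.2 ⟨0, by omega, by simp [ht' y hy.1 hyd]⟩)
          · intro hyd
            obtain ⟨l, hl, he⟩ := mem_seg.1 hyd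
            have hy' : y = t - ((l + 1 : ℕ) : ZMod p) * d := by
              push_cast
              linear_combination -he
            rcases Nat.lt_or_ge (l + 1) i with h2 | h2
            · exact hy.2 (mem_seg.2 ⟨l + 1, h2, hy'.symm⟩)
            · have : l + 1 = i := by omega
              rw [this] at hy'
              exact hnot (hy' ▸ hy.1)
        have hne : (X \ seg t d i).Nonempty := by
          rw [← card_pos]
          have := le_card_sdiff (seg t d i) X
          rw [card_seg hd (by omega)] at this
          omega
        have := eq_univ_of_add_mem hd hne hcl
        have hm : t ∈ X \ seg t d i := by rw [this]; simp
        exact (mem_sdiff.1 hm).2 (mem_seg.2 ⟨0, by omega, by simp⟩)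
  exact (eq_of_subset_of_card_le (key _ le_rfl) (by rw [card_seg hd hXp])).symm

theorem min_le_bd_seg {t d : ZMod p} (hd : d ≠ 0) {n j : ℕ} (hj : 0 < j) (h : n + j ≤ p) :
    min j n ≤ bd (seg t d n) (j * d) := by
  have hsub : seg t d (min j n) ⊆ {x ∈ seg t d n | x + j * d ∉ seg t d n} := by
    intro x hx
    obtain ⟨i, hi, rfl⟩ := mem_seg.1 hx
    rw [mem_filter]
    refine ⟨mem_seg.2 ⟨i, by omega, rfl⟩, ?_⟩
    intro hc
    obtain ⟨l, hl, he⟩ := mem_seg.1 hc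
    refine natCast_mul_ne hd (n := j - i + l) (by omega) (by omega) ?_
    rw [Nat.cast_add, Nat.cast_sub (by omega)]
    linear_combination -he
  have := card_le_card hsub
  rwa [card_seg hd (by omega)] at this

/-- The boundary of a progression of difference `d` in the direction `± j d` is as large as
the sizes permit. -/
theorem min_le_bd_of_ap {X : Finset (ZMod p)} {d e : ZMod p} (hd : d ≠ 0) (h : bd X d = 1)
    (he : e ≠ 0) : ∃ j : ℕ, 0 < j ∧ 2 * j ≤ p ∧ (e = j * d ∨ e = -(j * d)) ∧
      min j (min #X (p - #X)) ≤ bd X e := by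
  obtain ⟨j, hj, hj2, hje⟩ : ∃ j : ℕ, 0 < j ∧ 2 * j ≤ p ∧ (e = j * d ∨ e = -(j * d)) := by
    set v := (e * d⁻¹).val with hv
    have hve : (v : ZMod p) * d = e := by
      rw [hv, ZMod.natCast_zmod_val, mul_assoc, inv_mul_cancel₀ hd, mul_one]
    have hvp : v < p := ZMod.val_lt _
    have hv0 : v ≠ 0 := by
      intro h0
      rw [h0] at hve
      simp at hve
      exact he hve.symm
    rcases Nat.lt_or_ge p (2 * v) with h1 | h1
    · refine ⟨p - v, by omega, by omega, Or.inr ?_⟩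
      rw [Nat.cast_sub hvp.le, ← hve]
      simp
    · exact ⟨v, by omega, h1, Or.inl hve.symm⟩
  refine ⟨j, hj, hj2, hje, ?_⟩
  have hb : bd X e = bd X (j * d) := by
    rcases hje with rfl | rfl
    · rfl
    · rw [bd_neg]
  rw [hb]
  -- Past half of `p` the complement, a progression with the same boundaries, takes over, so that no
  -- shift by `j * d` wraps around.
  rcases Nat.lt_or_ge p (2 * #X) with h1 | h1
  · have hc : bd Xᶜ d = 1 := by rw [bd_compl, h]
    obtain ⟨t, ht⟩ := exists_eq_seg hd hc
    have hcard : #Xᶜ = p - #X := by rw [card_compl, ZMod.card]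
    have := min_le_bd_seg (t := t) hd (n := #Xᶜ) hj (by omega)
    rw [← ht, bd_compl] at this
    omega
  · obtain ⟨t, ht⟩ := exists_eq_seg hd h
    have := min_le_bd_seg (t := t) hd (n := #X) hj (by omega)
    rw [← ht] at this
    omega

theorem eq_or_eq_neg_of_bd_eq_one {X : Finset (ZMod p)} {d e : ZMod p} (hd : d ≠ 0)
    (h : bd X d = 1) (he : e ≠ 0) (h1 : bd X e = 1) (h2 : 2 ≤ #X) (h3 : #X + 2 ≤ p) :
    e = d ∨ e = -d := by
  obtain ⟨j, hj, -, hje, hm⟩ := min_le_bd_of_ap hd h he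
  have : j = 1 := by omega
  simpa [this] using hje

theorem mem_four_of_bd_le_two {X : Finset (ZMod p)} {d e : ZMod p} (hd : d ≠ 0)
    (h : bd X d = 1) (he : e ≠ 0) (h1 : bd X e ≤ 2) (h2 : 3 ≤ #X) (h3 : #X + 3 ≤ p) :
    e = d ∨ e = -d ∨ e = 2 * d ∨ e = -(2 * d) := by
  obtain ⟨j, hj, -, hje, hm⟩ := min_le_bd_of_ap hd h he
  have : j = 1 ∨ j = 2 := by omega
  rcases this with rfl | rfl
  · rcases hje with h | h <;> simp [h]
  · rcases hje with h | h <;> simp [h]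

/-- Adding `{0, d}` lengthens each run by one step; runs may merge but none is created. -/
theorem bd_add_pair_le (X : Finset (ZMod p)) (d : ZMod p) : bd (X + {0, d}) d ≤ bd X d := by
  unfold bd
  refine card_le_card_of_injOn (fun x => x - d) ?_ (fun x _ y _ h => sub_left_injective h)
  intro x hx
  have hmem : ∀ y, y ∈ X + {0, d} ↔ y ∈ X ∨ y - d ∈ X := by
    intro y
    simp only [mem_add, mem_insert, mem_singleton]
    constructor
    · rintro ⟨z, hz, w, rfl | rfl, rfl⟩
      · left; simpa using hz
      · right; simpa using hz
    · rintro (h | h)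
      · exact ⟨y, h, 0, Or.inl rfl, by simp⟩
      · exact ⟨y - d, h, d, Or.inr rfl, by simp⟩
  simp only [coe_filter, Set.mem_ofPred_eq, hmem, add_sub_cancel_right, not_or,
    sub_add_cancel] at hx ⊢
  tauto

/-- The second term of the progression adds `bd X d` elements, and every later term at least one as
long as the sumset is proper. -/
theorem card_add_seg_ge {X : Finset (ZMod p)} (hX : X.Nonempty) {t d : ZMod p} (hd : d ≠ 0)
    (m : ℕ) (h : #(X + seg t d (m + 2)) < p) :
    #X + bd X d + m ≤ #(X + seg t d (m + 2)) := by
  have step : ∀ n, (X + seg t d (n + 1)) ∪ (-d +ᵥ (X + seg t d (n + 1))) ⊆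
      X + seg t d (n + 2) := by
    intro n x hx
    rw [mem_union, mem_vadd_iff] at hx
    rcases hx with hx | hx
    · obtain ⟨y, hy, z, hz, rfl⟩ := mem_add.1 hx
      obtain ⟨i, hi, rfl⟩ := mem_seg.1 hz
      exact mem_add.2 ⟨y, hy, _, mem_seg.2 ⟨i, by omega, rfl⟩, rfl⟩
    · obtain ⟨y, hy, z, hz, he⟩ := mem_add.1 hx
      obtain ⟨i, hi, rfl⟩ := mem_seg.1 hz
      refine mem_add.2 ⟨y, hy, _, mem_seg.2 ⟨i + 1, by omega, rfl⟩, ?_⟩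
      push_cast
      linear_combination he
  have step' : ∀ n, #(X + seg t d (n + 1)) + bd (X + seg t d (n + 1)) d ≤
      #(X + seg t d (n + 2)) := by
    intro n
    rw [← bd_neg, ← card_union_vadd]
    exact card_le_card (step n)
  induction m with
  | zero =>
    have h1 := step' 0
    have h2 : X + seg t d 1 = t +ᵥ X := by
      ext x
      rw [mem_vadd_iff, mem_add]
      constructor
      · rintro ⟨y, hy, z, hz, rfl⟩
        obtain ⟨i, hi, rfl⟩ := mem_seg.1 hz
        obtain rfl : i = 0 := by omega
        simpa using hy
      · intro h
        exact ⟨x - t, h, t, mem_seg.2 ⟨0, by omega, by simp⟩, by ring⟩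
    simp only [zero_add] at h1
    rw [h2, card_vadd_finset, bd_vadd] at h1
    simpa using h1
  | succ m ih =>
    have h1 : #(X + seg t d (m + 2)) + bd (X + seg t d (m + 2)) d ≤
      #(X + seg t d (m + 1 + 2)) := step' (m + 1)
    have h2 := ih (by omega)
    have h3 : 0 < bd (X + seg t d (m + 2)) d := by
      refine bd_pos hd ?_ (by omega)
      exact hX.add ⟨t, mem_seg.2 ⟨0, by omega, by simp⟩⟩
    omega

theorem card_add_bd_add_le {X R : Finset (ZMod p)} {d : ZMod p} (hd : d ≠ 0)
    (hR : bd R d = 1) (h2 : 2 ≤ #R) (hX : X.Nonempty) (hp : #(X + R) < p) :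
    #X + bd X d + #R ≤ #(X + R) + 2 := by
  obtain ⟨t, ht⟩ := exists_eq_seg hd hR
  obtain ⟨m, hm⟩ : ∃ m, #R = m + 2 := ⟨#R - 2, by omega⟩
  rw [hm] at ht
  have := card_add_seg_ge hX (t := t) hd m (by rwa [← ht])
  rw [← ht] at this
  omega

theorem bd_le_two_of_card_add_le {X R : Finset (ZMod p)} {d : ZMod p} (hd : d ≠ 0)
    (hR : bd R d = 1) (h2 : 2 ≤ #R) (hX : X.Nonempty) (h : #(X + R) ≤ #X + #R)
    (hp : #(X + R) < p) : bd X d ≤ 2 := by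
  have := card_add_bd_add_le hd hR h2 hX hp
  omega

/-- If every proper translate met `X` in at most one element, three translates would give `3(#X - 1)
≤ #X + #Y ≤ 2 * #X`, hence `#X ≤ 3`. -/
theorem exists_bd_add_two_le {X Y : Finset (ZMod p)} (h : #(X + Y) ≤ #X + #Y) (hY : 3 ≤ #Y)
    (hYX : #Y ≤ #X) (hX : 4 ≤ #X) : ∃ d ≠ 0, bd X d + 2 ≤ #X := by
  by_contra hc
  push Not at hc
  have := three_translates hY (Y := X) (m := #X - 1) (fun d hd => by have := hc d hd; omega)
  omega

theorem isAP_of_card_two {X : Finset (ZMod p)} (hp : 3 ≤ p) (h : #X = 2) : IsAP X := by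
  obtain ⟨x, y, hxy, rfl⟩ := card_eq_two.1 h
  refine ⟨y - x, sub_ne_zero.2 hxy.symm, ?_⟩
  have h1 := bd_pos (sub_ne_zero.2 hxy.symm) (X := {x, y}) ⟨x, by simp⟩ (by omega)
  have h2 : #({z ∈ ({x, y} : Finset (ZMod p)) | z + (y - x) ∉ ({x, y} : Finset (ZMod p))}) ≤
      #{y} := by
    refine card_le_card ?_
    intro z hz
    simp only [mem_filter, mem_insert, mem_singleton] at hz ⊢
    rcases hz with ⟨rfl | rfl, h⟩
    · simp at h
    · rfl
  rw [card_singleton] at h2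
  unfold bd at h1 ⊢
  omega

theorem two_le_bd {X : Finset (ZMod p)} (hX : ¬ IsAP X) (hne : X.Nonempty) (hp : #X < p)
    {d : ZMod p} (hd : d ≠ 0) : 2 ≤ bd X d := by
  have h1 := bd_pos hd hne hp
  have h2 : bd X d ≠ 1 := fun h => hX ⟨d, hd, h⟩
  omega

end Progressions
end RainbowNumber

namespace RainbowNumber
open Finset Pointwise

/-! ### Partitions without rainbow solutions -/

section Partitions

variable {p : ℕ} [Fact p.Prime] {a : Fin 3 → ZMod p}

/-- No solution of `∑ a i * x i = 0` has one member in each of `X`, `Y`, `Z`. -/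
def Free (a : Fin 3 → ZMod p) (X Y Z : Finset (ZMod p)) : Prop :=
  ∀ i j k : Fin 3, i ≠ j → j ≠ k → i ≠ k → ∀ x ∈ X, ∀ y ∈ Y, ∀ z ∈ Z,
    a i * x + a j * y + a k * z ≠ 0

/-- A partition of `ℤ/pℤ` into three nonempty classes, without rainbow solutions. -/
structure Part (a : Fin 3 → ZMod p) (X Y Z : Finset (ZMod p)) : Prop where
  ne : ∀ i, a i ≠ 0
  free : Free a X Y Z
  disj₁₂ : Disjoint X Y
  disj₁₃ : Disjoint X Z
  disj₂₃ : Disjoint Y Z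
  card : #X + #Y + #Z = p
  pos₁ : X.Nonempty
  pos₂ : Y.Nonempty
  pos₃ : Z.Nonempty

variable {X Y Z : Finset (ZMod p)}

theorem Part.swap₁₂ (h : Part a X Y Z) : Part a Y X Z where
  ne := h.ne
  free i j k hij hjk hik x hx y hy z hz hs :=
    h.free j i k hij.symm hik hjk y hy x hx z hz (by linear_combination hs)
  disj₁₂ := h.disj₁₂.symm
  disj₁₃ := h.disj₂₃
  disj₂₃ := h.disj₁₃
  card := by have := h.card; omega
  pos₁ := h.pos₂
  pos₂ := h.pos₁
  pos₃ := h.pos₃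

theorem Part.swap₂₃ (h : Part a X Y Z) : Part a X Z Y where
  ne := h.ne
  free i j k hij hjk hik x hx y hy z hz hs :=
    h.free i k j hik hjk.symm hij x hx z hz y hy (by linear_combination hs)
  disj₁₂ := h.disj₁₃
  disj₁₃ := h.disj₁₂
  disj₂₃ := h.disj₂₃.symm
  card := by have := h.card; omega
  pos₁ := h.pos₁
  pos₂ := h.pos₃
  pos₃ := h.pos₂

theorem Part.swap₁₃ (h : Part a X Y Z) : Part a Z Y X := h.swap₁₂.swap₂₃.swap₁₂

theorem Part.rot (h : Part a X Y Z) : Part a Y Z X := h.swap₁₂.swap₂₃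

theorem exists_third {i j : Fin 3} (h : i ≠ j) : ∃ k, j ≠ k ∧ i ≠ k := by
  revert h
  revert i j
  decide

theorem Part.div_ne (h : Part a X Y Z) (i j : Fin 3) : a i / a j ≠ 0 :=
  div_ne_zero (h.ne i) (h.ne j)

/-- Dividing the equation by `a j` turns freeness into a statement about sumsets, the only form used
from here on for large classes. -/
theorem Part.disjoint_add (h : Part a X Y Z) {i j k : Fin 3} (hij : i ≠ j) (hjk : j ≠ k)
    (hik : i ≠ k) : Disjoint ((a i / a j) • X + Y) ((-(a k / a j)) • Z) := by
  rw [disjoint_left]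
  intro s hs hz
  obtain ⟨x', hx', y, hy, rfl⟩ := mem_add.1 hs
  obtain ⟨x, hx, rfl⟩ := mem_smul_finset.1 hx'
  obtain ⟨z, hz, he⟩ := mem_smul_finset.1 hz
  refine h.free i j k hij hjk hik x hx y hy z hz ?_
  have := h.ne j
  simp only [smul_eq_mul] at he
  field_simp at he
  linear_combination -he

theorem Part.card_add_le (h : Part a X Y Z) {i j : Fin 3} (hij : i ≠ j) :
    #((a i / a j) • X + Y) ≤ #X + #Y := by
  obtain ⟨k, hjk, hik⟩ := exists_third hij
  have h1 := card_le_univ (((a i / a j) • X + Y) ∪ ((-(a k / a j)) • Z))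
  rw [card_union_of_disjoint (h.disjoint_add hij hjk hik), ZMod.card,
    card_smul_finset₀ (neg_ne_zero.2 (h.div_ne k j))] at h1
  have := h.card
  omega

/-- A progression `Y` of difference `d` adds at least `bd X' d + #Y - 2` elements to a dilate `X'`
of `X`, while freeness leaves room for `#Y`. -/
theorem Part.bd_le_two (h : Part a X Y Z) {d : ZMod p} (hd : d ≠ 0) (hY : bd Y d = 1)
    (h2 : 2 ≤ #Y) {i j : Fin 3} (hij : i ≠ j) : bd X (a i / a j * d) ≤ 2 := by
  have h1 := h.card_add_le hij.symm
  have h3 : a j / a i * (a i / a j * d) = d := by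
    have := h.ne i
    have := h.ne j
    field_simp
  rw [← bd_smul X _ (h.div_ne j i), h3]
  have h4 : 0 < #Z := card_pos.2 h.pos₃
  have h5 := h.card
  have h6 : #((a j / a i) • X) = #X := card_smul_finset₀ (h.div_ne j i) X
  refine bd_le_two_of_card_add_le hd hY h2 ?_ (by omega) (by omega)
  exact h.pos₁.smul_finset

theorem Part.card_add_eq (h : Part a X Y Z) (hY : ¬ IsAP Y) (hX2 : 2 ≤ #X) (hY2 : 2 ≤ #Y)
    (hZ2 : 2 ≤ #Z) {i j : Fin 3} (hij : i ≠ j) : #((a i / a j) • X + Y) = #X + #Y := by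
  have h6 : #((a i / a j) • X) = #X := card_smul_finset₀ (h.div_ne i j) X
  have h1 := h.card_add_le hij
  have h5 := h.card
  have := vosper hY2 (X := (a i / a j) • X) (by omega) (by omega) hY
  omega

/-- By equality in Vosper's bound, the dilate of `Z` is exactly the complement of the sumset;
`bd_add_eq` then moves the boundary from `X` to the sumset, and complements share boundaries. -/
theorem Part.bd_eq (h : Part a X Y Z) (hY : ¬ IsAP Y) (hX2 : 2 ≤ #X) (hY2 : 2 ≤ #Y)
    (hZ2 : 2 ≤ #Z) {d : ZMod p} (h1 : bd X d + 2 ≤ #X) (h2 : bd X d + 2 ≤ #Z) {i k : Fin 3}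
    (hik : i ≠ k) : bd Z (a i / a k * d) = bd X d := by
  obtain ⟨j, hkj, hij⟩ := exists_third hik
  have hc := h.card_add_eq hY hX2 hY2 hZ2 hij
  have h6 : #((a i / a j) • X) = #X := card_smul_finset₀ (h.div_ne i j) X
  have h7 : #((-(a k / a j)) • Z) = #Z :=
    card_smul_finset₀ (neg_ne_zero.2 (h.div_ne k j)) Z
  have h5 := h.card
  have hd := h.disjoint_add hij hkj.symm hik
  have he : (-(a k / a j)) • Z = ((a i / a j) • X + Y)ᶜ := by
    refine eq_of_subset_of_card_le ?_ (by rw [card_compl, ZMod.card]; omega)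
    intro z hz
    rw [mem_compl]
    exact fun hc => disjoint_left.1 hd hc hz
  have h8 := bd_add_eq hY2 hY (X := (a i / a j) • X) (d := a i / a j * d) (by omega)
    (by rw [bd_smul X d (h.div_ne i j)]; omega) (by rw [bd_smul X d (h.div_ne i j)]; omega)
  rw [bd_smul X d (h.div_ne i j), ← bd_compl, ← he] at h8
  rw [← h8, ← bd_smul Z _ (neg_ne_zero.2 (h.div_ne k j)), ← bd_neg]
  congr 1
  have := h.ne k
  have := h.ne j
  field_simp

/-- Transport from `X` to `Z` by `a i / a k`, then back to `X` by `a k / a j`. -/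
theorem Part.bd_mul_eq (h : Part a X Y Z) (hY : ¬ IsAP Y) (hX2 : 2 ≤ #X) (hY2 : 2 ≤ #Y)
    (hZ2 : 2 ≤ #Z) {d : ZMod p} (h1 : bd X d + 2 ≤ #X) (h2 : bd X d + 2 ≤ #Z) {i j : Fin 3}
    (hij : i ≠ j) : bd X (a i / a j * d) = bd X d := by
  obtain ⟨k, hjk, hik⟩ := exists_third hij
  have h3 := h.bd_eq hY hX2 hY2 hZ2 h1 h2 hik
  have h4 := h.swap₁₃.bd_eq hY hZ2 hY2 hX2 (d := a i / a k * d) (by omega) (by omega) hjk.symm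
  rw [h3] at h4
  rw [← h4]
  congr 1
  have := h.ne k
  have := h.ne j
  field_simp

theorem Part.bd_self_eq (h : Part a X Y Z) (hY : ¬ IsAP Y) (hX2 : 2 ≤ #X) (hY2 : 2 ≤ #Y)
    (hZ2 : 2 ≤ #Z) {d : ZMod p} (h1 : bd X d + 2 ≤ #X) (h2 : bd X d + 2 ≤ #Z) :
    bd Z d = bd X d := by
  have h3 := h.bd_mul_eq hY hX2 hY2 hZ2 h1 h2 (show (0 : Fin 3) ≠ 1 by decide)
  have h4 := h.bd_eq hY hX2 hY2 hZ2 (d := a 0 / a 1 * d) (by omega) (by omega)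
    (show (1 : Fin 3) ≠ 0 by decide)
  rw [h3] at h4
  rw [← h4]
  congr 1
  have := h.ne 0
  have := h.ne 1
  field_simp

/-! ### Invariant sets -/

/-- There is a nonempty proper subset of `(ℤ/pℤ) \ {0}` closed under all the maps
`x ↦ -(a i / a j) * x`. -/
def Inv (a : Fin 3 → ZMod p) : Prop :=
  ∃ K : Finset (ZMod p), 0 ∉ K ∧ K.Nonempty ∧ (∃ u, u ≠ 0 ∧ u ∉ K) ∧
    ∀ i j : Fin 3, i ≠ j → ∀ x ∈ K, -(a i / a j * x) ∈ K

/-- The `n`-th roots of unity are the invariant set: proper because the unit group is cyclic of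
order `p - 1 > n`, and closed under the sign because `n` is even. -/
theorem inv_of_pow {n : ℕ} (hn : Even n) (h0 : 0 < n) (h1 : n < p - 1)
    (h : ∀ i j : Fin 3, i ≠ j → (a i / a j) ^ n = 1) : Inv a := by
  refine ⟨univ.filter (· ^ n = 1), by simp [h0.ne'], ⟨1, by simp⟩, ?_, ?_⟩
  · by_contra hc
    push Not at hc
    have : ∀ x : (ZMod p)ˣ, x ^ n = 1 := by
      intro x
      have := hc x x.ne_zero
      ext
      simpa using this
    rw [FiniteField.forall_pow_eq_one_iff, ZMod.card] at this
    exact absurd (Nat.le_of_dvd h0 this) (by omega)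
  · intro i j hij x hx
    rw [mem_filter] at hx ⊢
    exact ⟨mem_univ _, by rw [hn.neg_pow, mul_pow, h i j hij, hx.2, one_mul]⟩

theorem ne_neg_self {x : ZMod p} (hp : 3 ≤ p) (hx : x ≠ 0) : x ≠ -x := by
  intro h
  have : ((2 : ℕ) : ZMod p) * x = 0 := by push_cast; linear_combination h
  exact natCast_mul_ne hx (by norm_num) (by omega) this

theorem six_le_card {D : Finset (ZMod p)} (hp : 3 ≤ p) (h0 : 0 ∉ D) (hs : ∀ x ∈ D, -x ∈ D)
    {x y z : ZMod p} (hx : x ∈ D) (hy : y ∈ D) (hz : z ∈ D) (h1 : x ≠ y) (h2 : x ≠ -y)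
    (h3 : x ≠ z) (h4 : x ≠ -z) (h5 : y ≠ z) (h6 : y ≠ -z) :
    #({x, -x, y, -y, z, -z} : Finset (ZMod p)) = 6 ∧ {x, -x, y, -y, z, -z} ⊆ D := by
  have e1 := ne_neg_self hp (x := x) (fun h => h0 (h ▸ hx))
  have e2 := ne_neg_self hp (x := y) (fun h => h0 (h ▸ hy))
  have e3 := ne_neg_self hp (x := z) (fun h => h0 (h ▸ hz))
  have f2 : -x ≠ y := fun h => h2 (by rw [← h, neg_neg])
  have f4 : -x ≠ z := fun h => h4 (by rw [← h, neg_neg])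
  have f6 : -y ≠ z := fun h => h6 (by rw [← h, neg_neg])
  constructor
  · simp [card_insert_of_notMem, *]
  · simp [insert_subset_iff, *]

/-- Unless all ratios are fourth roots of unity, some ratio `r` gives four distinct elements `±r`,
`±r⁻¹`. Five directions leave no room for another pair, so every ratio is one of these, and the
product of the three cyclic ratios being 1 forces `r ^ 6 = 1`. -/
theorem inv_of_card_le_five (hp : 11 ≤ p) (ha : ∀ i, a i ≠ 0) {D : Finset (ZMod p)}
    {d : ZMod p} (hD : #D ≤ 5) (h0 : 0 ∉ D) (hs : ∀ x ∈ D, -x ∈ D)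
    (h : ∀ i j : Fin 3, i ≠ j → a i / a j * d ∈ D) : Inv a := by
  by_cases h4 : ∀ i j : Fin 3, i ≠ j → (a i / a j) ^ 4 = 1
  · exact inv_of_pow (by decide) (by norm_num) (by omega) h4
  push Not at h4
  obtain ⟨i, j, hij, h4⟩ := h4
  obtain ⟨k, hjk, hik⟩ := exists_third hij
  have hi := ha i
  have hj := ha j
  have hk := ha k
  have hd : d ≠ 0 := by
    rintro rfl
    exact h0 (by simpa using h 0 1 (by decide))
  have hrs : ∀ u v : Fin 3, u ≠ v → a u / a v = a i / a j ∨ a u / a v = -(a i / a j) ∨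
      a u / a v = a j / a i ∨ a u / a v = -(a j / a i) := by
    intro u v huv
    by_contra hc
    push Not at hc
    obtain ⟨c1, c2, c3, c4⟩ := hc
    have m : ∀ x y : ZMod p, x ≠ y → x * d ≠ y * d := fun x y h e => h (mul_right_cancel₀ hd e)
    have m1 : a i / a j ≠ a j / a i := by
      intro e
      field_simp at e
      refine h4 ?_
      field_simp
      linear_combination (a i ^ 2 + a j ^ 2) * e
    have m2 : a i / a j ≠ -(a j / a i) := by
      intro e
      field_simp at e
      refine h4 ?_
      field_simp
      linear_combination (a i ^ 2 - a j ^ 2) * e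
    have := six_le_card (by omega) h0 hs (h i j hij) (h j i hij.symm) (h u v huv)
      (m _ _ m1) (by rw [← neg_mul]; exact m _ _ m2) (m _ _ c1.symm)
      (by rw [← neg_mul]; exact m _ _ (fun h => c2 (by rw [h, neg_neg]))) (m _ _ c3.symm)
      (by rw [← neg_mul]; exact m _ _ (fun h => c4 (by rw [h, neg_neg])))
    have h7 := card_le_card this.2
    omega
  have hi6 : (a i / a j) ^ 6 = 1 := by
    set r := a i / a j with hr
    have hr0 : r ≠ 0 := div_ne_zero hi hj
    have hinv : a j / a i = r⁻¹ := by rw [hr, inv_div]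
    have hprod : r * (a j / a k) * (a k / a i) = 1 := by rw [hr]; field_simp
    have h1 := hrs j k hjk
    have h2 := hrs k i hik.symm
    rw [hinv] at h1 h2
    rcases h1 with h1 | h1 | h1 | h1 <;> rcases h2 with h2 | h2 | h2 | h2 <;>
      rw [h1, h2] at hprod <;> field_simp at hprod
    all_goals grind
  have hj6 : (a j / a i) ^ 6 = 1 := by
    rw [← inv_div, inv_pow, hi6, inv_one]
  refine inv_of_pow (n := 6) (by decide) (by norm_num) (by omega) ?_
  intro u v huv
  rcases hrs u v huv with e | e | e | e <;> rw [e]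
  · exact hi6
  · rw [Even.neg_pow (by decide), hi6]
  · exact hj6
  · rw [Even.neg_pow (by decide), hj6]

/-- Products of two ratios include 1, so `±d`, `±r d`, `±r⁻¹ d` already fill `D`. Then `r ^ 2` is
among `±1`, `±r`, `±r⁻¹`, and `r ^ 4 ≠ 1` leaves only `r ^ 3 = ±1`. -/
theorem inv_of_card_le_six (hp : 11 ≤ p) (ha : ∀ i, a i ≠ 0) {D : Finset (ZMod p)}
    {d : ZMod p} (hD : #D ≤ 6) (h0 : 0 ∉ D) (hs : ∀ x ∈ D, -x ∈ D)
    (h : ∀ i j k l : Fin 3, i ≠ j → k ≠ l → a i / a j * (a k / a l * d) ∈ D) : Inv a := by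
  by_cases h4 : ∀ i j : Fin 3, i ≠ j → (a i / a j) ^ 4 = 1
  · exact inv_of_pow (by decide) (by norm_num) (by omega) h4
  push Not at h4
  obtain ⟨i, j, hij, h4⟩ := h4
  have hd : d ≠ 0 := by
    rintro rfl
    exact h0 (by simpa using h 0 1 0 1 (by decide) (by decide))
  have h1 : ∀ u v : Fin 3, u ≠ v → a u / a v * d ∈ D := by
    intro u v huv
    obtain ⟨w, hvw, huw⟩ := exists_third huv
    have := h u w w v huw hvw.symm
    have e : a u / a w * (a w / a v * d) = a u / a v * d := by
      have := ha v
      have := ha w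
      field_simp
    rwa [e] at this
  have h2 : d ∈ D := by
    have := h i j j i hij hij.symm
    have e : a i / a j * (a j / a i * d) = d := by
      have := ha i
      have := ha j
      field_simp
    rwa [e] at this
  have hijD := h1 i j hij
  obtain ⟨r, hr⟩ : ∃ r, r = a i / a j := ⟨_, rfl⟩
  have hr0 : r ≠ 0 := hr ▸ div_ne_zero (ha i) (ha j)
  rw [← hr] at h4 hijD
  have hinv : a j / a i = r⁻¹ := by rw [hr, inv_div]
  have hirD : r⁻¹ * d ∈ D := by rw [← hinv]; exact h1 j i hij.symm
  have n1 : r ≠ 1 := by rintro e; exact h4 (by rw [e]; ring)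
  have n2 : r ≠ -1 := by rintro e; exact h4 (by rw [e]; ring)
  have n3 : r ^ 2 ≠ 1 := by rintro e; exact h4 (by linear_combination (r ^ 2 + 1) * e)
  have n4 : r ^ 2 ≠ -1 := by rintro e; exact h4 (by linear_combination (r ^ 2 - 1) * e)
  have hsix := six_le_card (by omega) h0 hs h2 hijD hirD
    (fun e => n1 (mul_right_cancel₀ hd (by rw [one_mul]; exact e.symm)))
    (fun e => n2 (mul_right_cancel₀ hd (by linear_combination e)))
    (fun e => n1 (mul_right_cancel₀ hd (by
      have : r * d = r * (r⁻¹ * d) := by rw [← e]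
      rw [this, ← mul_assoc, mul_inv_cancel₀ hr0])))
    (fun e => n2 (mul_right_cancel₀ hd (by
      have : r * d = r * -(r⁻¹ * d) := by rw [← e]
      rw [this, mul_neg, ← mul_assoc, mul_inv_cancel₀ hr0]; ring)))
    (fun e => n3 (by
      have := mul_right_cancel₀ hd e
      rw [sq]; nth_rewrite 1 [this]; exact inv_mul_cancel₀ hr0))
    (fun e => n4 (by
      have : r = -r⁻¹ := mul_right_cancel₀ hd (by rw [neg_mul]; exact e)
      rw [sq]; nth_rewrite 2 [this]; rw [mul_neg, mul_inv_cancel₀ hr0]))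
  have hall : ∀ x, x * d ∈ D → x = 1 ∨ x = -1 ∨ x = r ∨ x = -r ∨ x = r⁻¹ ∨ x = -r⁻¹ := by
    intro x hx
    rw [← eq_of_subset_of_card_le hsix.2 (by omega)] at hx
    simp only [mem_insert, mem_singleton, ← neg_mul] at hx
    have m : ∀ y : ZMod p, x * d = y * d → x = y := fun y h => mul_right_cancel₀ hd h
    rcases hx with hx | hx | hx | hx | hx | hx
    · exact Or.inl (m 1 (by rw [hx, one_mul]))
    · exact Or.inr (Or.inl (m (-1) (by rw [hx]; ring)))
    · simp [m _ hx]
    · simp [m _ hx]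
    · simp [m _ hx]
    · simp [m _ hx]
  have hr6 : r ^ 6 = 1 := by
    have := h i j i j hij hij
    rw [← hr, ← mul_assoc] at this
    rcases hall _ this with e | e | e | e | e | e <;> field_simp at e <;> grind
  refine inv_of_pow (n := 6) (by decide) (by norm_num) (by omega) ?_
  intro u v huv
  rcases hall _ (h1 u v huv) with e | e | e | e | e | e <;> rw [e]
  · simp
  · rw [Even.neg_pow (by decide), one_pow]
  · exact hr6
  · rw [Even.neg_pow (by decide), hr6]
  · rw [inv_pow, hr6, inv_one]
  · rw [Even.neg_pow (by decide), inv_pow, hr6, inv_one]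

end Partitions
end RainbowNumber

namespace RainbowNumber
open Finset Pointwise

/-! ### Partitions into three classes -/

section ThreeClasses

variable {p : ℕ} [Fact p.Prime] {a : Fin 3 → ZMod p} {X Y Z : Finset (ZMod p)}

theorem Part.union_eq (h : Part a X Y Z) : X ∪ Y ∪ Z = univ := by
  rw [← card_eq_iff_eq_univ, card_union_of_disjoint (disjoint_union_left.2 ⟨h.disj₁₃, h.disj₂₃⟩),
    card_union_of_disjoint h.disj₁₂, ZMod.card]
  exact h.card

theorem Part.cover (h : Part a X Y Z) (x : ZMod p) : x ∈ X ∨ x ∈ Y ∨ x ∈ Z := by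
  have : x ∈ X ∪ Y ∪ Z := h.union_eq ▸ mem_univ x
  simpa [or_assoc] using this

theorem Part.ne_univ (h : Part a X Y Z) : X ≠ univ := by
  rintro rfl
  obtain ⟨y, hy⟩ := h.pos₂
  exact disjoint_left.1 h.disj₁₂ (mem_univ y) hy

/-- Two affine maps preserving a nonempty proper subset commute. -/
theorem affine_comm {W : Finset (ZMod p)} (hne : W.Nonempty) (hW : W ≠ univ)
    {α β γ δ : ZMod p} (hα : α ≠ 0) (hγ : γ ≠ 0) (hf : ∀ x ∈ W, α * x + β ∈ W)
    (hg : ∀ x ∈ W, γ * x + δ ∈ W) : α * δ + β = γ * β + δ := by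
  by_contra hc
  refine hW (eq_univ_of_add_mem (sub_ne_zero.2 hc) hne ?_)
  intro w hw
  -- The composite permutes the finite set `W`, so the commutator, a translation, maps `W` into
  -- itself.
  have hsurj : W.image (fun x => γ * (α * x + β) + δ) = W := by
    refine eq_of_subset_of_card_le (image_subset_iff.2 fun x hx => hg _ (hf x hx)) ?_
    rw [card_image_of_injective]
    intro x y hxy
    exact mul_left_cancel₀ hα (add_right_cancel (mul_left_cancel₀ hγ (add_right_cancel hxy)))
  rw [← hsurj] at hw
  obtain ⟨x, hx, rfl⟩ := mem_image.1 hw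
  have := hf _ (hg x hx)
  convert this using 1
  ring

/-- Solving the equation with `s` in position `i` and `x` in position `j` cannot land in `Z`; it
lands on `s` for a single `x`, the point excluded by `hw`. -/
theorem Part.singleton_closed {s : ZMod p} (h : Part a {s} Y Z) {i j k : Fin 3} (hij : i ≠ j)
    (hjk : j ≠ k) (hik : i ≠ k) (hw : -((a i + a k) / a j * s) ∉ Y) :
    ∀ x ∈ Y, -(a j / a k) * x + -(a i / a k * s) ∈ Y := by
  intro x hx
  have hj := h.ne j
  have hk := h.ne k
  rcases h.cover (-(a j / a k) * x + -(a i / a k * s)) with h1 | h1 | h1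
  · refine absurd hx ?_
    rw [mem_singleton] at h1
    have : x = -((a i + a k) / a j * s) := by
      field_simp at h1 ⊢
      linear_combination -h1
    rwa [this]
  · exact h1
  · exact absurd (by field_simp; ring) (h.free i j k hij hjk hik s (mem_singleton_self s) x hx _ h1)

/-- Two cyclically related affine maps preserve `Y`, so they commute; the identity obtained is the
commutation relation with denominators cleared. -/
theorem Part.singleton_pair {s : ZMod p} (h : Part a {s} Y Z) {i j k : Fin 3} (hij : i ≠ j)
    (hjk : j ≠ k) (hik : i ≠ k) (hw : -((a i + a k) / a j * s) ∉ Y)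
    (hw' : -((a j + a i) / a k * s) ∉ Y) : s * (a i + a j + a k) * (a i - a j) = 0 := by
  have hf := h.singleton_closed hij hjk hik hw
  have hg := h.singleton_closed hjk hik.symm hij.symm hw'
  have := affine_comm h.pos₂ h.swap₁₂.ne_univ (neg_ne_zero.2 (h.div_ne j k))
    (neg_ne_zero.2 (h.div_ne k i)) hf hg
  have hi := h.ne i
  have hj := h.ne j
  have hk := h.ne k
  field_simp at this
  linear_combination -this

theorem Part.vadd (h : Part a X Y Z) (hs : a 0 + a 1 + a 2 = 0) (c : ZMod p) :
    Part a (c +ᵥ X) (c +ᵥ Y) (c +ᵥ Z) where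
  ne := h.ne
  free i j k hij hjk hik x hx y hy z hz hsum := by
    rw [mem_vadd_iff] at hx hy hz
    refine h.free i j k hij hjk hik _ hx _ hy _ hz ?_
    have : a i + a j + a k = 0 := by
      rw [← hs]
      revert hij hjk hik
      fin_cases i <;> fin_cases j <;> fin_cases k <;> simp <;> ring
    linear_combination hsum - c * this
  disj₁₂ := by
    rw [disjoint_left]
    intro x
    simp only [mem_vadd_iff]
    exact fun h1 h2 => disjoint_left.1 h.disj₁₂ h1 h2
  disj₁₃ := by
    rw [disjoint_left]
    intro x
    simp only [mem_vadd_iff]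
    exact fun h1 h2 => disjoint_left.1 h.disj₁₃ h1 h2
  disj₂₃ := by
    rw [disjoint_left]
    intro x
    simp only [mem_vadd_iff]
    exact fun h1 h2 => disjoint_left.1 h.disj₂₃ h1 h2
  card := by simpa [card_vadd_finset] using h.card
  pos₁ := h.pos₁.vadd_finset
  pos₂ := h.pos₂.vadd_finset
  pos₃ := h.pos₃.vadd_finset

theorem Part.neg_mem_of_zero (h : Part a {0} Y Z) {i j : Fin 3} (hij : i ≠ j) {x : ZMod p}
    (hx : x ∈ Y) : -(a i / a j * x) ∈ Y := by
  obtain ⟨k, hjk, hik⟩ := exists_third hij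
  have := h.singleton_closed hik.symm hij hjk.symm (by
    have := disjoint_left.1 h.disj₁₂ (mem_singleton_self 0)
    simpa using this) x hx
  simpa using this

theorem Part.inv_of_zero (h : Part a {0} Y Z) : Inv a := by
  refine ⟨Y, disjoint_left.1 h.disj₁₂ (mem_singleton_self 0), h.pos₂, ?_,
    fun i j hij x hx => h.neg_mem_of_zero hij hx⟩
  obtain ⟨z, hz⟩ := h.pos₃
  refine ⟨z, ?_, disjoint_right.1 h.disj₂₃ hz⟩
  rintro rfl
  exact disjoint_right.1 h.disj₁₃ hz (mem_singleton_self 0)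

theorem vadd_singleton_neg (s : ZMod p) : -s +ᵥ ({s} : Finset (ZMod p)) = {0} := by
  ext x
  rw [mem_vadd_iff, mem_singleton, mem_singleton]
  constructor <;> intro h
  · linear_combination h
  · linear_combination h

/-- When neither `s` nor the coefficient sum vanishes, `Part.singleton_pair` yields equal
coefficients whenever two exceptional points avoid the same class. The aim is to make all three
coefficients equal. -/
theorem Part.inv_of_singleton {s : ZMod p} (h : Part a {s} Y Z) (hp : 5 ≤ p) : Inv a := by
  rcases eq_or_ne s 0 with rfl | hs
  · exact h.inv_of_zero
  by_cases hsum : a 0 + a 1 + a 2 = 0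
  · have h1 := h.vadd hsum (-s)
    rw [vadd_singleton_neg] at h1
    exact h1.inv_of_zero
  have key : ∀ W, (W = Y ∨ W = Z) → ∀ i j k : Fin 3, i ≠ j → j ≠ k → i ≠ k →
      -((a i + a k) / a j * s) ∉ W → -((a j + a i) / a k * s) ∉ W → a i = a j := by
    intro W hW i j k hij hjk hik h1 h2
    have h3 : s * (a i + a j + a k) * (a i - a j) = 0 := by
      rcases hW with rfl | rfl
      · exact h.singleton_pair hij hjk hik h1 h2
      · exact h.swap₂₃.singleton_pair hij hjk hik h1 h2
    have h4 : a i + a j + a k = a 0 + a 1 + a 2 := by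
      revert hij hjk hik
      fin_cases i <;> fin_cases j <;> fin_cases k <;> simp <;> ring
    rw [h4] at h3
    exact sub_eq_zero.1 ((mul_eq_zero.1 h3).resolve_left (mul_ne_zero hs hsum))
  have hYZ : ∀ w, w ∉ Y ∨ w ∉ Z := by
    intro w
    by_contra hc
    push Not at hc
    exact disjoint_left.1 h.disj₂₃ hc.1 hc.2
  -- If two coefficients agree, their exceptional points coincide and so avoid a common class.
  have key2 : ∀ i j k : Fin 3, i ≠ j → j ≠ k → i ≠ k → a i = a j → a k = a i := by
    intro i j k hij hjk hik he
    rcases hYZ (-((a i + a k) / a j * s)) with h1 | h1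
    · refine key Y (Or.inl rfl) k i j hik.symm hij hjk.symm ?_ h1
      rw [he] at h1 ⊢
      rwa [add_comm]
    · refine key Z (Or.inr rfl) k i j hik.symm hij hjk.symm ?_ h1
      rw [he] at h1 ⊢
      rwa [add_comm]
  have hall : a 0 = a 1 ∧ a 1 = a 2 := by
    have k01 := key2 0 1 2 (by decide) (by decide) (by decide)
    have k12 := key2 1 2 0 (by decide) (by decide) (by decide)
    have k20 := key2 2 0 1 (by decide) (by decide) (by decide)
    -- Three exceptional points, each outside `Y` or outside `Z`: two of them avoid the same class.
    have : a 0 = a 1 ∨ a 1 = a 2 ∨ a 2 = a 0 := by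
      rcases hYZ (-((a 0 + a 2) / a 1 * s)) with h1 | h1 <;>
      rcases hYZ (-((a 1 + a 0) / a 2 * s)) with h2 | h2 <;>
      rcases hYZ (-((a 2 + a 1) / a 0 * s)) with h3 | h3
      · exact Or.inl (key Y (Or.inl rfl) 0 1 2 (by decide) (by decide) (by decide) h1 h2)
      · exact Or.inl (key Y (Or.inl rfl) 0 1 2 (by decide) (by decide) (by decide) h1 h2)
      · exact Or.inr (Or.inr (key Y (Or.inl rfl) 2 0 1 (by decide) (by decide) (by decide) h3 h1))
      · exact Or.inr (Or.inl (key Z (Or.inr rfl) 1 2 0 (by decide) (by decide) (by decide) h2 h3))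
      · exact Or.inr (Or.inl (key Y (Or.inl rfl) 1 2 0 (by decide) (by decide) (by decide) h2 h3))
      · exact Or.inr (Or.inr (key Z (Or.inr rfl) 2 0 1 (by decide) (by decide) (by decide) h3 h1))
      · exact Or.inl (key Z (Or.inr rfl) 0 1 2 (by decide) (by decide) (by decide) h1 h2)
      · exact Or.inl (key Z (Or.inr rfl) 0 1 2 (by decide) (by decide) (by decide) h1 h2)
    rcases this with e | e | e
    · have := k01 e
      exact ⟨e, by rw [this, e]⟩
    · have := k12 e
      exact ⟨this, e⟩
    · have := k20 e
      exact ⟨by rw [this, e], this⟩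
  have heq : ∀ i, a i = a 0 := by
    intro i
    fin_cases i
    · rfl
    · exact hall.1.symm
    · exact (hall.1.trans hall.2).symm
  refine inv_of_pow (n := 2) (by decide) (by norm_num) (by omega) ?_
  intro i j _
  rw [heq i, heq j, div_self (h.ne 0), one_pow]

/-- The differences `d ≠ 0` in which `X` has boundary at most `m`. -/
def dirs (X : Finset (ZMod p)) (m : ℕ) : Finset (ZMod p) := {d | d ≠ 0 ∧ bd X d ≤ m}

theorem mem_dirs {m : ℕ} {d : ZMod p} : d ∈ dirs X m ↔ d ≠ 0 ∧ bd X d ≤ m := by simp [dirs]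

theorem zero_notMem_dirs (X : Finset (ZMod p)) (m : ℕ) : 0 ∉ dirs X m := by simp [dirs]

theorem neg_mem_dirs {m : ℕ} {d : ZMod p} (h : d ∈ dirs X m) : -d ∈ dirs X m := by
  rw [mem_dirs] at h ⊢
  rwa [neg_ne_zero, bd_neg]

/-- The summand is the number of representations of `d` as a difference of elements of `X`, so both
sides count ordered pairs of distinct elements. -/
theorem sum_card_sub_bd (X : Finset (ZMod p)) :
    ∑ d ∈ univ.erase (0 : ZMod p), (#X - bd X d) = #X * (#X - 1) := by
  have hXp : #X ≤ p := by simpa [ZMod.card] using card_le_univ X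
  have h2 : ∑ d ∈ univ.erase (0 : ZMod p), bd X d = #X * (p - #X) := by
    rw [← sum_bd, ← add_sum_erase univ _ (mem_univ (0 : ZMod p)), bd_zero, zero_add]
  have h3 : ∑ d ∈ univ.erase (0 : ZMod p), (#X - bd X d) +
      ∑ d ∈ univ.erase (0 : ZMod p), bd X d = (p - 1) * #X := by
    rw [← sum_add_distrib, sum_congr rfl (fun d _ => Nat.sub_add_cancel (bd_le_card X d)),
      sum_const, card_erase_of_mem (mem_univ _), card_univ, ZMod.card, smul_eq_mul]
  rw [h2] at h3
  rcases Nat.eq_zero_or_pos #X with h0 | h0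
  · simp [h0]
  · obtain ⟨q, hq⟩ := Nat.exists_eq_add_of_le hXp
    obtain ⟨x, hx⟩ : ∃ x, #X = x + 1 := ⟨#X - 1, by omega⟩
    rw [hx] at h3 hq ⊢
    rw [show p - (x + 1) = q by omega, show p - 1 = x + q by omega] at h3
    simp only [add_tsub_cancel_right]
    nlinarith

theorem card_dirs_mul_le (X : Finset (ZMod p)) (m : ℕ) :
    #(dirs X m) * (#X - m) ≤ #X * (#X - 1) := by
  rw [← sum_card_sub_bd, ← smul_eq_mul, ← sum_const]
  refine (sum_le_sum fun d hd => ?_).trans (sum_le_sum_of_subset (fun d hd => ?_))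
  · have := (mem_dirs.1 hd).2
    omega
  · simp [(mem_dirs.1 hd).1]

theorem bd_eq_card_of_card_dirs {m : ℕ} (h : #(dirs X m) * (#X - m) = #X * (#X - 1))
    {e : ZMod p} (he : e ≠ 0) (he' : e ∉ dirs X m) : bd X e = #X := by
  have h1 : ∑ d ∈ insert e (dirs X m), (#X - bd X d) ≤ #X * (#X - 1) := by
    rw [← sum_card_sub_bd]
    refine sum_le_sum_of_subset (fun d hd => ?_)
    rcases mem_insert.1 hd with rfl | hd
    · simp [he]
    · simp [(mem_dirs.1 hd).1]
  have h2 : #(dirs X m) * (#X - m) ≤ ∑ d ∈ dirs X m, (#X - bd X d) := by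
    rw [← smul_eq_mul, ← sum_const]
    refine sum_le_sum fun d hd => ?_
    have := (mem_dirs.1 hd).2
    omega
  rw [sum_insert he'] at h1
  have := bd_le_card X e
  omega

/-- Two progressions. -/
theorem Part.inv_of_isAP (h : Part a X Y Z) (hX : IsAP X) (hY : IsAP Y) (hX3 : 3 ≤ #X)
    (hY2 : 2 ≤ #Y) (hZ2 : 2 ≤ #Z) (hp : 11 ≤ p) : Inv a := by
  obtain ⟨e, he, hX⟩ := hX
  obtain ⟨d, hd, hY⟩ := hY
  have hc := h.card
  have h2 : (2 : ZMod p) * e ≠ 0 := natCast_mul_ne he (n := 2) (by norm_num) (by omega)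
  refine inv_of_card_le_five hp h.ne (D := {e, -e, 2 * e, -(2 * e)}) (d := d)
    ((card_le_four).trans (by norm_num)) ?_ ?_ ?_
  · simp only [mem_insert, mem_singleton, not_or]
    exact ⟨he.symm, (neg_ne_zero.2 he).symm, h2.symm, (neg_ne_zero.2 h2).symm⟩
  · intro x hx
    simp only [mem_insert, mem_singleton] at hx ⊢
    rcases hx with rfl | rfl | rfl | rfl <;> simp
  · intro i j hij
    simpa using mem_four_of_bd_le_two he hX (mul_ne_zero (h.div_ne i j) hd)
      (h.bd_le_two hd hY hY2 hij) hX3 (by omega)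

end ThreeClasses
end RainbowNumber

namespace RainbowNumber
open Finset Pointwise

/-! ### Three classes of at least two elements -/

section ThreeClassesLarge

variable {p : ℕ} [Fact p.Prime] {a : Fin 3 → ZMod p} {X Y Z : Finset (ZMod p)}

theorem bd_ne_card_of_mem {x y : ZMod p} (hx : x ∈ X) (hy : y ∈ X) : bd X (y - x) ≠ #X := by
  intro h
  exact filter_eq_self.1 (eq_of_subset_of_card_le (filter_subset _ _) h.ge) x hx (by simpa using hy)

/-- Two classes of size two. -/
theorem Part.inv_of_card_two_two (h : Part a X Y Z) (hX : #X = 2) (hY : #Y = 2) (hp : 11 ≤ p) :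
    Inv a := by
  have hYAP := isAP_of_card_two (by omega) hY
  have hc := h.card
  by_cases hZ : IsAP Z
  · exact h.swap₁₃.inv_of_isAP hZ hYAP (by omega) (by omega) (by omega) hp
  obtain ⟨d, hd, hYd⟩ := hYAP
  have hE4 : #(X ∪ Y) = 4 := by rw [card_union_of_disjoint h.disj₁₂]; omega
  have hZE : Z = (X ∪ Y)ᶜ := by
    refine eq_of_subset_of_card_le ?_ (by rw [card_compl, ZMod.card]; omega)
    intro z hz
    rw [mem_compl, mem_union, not_or]
    exact ⟨disjoint_right.1 h.disj₁₃ hz, disjoint_right.1 h.disj₂₃ hz⟩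
  have hE : ¬ IsAP (X ∪ Y) := fun h1 => hZ (hZE ▸ h1.compl)
  refine inv_of_card_le_five hp h.ne (D := dirs (X ∪ Y) 2) (d := d) ?_ (zero_notMem_dirs _ _)
    (fun x hx => neg_mem_dirs hx) ?_
  · have hm := card_dirs_mul_le (X ∪ Y) 2
    rw [hE4] at hm
    by_contra hD
    have hD6 : #(dirs (X ∪ Y) 2) = 6 := by omega
    -- Six directions would exhaust all 12 ordered pairs of the 4-element union, leaving at most 7
    -- differences including 0, whereas Vosper's theorem demands 8.
    have hsub : -(X ∪ Y) + (X ∪ Y) ⊆ insert 0 (dirs (X ∪ Y) 2) := by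
      intro e he
      obtain ⟨x', hx', y, hy, rfl⟩ := mem_add.1 he
      rw [mem_neg'] at hx'
      by_contra hc
      rw [mem_insert, not_or] at hc
      have h1 := bd_eq_card_of_card_dirs (by rw [hD6, hE4]) hc.1 hc.2
      rw [show x' + y = y - -x' by ring] at h1
      exact bd_ne_card_of_mem hx' hy h1
    have h1 := (card_le_card hsub).trans (card_insert_le _ _)
    have h2 := card_neg (X ∪ Y)
    have := vosper (R := X ∪ Y) (X := -(X ∪ Y)) (by omega) (by omega) (by omega) hE
    omega
  · intro i j hij
    refine mem_dirs.2 ⟨mul_ne_zero (h.div_ne i j) hd, ?_⟩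
    rw [← bd_compl, ← hZE]
    exact h.swap₁₃.bd_le_two hd hYd (by omega) hij

theorem bd_union_add_bd_inter (A B : Finset (ZMod p)) (d : ZMod p) :
    bd (A ∪ B) d + bd (A ∩ B) d ≤ bd A d + bd B d := by
  have := card_inter_add_union_add A B {0, d}
  simp only [card_add_pair] at this
  have := card_union_add_card_inter A B
  omega

/-- The dual of `bd_add_pair_le`: intersecting with the translate is adding the pair to the
complement. -/
theorem bd_inter_vadd_le (X : Finset (ZMod p)) (e : ZMod p) : bd (X ∩ (e +ᵥ X)) e ≤ bd X e := by
  have h := bd_add_pair_le Xᶜ e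
  rw [bd_compl, ← bd_compl, add_pair_eq] at h
  convert h using 2
  ext x
  simp [mem_vadd_iff]

/-- If `I` is a progression of difference `d`, so is `I ∪ (I + 2 d)`. -/
theorem bd_add_pair_two {I : Finset (ZMod p)} {d : ZMod p} (hd : d ≠ 0) (h : bd I d = 1)
    (h3 : 3 ≤ #I) (hp : #I + 3 ≤ p) : bd (I + {0, 2 * d}) d ≤ 1 := by
  have h2 : (2 : ZMod p) * d ≠ 0 := natCast_mul_ne hd (n := 2) (by norm_num) (by omega)
  have h4 : 2 ≤ bd I (2 * d) := by
    by_contra hc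
    have := bd_pos h2 (card_pos.1 (by omega : 0 < #I)) (by omega)
    rcases eq_or_eq_neg_of_bd_eq_one hd h h2 (by omega) (by omega) (by omega) with e | e
    · exact hd (by linear_combination e)
    · exact natCast_mul_ne hd (n := 3) (by norm_num) (by omega) (by push_cast; linear_combination e)
  have h5 := bd_add_pair_le I d
  have h6 := bd_add_pair_le (I + {0, d}) d
  have h7 := card_add_pair (I + {0, d}) d
  have h8 := card_add_pair I d
  have h9 := card_add_pair I (2 * d)
  have : I + {0, 2 * d} = I + {0, d} + {0, d} := by
    refine eq_of_subset_of_card_le ?_ (by omega)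
    rw [add_assoc]
    refine add_subset_add_left ?_
    intro x hx
    simp only [mem_insert, mem_singleton] at hx
    rcases hx with rfl | rfl
    · exact mem_add.2 ⟨0, by simp, 0, by simp, by simp⟩
    · exact mem_add.2 ⟨d, by simp, d, by simp, by ring⟩
  rw [this]
  omega

/-- The run count of `X ∪ (X + e)` in the direction `d`. -/
theorem bd_add_pair_le_two {X : Finset (ZMod p)} {d e : ZMod p} (hX : ¬ IsAP X) (h5 : 5 ≤ #X)
    (hp : #X + 2 ≤ p) (hd : d ≠ 0) (h1 : bd X d = 2) (he : e ≠ 0) (h2 : bd X e = 2) :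
    bd (X + {0, e}) d ≤ 2 := by
  by_contra hV
  have hu := bd_union_add_bd_inter X (e +ᵥ X) d
  rw [← add_pair_eq, bd_vadd] at hu
  have hIc := card_inter_vadd X e
  have hIe := bd_inter_vadd_le X e
  have hIpos := bd_pos hd (card_pos.1 (by omega : 0 < #(X ∩ (e +ᵥ X)))) (by omega)
  set I := X ∩ (e +ᵥ X) with hI
  -- Submodularity bounds the boundaries of union and intersection by 4 in total, so three runs in
  -- the union leave one in `I`, a progression with `#X - 2` terms.
  have hI1 : bd I d = 1 := by omega
  -- When `f = ±2 d`, the two translates of `I` inside `X` already have `#X` elements and unite to a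
  -- progression, which `X` is not.
  have key : ∀ f, bd I f = bd I e → -f +ᵥ I ⊆ X → (f = 2 * d ∨ f = -(2 * d)) → False := by
    intro f hf hsub hfd
    have hd' : ∃ d', d' ≠ 0 ∧ bd I d' = 1 ∧ -f = 2 * d' := by
      rcases hfd with rfl | rfl
      · exact ⟨-d, neg_ne_zero.2 hd, by rw [bd_neg, hI1], by ring⟩
      · exact ⟨d, hd, hI1, by ring⟩
    obtain ⟨d', hd', hI', hfd'⟩ := hd'
    have h6 := bd_add_pair_two hd' hI' (by omega) (by omega)
    have h7 := card_add_pair I (2 * d')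
    have h9 : 2 ≤ bd I (2 * d') := by
      have h2' : (2 : ZMod p) * d' ≠ 0 :=
        natCast_mul_ne hd' (n := 2) (by norm_num) (by omega)
      by_contra hc
      have := bd_pos h2' (card_pos.1 (by omega : 0 < #I)) (by omega)
      rcases eq_or_eq_neg_of_bd_eq_one hd' hI' h2' (by omega) (by omega) (by omega) with e | e
      · exact hd' (by linear_combination e)
      · exact natCast_mul_ne hd' (n := 3) (by norm_num) (by omega)
          (by push_cast; linear_combination e)
    have h8 : I + {0, 2 * d'} = X := by
      refine eq_of_subset_of_card_le ?_ (by omega)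
      rw [add_pair_eq, ← hfd']
      exact union_subset inter_subset_left hsub
    rw [h8] at h6
    have := two_le_bd hX (card_pos.1 (by omega)) (by omega) hd'
    omega
  have hsub : -e +ᵥ I ⊆ X := by
    intro x hx
    rw [mem_vadd_iff, hI, mem_inter, mem_vadd_iff] at hx
    have := hx.2
    simpa using this
  rcases mem_four_of_bd_le_two hd hI1 he (by omega) (by omega) (by omega) with rfl | rfl | h | h
  · have := bd_add_pair_le X e
    omega
  · have := bd_add_pair_le X (-d)
    rw [bd_neg, bd_neg] at this
    omega
  · exact key e rfl hsub (Or.inl h)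
  · exact key e rfl hsub (Or.inr h)

theorem Part.bd_eq_two (h : Part a X Y Z) (hX : ¬ IsAP X) (hZ : ¬ IsAP Z) (hY : #Y = 2)
    (hX5 : 5 ≤ #X) {e : ZMod p} (he : e ≠ 0) (h2 : bd X e = 2) {i k : Fin 3}
    (hik : i ≠ k) : bd Z (a i / a k * e) = 2 := by
  have hZc := card_pos.2 h.pos₃
  have hc := h.card
  obtain ⟨j, hkj, hij⟩ := exists_third hik
  obtain ⟨y, y', hyy, hYe⟩ := card_eq_two.1 hY
  have hd : y' - y ≠ 0 := sub_ne_zero.2 hyy.symm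
  have hYv : Y = y +ᵥ ({0, y' - y} : Finset (ZMod p)) := by
    rw [hYe]
    ext x
    simp only [mem_insert, mem_singleton, mem_vadd_iff]
    constructor
    · rintro (rfl | rfl) <;> simp
    · rintro (h | h)
      · exact Or.inl (sub_eq_zero.1 h)
      · exact Or.inr (sub_left_injective h)
  have hYd : bd Y (y' - y) = 1 := by
    rw [hYv, bd_vadd]
    have h1 := bd_pos hd (X := {0, y' - y}) ⟨0, by simp⟩ ((card_le_two).trans_lt (by omega))
    have h2 : bd ({0, y' - y} : Finset (ZMod p)) (y' - y) ≤ #({y' - y} : Finset (ZMod p)) := by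
      refine card_le_card ?_
      intro z hz
      simp only [mem_filter, mem_insert, mem_singleton] at hz ⊢
      rcases hz with ⟨rfl | rfl, h⟩
      · simp at h
      · rfl
    rw [card_singleton] at h2
    omega
  set d := y' - y
  set X' := (a i / a j) • X with hX'
  have hX'c : #X' = #X := card_smul_finset₀ (h.div_ne i j) X
  have hbd : ∀ f, bd X' (a i / a j * f) = bd X f := fun f => bd_smul X f (h.div_ne i j)
  have hX'AP : ¬ IsAP X' := by
    rintro ⟨f, hf, hf1⟩
    have e1 : f = a i / a j * (a j / a i * f) := by
      have := h.ne i
      have := h.ne j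
      field_simp
    rw [e1, hbd] at hf1
    exact hX ⟨_, mul_ne_zero (h.div_ne j i) hf, hf1⟩
  have hX'd : bd X' d = 2 := by
    have e1 : d = a i / a j * (a j / a i * d) := by
      have := h.ne i
      have := h.ne j
      field_simp
    have h1 := two_le_bd hX'AP (card_pos.1 (by omega)) (by omega) hd
    have h3 := h.bd_le_two hd hYd (by omega) hij.symm
    rw [← hbd, ← e1] at h3
    omega
  have h7 : #((-(a k / a j)) • Z) = #Z :=
    card_smul_finset₀ (neg_ne_zero.2 (h.div_ne k j)) Z
  have hsum : X' + Y = y +ᵥ (X' + {0, d}) := by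
    rw [hYv, add_comm, vadd_add', add_comm X']
  have hsumc : #(X' + Y) = #X + 2 := by rw [hsum, card_vadd_finset, card_add_pair]; omega
  have heq : (-(a k / a j)) • Z = (X' + Y)ᶜ := by
    refine eq_of_subset_of_card_le ?_ (by rw [card_compl, ZMod.card]; omega)
    intro z hz
    rw [mem_compl]
    exact fun hc => disjoint_left.1 (h.disjoint_add hij hkj.symm hik) hc hz
  have hZe : bd Z (a i / a k * e) = bd (X' + {0, d}) (a i / a j * e) := by
    rw [← bd_vadd (X' + {0, d}) y, ← hsum, ← bd_compl (X' + Y), ← heq,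
      ← bd_smul Z _ (neg_ne_zero.2 (h.div_ne k j)), ← bd_neg]
    congr 1
    have := h.ne k
    have := h.ne j
    field_simp
  have he' : a i / a j * e ≠ 0 := mul_ne_zero (h.div_ne i j) he
  have h8 := bd_add_pair_le_two hX'AP (by omega) (by omega) hd hX'd he' (by rw [hbd, h2])
  -- Counting the same set in both orders exchanges the boundary of `X' + {0, d}` along `a i / a j *
  -- e` with that of `X' + {0, a i / a j * e}` along `d`, since both first steps add 2.
  have h9 : X' + {0, d} + {0, a i / a j * e} = X' + {0, a i / a j * e} + {0, d} :=
    add_right_comm _ _ _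
  have h10 := congrArg Finset.card h9
  rw [card_add_pair, card_add_pair, card_add_pair, card_add_pair, hbd, h2] at h10
  have h11 := two_le_bd hZ h.pos₃ (by omega) (mul_ne_zero (h.div_ne i k) he)
  omega

/-- One class of size two, the others not progressions. -/
theorem Part.inv_of_card_two (h : Part a X Y Z) (hX : ¬ IsAP X) (hZ : ¬ IsAP Z) (hY : #Y = 2)
    (hX3 : 3 ≤ #X) (hXZ : #X ≤ #Z) (hp : 11 ≤ p) : Inv a := by
  have hc := h.card
  obtain ⟨d, hd, hYd⟩ := isAP_of_card_two (by omega) hY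
  have h2X : ∀ {e}, e ≠ 0 → 2 ≤ bd X e := fun he => two_le_bd hX h.pos₁ (by omega) he
  have h2Z : ∀ {e}, e ≠ 0 → 2 ≤ bd Z e := fun he => two_le_bd hZ h.pos₃ (by omega) he
  have hZX : ∀ e ∈ dirs Z 2, ∀ i k, i ≠ k → a i / a k * e ∈ dirs X 2 := by
    intro e he i k hik
    rw [mem_dirs] at he ⊢
    refine ⟨mul_ne_zero (h.div_ne i k) he.1, ?_⟩
    have := h2Z he.1
    exact (h.swap₁₃.bd_eq_two hZ hX hY (by omega) he.1 (by omega) hik).le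
  have hdZ : ∀ i k, i ≠ k → a i / a k * d ∈ dirs Z 2 := fun i k hik =>
    mem_dirs.2 ⟨mul_ne_zero (h.div_ne i k) hd, h.swap₁₃.bd_le_two hd hYd (by omega) hik⟩
  have hdX : ∀ i k, i ≠ k → a i / a k * d ∈ dirs X 2 := fun i k hik =>
    mem_dirs.2 ⟨mul_ne_zero (h.div_ne i k) hd, h.bd_le_two hd hYd (by omega) hik⟩
  have hcard := card_dirs_mul_le X 2
  rcases Nat.lt_or_ge #X 5 with h5 | h5
  · refine inv_of_card_le_six hp h.ne (D := dirs X 2) (d := d) ?_ (zero_notMem_dirs _ _)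
      (fun x hx => neg_mem_dirs hx) (fun i j k l hij hkl => hZX _ (hdZ k l hkl) i j hij)
    have : #X = 3 ∨ #X = 4 := by omega
    rcases this with h6 | h6 <;> rw [h6] at hcard <;> omega
  · have hXZ' : ∀ e ∈ dirs X 2, ∀ i k, i ≠ k → a i / a k * e ∈ dirs Z 2 := by
      intro e he i k hik
      rw [mem_dirs] at he ⊢
      refine ⟨mul_ne_zero (h.div_ne i k) he.1, ?_⟩
      have := h2X he.1
      exact (h.bd_eq_two hX hZ hY h5 he.1 (by omega) hik).le
    -- For at least five elements, two-run directions pass from `X` to `Z` and back, so they are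
    -- invariant; counting differences shows that they do not fill all directions.
    refine ⟨dirs X 2, zero_notMem_dirs _ _, ⟨_, hdX 0 1 (by decide)⟩, ?_, ?_⟩
    · by_contra hc'
      push Not at hc'
      have h6 : dirs X 2 = univ.erase 0 := by
        ext x
        simp only [mem_erase, mem_univ, and_true]
        exact ⟨fun hx => (mem_dirs.1 hx).1, hc' x⟩
      rw [h6, card_erase_of_mem (mem_univ _), card_univ, ZMod.card] at hcard
      obtain ⟨x, hx⟩ : ∃ x, #X = x + 5 := ⟨#X - 5, by omega⟩
      obtain ⟨q, hq⟩ : ∃ q, p = 2 * x + 12 + q := ⟨p - (2 * x + 12), by omega⟩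
      rw [hx, show p - 1 = 2 * x + 11 + q by omega, show x + 5 - 2 = x + 3 by omega,
        show x + 5 - 1 = x + 4 by omega] at hcard
      nlinarith
    · intro i j hij x hx
      obtain ⟨k, hjk, hik⟩ := exists_third hij
      have h7 := neg_mem_dirs (hZX _ (hXZ' x hx k j hjk.symm) i k hik)
      have h8 : a i / a k * (a k / a j * x) = a i / a j * x := by
        have := h.ne k
        have := h.ne j
        field_simp
      rwa [h8] at h7

/-- Three translates of a dilate of `X` lie in a sumset of size 6. Their pairwise boundaries are at
least 2 and sum to at most 6, so each equals 2. -/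
theorem Part.dirs_of_card_three (h : Part a X Y Z) (hX : ¬ IsAP X) (hY : ¬ IsAP Y) (hX3 : #X = 3)
    (hY3 : #Y = 3) (hZ : 2 ≤ #Z) {d : ZMod p} (hd : d ∈ dirs Y 2) {i j : Fin 3} (hij : i ≠ j) :
    a i / a j * d ∈ dirs X 2 := by
  have hc := h.card
  rw [mem_dirs] at hd ⊢
  refine ⟨mul_ne_zero (h.div_ne i j) hd.1, ?_⟩
  obtain ⟨b, hb⟩ : {x ∈ Y | x + d ∈ Y}.Nonempty := by
    rw [← card_pos]
    have := card_filter_add_card_filter_not (s := Y) (fun x => x + d ∈ Y)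
    unfold bd at hd
    omega
  rw [mem_filter] at hb
  obtain ⟨c, hc1, hc2⟩ : ∃ c ∈ Y, c ∉ ({b, b + d} : Finset (ZMod p)) := by
    refine exists_mem_notMem_of_card_lt_card ?_
    exact (card_le_two).trans_lt (by omega)
  simp only [mem_insert, mem_singleton, not_or] at hc2
  have h1 := h.card_add_eq hY (by omega) (by omega) hZ hij.symm
  have h2 := sum_three_translates ((a j / a i) • X) hb.1 hb.2 hc1
  have hbd : ∀ f, bd ((a j / a i) • X) f = bd X (a i / a j * f) := by
    intro f
    rw [← bd_smul X _ (h.div_ne j i)]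
    congr 1
    have := h.ne i
    have := h.ne j
    field_simp
  have h2le : ∀ {e}, e ≠ 0 → 2 ≤ bd X (a i / a j * e) := fun he =>
    two_le_bd hX h.pos₁ (by omega) (mul_ne_zero (h.div_ne i j) he)
  rw [hbd, hbd, hbd, add_sub_cancel_left] at h2
  have := h2le (sub_ne_zero.2 hc2.1)
  have := h2le (sub_ne_zero.2 hc2.2)
  omega

theorem exists_notMem_dirs_of_card (h3 : #X = 3) (hp : 11 ≤ p) :
    ∃ u, u ≠ 0 ∧ u ∉ dirs X 2 := by
  by_contra hc'
  push Not at hc'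
  have hcard := card_dirs_mul_le X 2
  have h6 : dirs X 2 = univ.erase 0 := by
    ext x
    simp only [mem_erase, mem_univ, and_true]
    exact ⟨fun hx => (mem_dirs.1 hx).1, hc' x⟩
  rw [h6, card_erase_of_mem (mem_univ _), card_univ, ZMod.card, h3] at hcard
  omega

theorem mul_eq_of_bd_const {m : ℕ} (h : ∀ d ≠ 0, bd X d = m) : #X * (p - #X) = (p - 1) * m := by
  rw [← sum_bd, ← add_sum_erase univ _ (mem_univ (0 : ZMod p)), bd_zero, zero_add,
    sum_congr rfl (fun d hd => h d (ne_of_mem_erase hd)), sum_const,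
    card_erase_of_mem (mem_univ _), card_univ, ZMod.card, smul_eq_mul]

/-- The directions of minimal boundary of `X` are invariant by `Part.bd_mul_eq`, provided that
boundary is at most `#X - 2`. Otherwise `X` and `Y` have three elements each and the differences of
`Y` serve instead. -/
theorem Part.inv_of_not_isAP (h : Part a X Y Z) (hY : ¬ IsAP Y) (hX3 : 3 ≤ #X) (hY3 : 3 ≤ #Y)
    (hXZ : #X ≤ #Z) (hXY : IsAP X ∨ #Y ≤ #X) (hp : 11 ≤ p) : Inv a := by
  have hc := h.card
  obtain ⟨d, hd, hmin⟩ := exists_min_image (univ.erase (0 : ZMod p)) (bd X) ⟨1, by simp⟩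
  replace hd : d ≠ 0 := ne_of_mem_erase hd
  replace hmin : ∀ e ≠ 0, bd X d ≤ bd X e := fun e he => hmin e (by simp [he])
  rcases Nat.lt_or_ge #X (bd X d + 2) with hlt | hge
  · have hXAP : ¬ IsAP X := by
      rintro ⟨e, he, he1⟩
      have := hmin e he
      omega
    have hYX := hXY.resolve_left hXAP
    have hX3' : #X = 3 := by
      by_contra hne
      have h1 := h.card_add_le (show (0 : Fin 3) ≠ 1 by decide)
      have h6 : #((a 0 / a 1) • X) = #X := card_smul_finset₀ (h.div_ne 0 1) X
      obtain ⟨e, he, he2⟩ := exists_bd_add_two_le (X := (a 0 / a 1) • X) (Y := Y) (by omega) hY3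
        (by omega) (by omega)
      have e1 : e = a 0 / a 1 * (a 1 / a 0 * e) := by
        have := h.ne 0
        have := h.ne 1
        field_simp
      rw [e1, bd_smul X _ (h.div_ne 0 1)] at he2
      have := hmin _ (mul_ne_zero (h.div_ne 1 0) he)
      omega
    have hYX' : ∀ {i j}, i ≠ j → ∀ e ∈ dirs Y 2, a i / a j * e ∈ dirs X 2 :=
      fun hij e he => h.dirs_of_card_three hXAP hY hX3' (by omega) (by omega) he hij
    have hXY' : ∀ {i j}, i ≠ j → ∀ e ∈ dirs X 2, a i / a j * e ∈ dirs Y 2 :=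
      fun hij e he => h.swap₁₂.dirs_of_card_three hY hXAP (by omega) hX3' (by omega) he hij
    refine ⟨dirs Y 2, zero_notMem_dirs _ _, ?_, exists_notMem_dirs_of_card (by omega) hp, ?_⟩
    · obtain ⟨x, hx, y, hy, hxy⟩ := one_lt_card.1 (by omega : 1 < #Y)
      refine ⟨y - x, mem_dirs.2 ⟨sub_ne_zero.2 hxy.symm, ?_⟩⟩
      have := bd_ne_card_of_mem hx hy
      have := bd_le_card Y (y - x)
      omega
    · intro i j hij x hx
      obtain ⟨k, hjk, hik⟩ := exists_third hij
      have h7 := neg_mem_dirs (hXY' hik _ (hYX' hjk.symm x hx))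
      have h8 : a i / a k * (a k / a j * x) = a i / a j * x := by
        have := h.ne k
        have := h.ne j
        field_simp
      rwa [h8] at h7
  · refine ⟨dirs X (bd X d), zero_notMem_dirs _ _, ⟨d, mem_dirs.2 ⟨hd, le_rfl⟩⟩, ?_, ?_⟩
    · by_contra hc'
      push Not at hc'
      have hconst : ∀ e ≠ 0, bd X e = bd X d := fun e he =>
        le_antisymm (mem_dirs.1 (hc' e he)).2 (hmin e he)
      have hconstZ : ∀ e ≠ 0, bd Z e = bd X d := by
        intro e he
        have h1 := hconst e he
        rw [← h1]
        exact h.bd_self_eq hY (by omega) (by omega) (by omega) (by omega) (by omega)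
      have hX := mul_eq_of_bd_const hconst
      have hZ := mul_eq_of_bd_const hconstZ
      obtain ⟨z, hz⟩ := Nat.exists_eq_add_of_le hXZ
      -- A constant boundary makes `n (p - n)` agree at `#X` and `#Z`; the sizes are then equal or
      -- sum to `p`, and the latter would leave `Y` empty.
      have hz0 : z = 0 := by
        rw [← hX, show p - #Z = #X + #Y by omega, show p - #X = #Y + #X + z by omega, hz] at hZ
        have : z * #Y = 0 := by nlinarith
        rcases Nat.mul_eq_zero.1 this with h0 | h0 <;> omega
      rcases hXY with ⟨e, he, he1⟩ | hYX
      · rw [hconst e he] at he1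
        rw [he1, mul_one, show p - #X = #Y + #X by omega,
          show p - 1 = #Y + #X + (#X - 1) by omega] at hX
        obtain ⟨x, hx⟩ : ∃ x, #X = x + 3 := ⟨#X - 3, by omega⟩
        rw [hx, show x + 3 - 1 = x + 2 by omega] at hX
        nlinarith
      -- With `x = #X`, `y = #Y` and constant boundary `m`, `m (2x + y - 1) = x (x + y)` and `3m ≤ x
      -- + y` give `3x ≤ 2x + y - 1`, against `y ≤ x`.
      · have h1 := h.card_add_le (show (0 : Fin 3) ≠ 1 by decide)
        have h3 := three_translates (Y := (a 0 / a 1) • X) (m := bd X d) hY3 (fun e he => by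
          have e1 : e = a 0 / a 1 * (a 1 / a 0 * e) := by
            have := h.ne 0
            have := h.ne 1
            field_simp
          rw [e1, bd_smul X _ (h.div_ne 0 1)]
          exact hmin _ (mul_ne_zero (h.div_ne 1 0) he))
        rw [show p - #X = #Y + #X by omega, show p - 1 = #Y + 2 * #X - 1 by omega] at hX
        obtain ⟨y, hy⟩ : ∃ y, #Y = y + 1 := ⟨#Y - 1, by omega⟩
        obtain ⟨x, hx⟩ := Nat.exists_eq_add_of_le hYX
        rw [hy] at hx hX h1
        rw [hx, show y + 1 + 2 * (y + 1 + x) - 1 = 3 * y + 2 * x + 2 by omega] at hX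
        have h4 : 3 * bd X d ≤ 2 * y + x + 2 := by omega
        have h5 : (3 * y + 2 * x + 2) * (3 * bd X d) ≤ (3 * y + 2 * x + 2) * (2 * y + x + 2) :=
          Nat.mul_le_mul_left _ h4
        nlinarith
    · intro i j hij x hx
      refine neg_mem_dirs ?_
      rw [mem_dirs] at hx ⊢
      refine ⟨mul_ne_zero (h.div_ne i j) hx.1, ?_⟩
      rw [h.bd_mul_eq hY (by omega) (by omega) (by omega) (by omega) (by omega) hij]
      exact hx.2

end ThreeClassesLarge
end RainbowNumber

namespace RainbowNumber
open Finset Pointwise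

/-! ### The prime `7` -/

/-- Some permutation of `(x, y, z)` solves `x + u y + v z = 0` modulo `7`. -/
def solves (u v x y z : ℕ) : Bool :=
  (x + u * y + v * z) % 7 == 0 || (x + u * z + v * y) % 7 == 0 || (y + u * x + v * z) % 7 == 0 ||
    (y + u * z + v * x) % 7 == 0 || (z + u * x + v * y) % 7 == 0 || (z + u * y + v * x) % 7 == 0

/-- Here `u`, `v` stand for `a 1 / a 0`, `a 2 / a 0`, and scaling turns the first class into `{b, b
+ 1}`. The exceptional case `u² = v² = 1` makes all ratios `±1`, where the square roots of unity are
invariant. -/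
theorem solves_seven : ∀ u < 7, ∀ v < 7, u = 0 ∨ v = 0 ∨ (u * u % 7 = 1 ∧ v * v % 7 = 1) ∨
    ((List.range 7).all fun b => (List.range 7).all fun y₁ => (List.range 7).all fun y₂ =>
      (y₁ == b || y₁ == (b + 1) % 7 || y₂ == b || y₂ == (b + 1) % 7 || y₁ == y₂) ||
      (List.range 7).any fun z => !(z == b || z == (b + 1) % 7 || z == y₁ || z == y₂) &&
        (solves u v b y₁ z || solves u v b y₂ z ||
          solves u v ((b + 1) % 7) y₁ z || solves u v ((b + 1) % 7) y₂ z)) = true := by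
  decide +kernel

theorem exists_perm_of_solves {u v x y z : ℕ} (h : solves u v x y z = true) :
    ∃ f : Fin 3 → ZMod 7, (f = ![1, (u : ZMod 7), (v : ZMod 7)] ∨
      f = ![1, (v : ZMod 7), (u : ZMod 7)] ∨ f = ![(u : ZMod 7), 1, (v : ZMod 7)] ∨
      f = ![(u : ZMod 7), (v : ZMod 7), 1] ∨ f = ![(v : ZMod 7), 1, (u : ZMod 7)] ∨
      f = ![(v : ZMod 7), (u : ZMod 7), 1]) ∧ f 0 * x + f 1 * y + f 2 * z = 0 := by
  have key : ∀ n : ℕ, n % 7 = 0 → (n : ZMod 7) = 0 := fun n hn =>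
    (ZMod.natCast_eq_zero_iff n 7).2 (Nat.dvd_of_mod_eq_zero hn)
  simp only [solves, Bool.or_eq_true, beq_iff_eq] at h
  rcases h with ((((h | h) | h) | h) | h) | h
  · exact ⟨_, Or.inl rfl, by have := key _ h; push_cast at this; simpa using this⟩
  · exact ⟨_, Or.inr (Or.inl rfl), by
      have := key _ h; push_cast at this; simp; linear_combination this⟩
  · exact ⟨_, Or.inr (Or.inr (Or.inl rfl)), by
      have := key _ h; push_cast at this; simp; linear_combination this⟩
  · exact ⟨_, Or.inr (Or.inr (Or.inr (Or.inr (Or.inl rfl)))), by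
      have := key _ h; push_cast at this; simp; linear_combination this⟩
  · exact ⟨_, Or.inr (Or.inr (Or.inr (Or.inl rfl))), by
      have := key _ h; push_cast at this; simp; linear_combination this⟩
  · exact ⟨_, Or.inr (Or.inr (Or.inr (Or.inr (Or.inr rfl)))), by
      have := key _ h; push_cast at this; simp; linear_combination this⟩

section Seven

variable [Fact (Nat.Prime 7)] {a : Fin 3 → ZMod 7} {X Y Z : Finset (ZMod 7)}

theorem Part.inv_of_seven (h : Part a X Y Z) (hX : #X = 2) (hY : #Y = 2) : Inv a := by
  obtain ⟨x₁, x₂, hx, hXe⟩ := card_eq_two.1 hX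
  obtain ⟨y₁, y₂, hy, hYe⟩ := card_eq_two.1 hY
  have hd : x₂ - x₁ ≠ 0 := sub_ne_zero.2 hx.symm
  set d := x₂ - x₁ with hdd
  have h0 := h.ne 0
  have hval : ∀ w : ZMod 7, ((w.val : ℕ) : ZMod 7) = w := ZMod.natCast_zmod_val
  have hsucc : (((x₁ / d).val + 1) % 7 : ℕ) = (x₂ / d).val := by
    have h1 : x₂ / d = ((((x₁ / d).val + 1 : ℕ)) : ZMod 7) := by
      push_cast
      rw [hval]
      field_simp
      rw [hdd]
      ring
    rw [h1, ZMod.val_natCast]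
  have hne : ∀ {v w : ZMod 7}, v ≠ w → (v / d).val ≠ (w / d).val := by
    intro v w hvw he
    have := ZMod.val_injective 7 he
    field_simp at this
    exact hvw this
  have hsols : ∀ z : ℕ, z < 7 → ∀ x ∈ X, ∀ y ∈ Y, (z : ZMod 7) * d ∈ Z →
      solves (a 1 / a 0).val (a 2 / a 0).val (x / d).val (y / d).val z = true → False := by
    intro z hz7 x hx y hy hz hs
    obtain ⟨f, hf, he⟩ := exists_perm_of_solves hs
    simp only [hval] at hf he
    have key : a 0 * f 0 * x + a 0 * f 1 * y + a 0 * f 2 * (z * d) = 0 := by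
      field_simp at he
      linear_combination a 0 * he
    have e1 : a 0 * (a 1 / a 0) = a 1 := by field_simp
    have e2 : a 0 * (a 2 / a 0) = a 2 := by field_simp
    have c : ∀ i j k : Fin 3, i ≠ j → j ≠ k → i ≠ k →
      a 0 * f 0 = a i → a 0 * f 1 = a j → a 0 * f 2 = a k → False := by
      intro i j k hij hjk hik hi hj hk
      rw [hi, hj, hk] at key
      exact h.free i j k hij hjk hik x hx y hy _ hz key
    rcases hf with rfl | rfl | rfl | rfl | rfl | rfl
    · exact c 0 1 2 (by decide) (by decide) (by decide) (by simp) (by simp [e1]) (by simp [e2])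
    · exact c 0 2 1 (by decide) (by decide) (by decide) (by simp) (by simp [e2]) (by simp [e1])
    · exact c 1 0 2 (by decide) (by decide) (by decide) (by simp [e1]) (by simp) (by simp [e2])
    · exact c 1 2 0 (by decide) (by decide) (by decide) (by simp [e1]) (by simp [e2]) (by simp)
    · exact c 2 0 1 (by decide) (by decide) (by decide) (by simp [e2]) (by simp) (by simp [e1])
    · exact c 2 1 0 (by decide) (by decide) (by decide) (by simp [e2]) (by simp [e1]) (by simp)
  have hx1 : x₁ ∈ X := by simp [hXe]
  have hx2 : x₂ ∈ X := by simp [hXe]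
  have hy1 : y₁ ∈ Y := by simp [hYe]
  have hy2 : y₂ ∈ Y := by simp [hYe]
  have hXY : ∀ {x y}, x ∈ X → y ∈ Y → y ≠ x := by
    rintro x y hx hy rfl
    exact disjoint_left.1 h.disj₁₂ hx hy
  rcases solves_seven (a 1 / a 0).val (ZMod.val_lt _) (a 2 / a 0).val (ZMod.val_lt _) with
    h1 | h1 | h1 | h1
  · rw [ZMod.val_eq_zero] at h1
    exact absurd h1 (h.div_ne _ _)
  · rw [ZMod.val_eq_zero] at h1
    exact absurd h1 (h.div_ne _ _)
  · have hsq : ∀ w : ZMod 7, w.val * w.val % 7 = 1 → w ^ 2 = 1 := by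
      intro w hw
      have h2 : ((w.val * w.val : ℕ) : ZMod 7) = ((1 : ℕ) : ZMod 7) :=
        (ZMod.natCast_eq_natCast_iff _ _ 7).2 hw
      push_cast at h2
      rw [hval] at h2
      rw [sq, h2]
    have h2 := hsq _ h1.1
    have h3 := hsq _ h1.2
    have h5 : ∀ i, a i ^ 2 = a 0 ^ 2 := by
      intro i
      fin_cases i
      · rfl
      · field_simp at h2; exact h2
      · field_simp at h3; exact h3
    refine inv_of_pow (n := 2) (by decide) (by norm_num) (by norm_num) ?_
    intro i j _
    rw [div_pow, h5 i, h5 j, div_self (pow_ne_zero 2 h0)]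
  · exfalso
    simp only [List.all_eq_true, List.mem_range] at h1
    have h2 := h1 _ (ZMod.val_lt (x₁ / d)) _ (ZMod.val_lt (y₁ / d)) _ (ZMod.val_lt (y₂ / d))
    simp only [hsucc, Bool.or_eq_true, beq_iff_eq, hne (hXY hx1 hy1), hne (hXY hx2 hy1),
      hne (hXY hx1 hy2), hne (hXY hx2 hy2), hne hy, List.any_eq_true, List.mem_range,
      Bool.and_eq_true, Bool.not_eq_true', Bool.or_eq_false_iff, beq_eq_false_iff_ne, false_or] at h2
    obtain ⟨z, hz, ⟨⟨⟨n1, n2⟩, n3⟩, n4⟩, hs⟩ := h2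
    have hn : ∀ w : ZMod 7, z ≠ (w / d).val → (z : ZMod 7) * d ≠ w := by
      intro w hw he
      refine hw ?_
      rw [← he, mul_div_cancel_right₀ _ hd, ZMod.val_natCast, Nat.mod_eq_of_lt hz]
    have hzZ : (z : ZMod 7) * d ∈ Z := by
      rcases h.cover ((z : ZMod 7) * d) with h3 | h3 | h3
      · simp [hXe, hn _ n1, hn _ n2] at h3
      · simp [hYe, hn _ n3, hn _ n4] at h3
      · exact h3
    rcases hs with ((hs | hs) | hs) | hs
    · exact hsols z hz _ hx1 _ hy1 hzZ hs
    · exact hsols z hz _ hx1 _ hy2 hzZ hs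
    · exact hsols z hz _ hx2 _ hy1 hzZ hs
    · exact hsols z hz _ hx2 _ hy2 hzZ hs

end Seven

/-! ### Rainbow-free partitions and invariant sets -/

section Main

variable {p : ℕ} [Fact p.Prime] {a : Fin 3 → ZMod p} {X Y Z : Finset (ZMod p)}

theorem Part.inv_of_mid_card_two (h : Part a X Y Z) (hY : #Y = 2) (hX2 : 2 ≤ #X) (hZ2 : 2 ≤ #Z)
    (hp : 11 ≤ p) : Inv a := by
  have hYAP := isAP_of_card_two (by omega) hY
  rcases Nat.lt_or_ge #X 3 with h1 | h1
  · exact h.inv_of_card_two_two (by omega) hY hp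
  rcases Nat.lt_or_ge #Z 3 with h2 | h2
  · exact h.swap₁₃.inv_of_card_two_two (by omega) hY hp
  by_cases hX : IsAP X
  · exact h.inv_of_isAP hX hYAP h1 (by omega) hZ2 hp
  by_cases hZ : IsAP Z
  · exact h.swap₁₃.inv_of_isAP hZ hYAP h2 (by omega) hX2 hp
  rcases le_total #X #Z with h3 | h3
  · exact h.inv_of_card_two hX hZ hY h1 h3 hp
  · exact h.swap₁₃.inv_of_card_two hZ hX hY h2 h3 hp

theorem Part.inv_of_three_le (h : Part a X Y Z) (hX : 3 ≤ #X) (hY : 3 ≤ #Y) (hZ : 3 ≤ #Z)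
    (hp : 11 ≤ p) : Inv a := by
  have mid : ∀ {X Y Z : Finset (ZMod p)}, Part a X Y Z → 3 ≤ #X → 3 ≤ #Y → 3 ≤ #Z →
      IsAP Y → ¬ IsAP X → ¬ IsAP Z → #X ≤ #Z → Inv a := by
    intro X Y Z h hX hY hZ hYA hXA hZA hXZ
    rcases le_total #Y #Z with h1 | h1
    · exact h.swap₁₂.inv_of_not_isAP hXA hY hX h1 (Or.inl hYA) hp
    · exact h.rot.rot.inv_of_not_isAP hXA hZ hX h1 (Or.inr hXZ) hp
  have mid' : ∀ {X Y Z : Finset (ZMod p)}, Part a X Y Z → 3 ≤ #X → 3 ≤ #Y → 3 ≤ #Z →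
      IsAP Y → Inv a := by
    intro X Y Z h hX hY hZ hYA
    by_cases hXA : IsAP X
    · exact h.inv_of_isAP hXA hYA hX (by omega) (by omega) hp
    by_cases hZA : IsAP Z
    · exact h.swap₁₃.inv_of_isAP hZA hYA hZ (by omega) (by omega) hp
    rcases le_total #X #Z with h1 | h1
    · exact mid h hX hY hZ hYA hXA hZA h1
    · exact mid h.swap₁₃ hZ hY hX hYA hZA hXA h1
  by_cases hYA : IsAP Y
  · exact mid' h hX hY hZ hYA
  by_cases hXA : IsAP X
  · exact mid' h.swap₁₂ hY hX hZ hXA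
  by_cases hZA : IsAP Z
  · exact mid' h.swap₂₃ hX hZ hY hZA
  rcases le_total #X #Y with h1 | h1 <;> rcases le_total #Y #Z with h2 | h2 <;>
    rcases le_total #X #Z with h3 | h3
  · exact h.swap₁₂.inv_of_not_isAP hXA hY hX h2 (Or.inr h1) hp
  · exact h.swap₁₂.inv_of_not_isAP hXA hY hX h2 (Or.inr h1) hp
  · exact h.swap₁₂.swap₁₃.inv_of_not_isAP hXA hZ hX h2 (Or.inr h3) hp
  · exact h.swap₂₃.inv_of_not_isAP hZA hX hZ h1 (Or.inr h3) hp
  · exact h.inv_of_not_isAP hYA hX hY h3 (Or.inr h1) hp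
  · exact h.swap₁₃.inv_of_not_isAP hYA hZ hY h3 (Or.inr h2) hp
  · exact h.swap₁₃.swap₁₂.inv_of_not_isAP hZA hY hZ h1 (Or.inr h2) hp
  · exact h.swap₁₃.swap₁₂.inv_of_not_isAP hZA hY hZ h1 (Or.inr h2) hp

theorem inv_of_part (h : Part a X Y Z) (hp : 5 ≤ p) : Inv a := by
  have hc := h.card
  have hX := card_pos.2 h.pos₁
  have hY := card_pos.2 h.pos₂
  have hZ := card_pos.2 h.pos₃
  by_cases h1 : #X = 1
  · obtain ⟨s, rfl⟩ := card_eq_one.1 h1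
    exact h.inv_of_singleton hp
  by_cases h2 : #Y = 1
  · obtain ⟨s, rfl⟩ := card_eq_one.1 h2
    exact h.swap₁₂.inv_of_singleton hp
  by_cases h3 : #Z = 1
  · obtain ⟨s, rfl⟩ := card_eq_one.1 h3
    exact h.swap₁₃.inv_of_singleton hp
  have hprime : p.Prime := Fact.out
  -- Classes of size at least two rule out 5; at 7 the sizes can only be 2, 2, 3.
  have hp7 : p = 7 ∨ 11 ≤ p := by
    by_contra hcon
    have : p = 6 ∨ p = 8 ∨ p = 9 ∨ p = 10 := by omega
    rcases this with rfl | rfl | rfl | rfl <;> revert hprime <;> norm_num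
  rcases hp7 with rfl | hp
  · rcases Nat.lt_or_ge 2 #X with h4 | h4
    · exact h.rot.inv_of_seven (by omega) (by omega)
    · rcases Nat.lt_or_ge 2 #Y with h5 | h5
      · exact h.swap₂₃.inv_of_seven (by omega) (by omega)
      · exact h.inv_of_seven (by omega) (by omega)
  · by_cases h4 : #X = 2
    · exact h.swap₁₂.inv_of_mid_card_two h4 (by omega) (by omega) hp
    by_cases h5 : #Y = 2
    · exact h.inv_of_mid_card_two h5 (by omega) (by omega) hp
    by_cases h6 : #Z = 2
    · exact h.swap₂₃.inv_of_mid_card_two h6 (by omega) (by omega) hp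
    exact h.inv_of_three_le (by omega) (by omega) (by omega) hp

end Main
end RainbowNumber

namespace RainbowNumber
open Finset Pointwise

/-! ### Partitions into four classes -/

section FourClasses

variable {p : ℕ} [Fact p.Prime] {a : Fin 3 → ZMod p} {C : Fin 4 → Finset (ZMod p)}

/-- A partition of `ℤ/pℤ` into four nonempty classes, without rainbow solutions. -/
structure Quad (a : Fin 3 → ZMod p) (C : Fin 4 → Finset (ZMod p)) : Prop where
  ne : ∀ i, a i ≠ 0
  free : ∀ r x y, r ≠ x → x ≠ y → r ≠ y → Free a (C r) (C x) (C y)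
  disj : ∀ r x, r ≠ x → Disjoint (C r) (C x)
  card : ∑ r, #(C r) = p
  pos : ∀ r, (C r).Nonempty

/-- The four indices are pairwise distinct. -/
abbrev Distinct (r x y z : Fin 4) : Prop := r ≠ x ∧ r ≠ y ∧ r ≠ z ∧ x ≠ y ∧ x ≠ z ∧ y ≠ z

variable {r x y z : Fin 4}

theorem Distinct.rot (h : Distinct r x y z) : Distinct r y z x := by
  obtain ⟨h1, h2, h3, h4, h5, h6⟩ := h
  exact ⟨h2, h3, h1, h6, h4.symm, h5.symm⟩

theorem Distinct.swap₁₂ (h : Distinct r x y z) : Distinct x r y z := by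
  obtain ⟨h1, h2, h3, h4, h5, h6⟩ := h
  exact ⟨h1.symm, h4, h5, h2, h3, h6⟩

theorem Distinct.swap₃₄ (h : Distinct r x y z) : Distinct r x z y := by
  obtain ⟨h1, h2, h3, h4, h5, h6⟩ := h
  exact ⟨h1, h3, h2, h5, h4, h6.symm⟩

theorem Distinct.univ_eq (h : Distinct r x y z) : (univ : Finset (Fin 4)) = {r, x, y, z} := by
  revert h
  revert r x y z
  decide

theorem exists_distinct (r : Fin 4) : ∃ x y z, Distinct r x y z := by
  revert r
  decide

theorem exists_distinct_pair (h : r ≠ x) : ∃ y z, Distinct r x y z := by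
  revert h
  revert r x
  decide

theorem exists_fourth (h1 : r ≠ x) (h2 : r ≠ y) (h3 : x ≠ y) : ∃ z, Distinct r x y z := by
  revert h1 h2 h3
  revert r x y
  decide

theorem Quad.sum_card (h : Quad a C) (hD : Distinct r x y z) :
    #(C r) + #(C x) + #(C y) + #(C z) = p := by
  obtain ⟨h1, h2, h3, h4, h5, h6⟩ := id hD
  have := h.card
  rw [hD.univ_eq, sum_insert (by simp [*]), sum_insert (by simp [*]), sum_insert (by simp [*]),
    sum_singleton] at this
  omega

theorem Quad.part (h : Quad a C) (hD : Distinct r x y z) : Part a (C r) (C x) (C y ∪ C z) := by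
  obtain ⟨h1, h2, h3, h4, h5, h6⟩ := id hD
  exact
  { ne := h.ne
    free := by
      intro i j k hij hjk hik u hu v hv w hw
      rcases mem_union.1 hw with hw | hw
      · exact h.free r x y h1 h4 h2 i j k hij hjk hik u hu v hv w hw
      · exact h.free r x z h1 h5 h3 i j k hij hjk hik u hu v hv w hw
    disj₁₂ := h.disj _ _ h1
    disj₁₃ := disjoint_union_right.2 ⟨h.disj _ _ h2, h.disj _ _ h3⟩
    disj₂₃ := disjoint_union_right.2 ⟨h.disj _ _ h4, h.disj _ _ h5⟩
    card := by
      rw [card_union_of_disjoint (h.disj _ _ h6)]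
      have := h.sum_card hD
      omega
    pos₁ := h.pos r
    pos₂ := h.pos x
    pos₃ := (h.pos y).mono subset_union_left }

theorem Quad.cover (h : Quad a C) (hD : Distinct r x y z) (v : ZMod p) :
    v ∈ C r ∨ v ∈ C x ∨ v ∈ C y ∨ v ∈ C z := by
  have := (h.part hD).cover v
  simpa using this

theorem Quad.vadd (h : Quad a C) (hs : a 0 + a 1 + a 2 = 0) (c : ZMod p) :
    Quad a (fun r => c +ᵥ C r) where
  ne := h.ne
  free r x y hrx hxy hry := by
    obtain ⟨z, hz⟩ := exists_fourth hrx hry hxy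
    intro i j k hij hjk hik u hu v hv w hw
    exact ((h.part hz).vadd hs c).free i j k hij hjk hik u hu v hv w
      (vadd_finset_subset_vadd_finset subset_union_left hw)
  disj r x hrx := by
    rw [disjoint_left]
    intro v
    simp only [mem_vadd_iff]
    exact fun h1 h2 => disjoint_left.1 (h.disj _ _ hrx) h1 h2
  card := by simpa [card_vadd_finset] using h.card
  pos r := (h.pos r).vadd_finset

/-! #### A class of size one -/

/-- The reflection sends the last term `t` to some `t - i d`; the middle term is fixed for even `i`,
and for odd `i` it is swapped with its neighbor. -/
theorem exists_center_mem {X : Finset (ZMod p)} {d s : ZMod p} (hd : d ≠ 0)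
    (h : bd X d = 1) (hs : ∀ x ∈ X, -s - x ∈ X) : ∃ v ∈ X, 2 * v = -s ∨ 2 * v = d - s := by
  obtain ⟨t, ht⟩ := exists_eq_seg hd h
  have hpos : 0 < #X := by have := bd_le_card X d; omega
  have htX : t ∈ X := by rw [ht]; exact mem_seg.2 ⟨0, hpos, by simp⟩
  have h1 := hs t htX
  rw [ht] at h1
  obtain ⟨i, hi, he⟩ := mem_seg.1 h1
  rcases Nat.even_or_odd' i with ⟨m, rfl | rfl⟩
  · refine ⟨t - m * d, ?_, Or.inl ?_⟩
    · rw [ht]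
      exact mem_seg.2 ⟨m, by omega, rfl⟩
    · push_cast at he
      linear_combination he
  · refine ⟨t - m * d, ?_, Or.inr ?_⟩
    · rw [ht]
      exact mem_seg.2 ⟨m, by omega, rfl⟩
    · push_cast at he
      linear_combination he

theorem two_mul_cancel (hp : 3 ≤ p) {u v : ZMod p} (h : 2 * u = 2 * v) : u = v := by
  have h2 : (2 : ZMod p) ≠ 0 := by
    have := natCast_mul_ne (p := p) (d := 1) one_ne_zero (n := 2) (by norm_num) (by omega)
    simpa using this
  exact mul_left_cancel₀ h2 h

/-- The other classes are symmetric, and the sum of two of them stays in their union. Adjoining 0 to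
`C x` makes this sumset so small that Vosper's theorem gives a progression of some difference `d`,
and then `C y` and `C z` are progressions of difference `d` too. Being symmetric without 0, both
contain `d / 2`. -/
theorem Quad.false_of_zero (h : Quad a C) (hr : C r = {0}) (hp : 5 ≤ p) : False := by
  have h0 : ∀ x, r ≠ x → (0 : ZMod p) ∉ C x := fun x hx =>
    disjoint_left.1 (h.disj r x hx) (by simp [hr])
  have hcl : ∀ x, r ≠ x → ∀ i j : Fin 3, i ≠ j → ∀ v ∈ C x, -(a i / a j * v) ∈ C x := by
    intro x hx i j hij v hv
    obtain ⟨y, z, hD⟩ := exists_distinct_pair hx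
    have h1 := h.part hD
    rw [hr] at h1
    exact h1.neg_mem_of_zero hij hv
  have hneg : ∀ x, r ≠ x → ∀ v ∈ C x, -v ∈ C x := by
    intro x hx v hv
    have := hcl x hx 0 2 (by decide) _
      (hcl x hx 2 1 (by decide) _ (hcl x hx 1 0 (by decide) v hv))
    convert this using 1
    have := h.ne 0
    have := h.ne 1
    have := h.ne 2
    field_simp
  have hadd : ∀ x y z, Distinct r x y z → C x + C y ⊆ C x ∪ C y := by
    intro x y z hD v hv
    obtain ⟨u, hu, w, hw, rfl⟩ := mem_add.1 hv
    obtain ⟨h1, h2, h3, h4, h5, h6⟩ := id hD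
    have hs : a 0 * (-(a 2 / a 0 * u)) + a 1 * (-(a 2 / a 1 * w)) + a 2 * (u + w) = 0 := by
      have := h.ne 0
      have := h.ne 1
      field_simp
      ring
    rw [mem_union]
    rcases h.cover hD (u + w) with h7 | h7 | h7 | h7
    · rw [hr, mem_singleton] at h7
      have : w = -u := by linear_combination h7
      exact absurd (this ▸ hneg x h1 u hu) (disjoint_right.1 (h.disj x y h4) hw)
    · exact Or.inl h7
    · exact Or.inr h7
    · exact absurd hs (h.free x y z h4 h6 h5 0 1 2 (by decide) (by decide) (by decide) _
        (hcl x h1 2 0 (by decide) u hu) _ (hcl y h2 2 1 (by decide) w hw) _ h7)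
  have hcard2 : ∀ x, r ≠ x → 2 ≤ #(C x) := by
    intro x hx
    obtain ⟨v, hv⟩ := h.pos x
    refine one_lt_card.2 ⟨v, hv, -v, hneg x hx v hv, ne_neg_self (by omega) ?_⟩
    rintro rfl
    exact h0 x hx hv
  obtain ⟨x, y, z, hD⟩ := exists_distinct r
  obtain ⟨h1, h2, h3, h4, h5, h6⟩ := id hD
  have hsum := h.sum_card hD
  have hr1 : #(C r) = 1 := by rw [hr, card_singleton]
  have hins : #(insert 0 (C x)) = #(C x) + 1 := card_insert_of_notMem (h0 x h1)
  have hsub : ∀ w z', Distinct r x w z' → C w + insert 0 (C x) ⊆ C x ∪ C w := by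
    intro w z' hD' v hv
    obtain ⟨u, hu, u', hu', rfl⟩ := mem_add.1 hv
    rcases mem_insert.1 hu' with rfl | hu'
    · simp [hu]
    · rw [add_comm]
      exact hadd x w z' hD' (add_mem_add hu' hu)
  have hle : ∀ w z', Distinct r x w z' → #(C w + insert 0 (C x)) ≤ #(C x) + #(C w) :=
    fun w z' hD' => (card_le_card (hsub w z' hD')).trans (card_union_le _ _)
  have c2 := hcard2 x h1
  have c3 := hcard2 y h2
  have c4 := hcard2 z h3
  have l3 := hle y z hD
  have l4 := hle z y hD.swap₃₄
  have hAP : IsAP (insert 0 (C x)) := by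
    by_contra hAP
    have := vosper (R := insert 0 (C x)) (X := C y) (by omega) (by omega) (by omega) hAP
    omega
  obtain ⟨d, hd, hxd⟩ := hAP
  have b3 := card_add_bd_add_le hd hxd (by omega) (h.pos y) (by omega)
  have b4 := card_add_bd_add_le hd hxd (by omega) (h.pos z) (by omega)
  have p3 := bd_pos hd (h.pos y) (by omega)
  have p4 := bd_pos hd (h.pos z) (by omega)
  have half : ∀ w, r ≠ w → bd (C w) d = 1 → ∃ v ∈ C w, 2 * v = d := by
    intro w hw hwd
    obtain ⟨v, hv, hv2⟩ := exists_center_mem (s := 0) hd hwd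
      (by simpa using hneg w hw)
    rcases hv2 with hv2 | hv2
    · have : v = 0 := two_mul_cancel (by omega) (by rw [hv2]; ring)
      exact absurd (this ▸ hv) (h0 w hw)
    · exact ⟨v, hv, by simpa using hv2⟩
  obtain ⟨v, hv, hv2⟩ := half y h2 (by omega)
  obtain ⟨w, hw, hw2⟩ := half z h3 (by omega)
  have : v = w := two_mul_cancel (by omega) (hv2.trans hw2.symm)
  exact disjoint_left.1 (h.disj y z h6) hv (this ▸ hw)

theorem bd_third_eq_one {X Y Z : Finset (ZMod p)} {s : ZMod p} (hs : 3 * s ≠ 0)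
    (hXY : Disjoint X Y) (hX : X.Nonempty) (hY : Y.Nonempty) (hZ : Z.Nonempty)
    (hU : ∀ v, v ∈ X ∨ v ∈ Y ∨ v ∈ Z) (hXZ : Disjoint X Z) (hYZ : Disjoint Y Z)
    (h1 : ∀ v ∈ X, -s - v ∈ X) (h2 : ∀ v ∈ Y, -s - v ∈ Y)
    (h3 : ∀ u ∈ X, ∀ v ∈ Y, -(u + v) ∉ Z) : bd Z (3 * s) = 1 := by
  have hmem : ∀ u ∈ X, ∀ v ∈ Y, -(u + v) ∈ X ∪ Y := by
    intro u hu v hv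
    have := h3 u hu v hv
    have := hU (-(u + v))
    rw [mem_union]
    tauto
  have hrefl : ∀ v ∈ X ∪ Y, -s - v ∈ X ∪ Y := by
    intro v hv
    rw [mem_union] at hv ⊢
    exact hv.imp (h1 v) (h2 v)
  have hsub : -s +ᵥ (X + Y + {0, 3 * s}) ⊆ X ∪ Y := by
    intro w hw
    rw [mem_vadd_iff] at hw
    obtain ⟨q, hq, e, he, hw⟩ := mem_add.1 hw
    obtain ⟨u, hu, v, hv, rfl⟩ := mem_add.1 hq
    simp only [mem_insert, mem_singleton] at he
    rcases he with rfl | rfl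
    · have := hrefl _ (hmem u hu v hv)
      convert this using 1
      linear_combination -hw
    · have := hmem _ (h1 u hu) _ (h2 v hv)
      convert this using 1
      linear_combination -hw
  have hZc : Z = (X ∪ Y)ᶜ := by
    ext v
    rw [mem_compl, mem_union, not_or]
    constructor
    · exact fun hv => ⟨disjoint_right.1 hXZ hv, disjoint_right.1 hYZ hv⟩
    · rintro ⟨g1, g2⟩
      have := hU v
      tauto
  have hcXY : #(X ∪ Y) = #X + #Y := card_union_of_disjoint hXY
  have hlt : #(X ∪ Y) < p := by
    have g1 : #Z = p - #(X ∪ Y) := by rw [hZc, card_compl, ZMod.card]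
    have g2 := card_pos.2 hZ
    omega
  have hcard := card_le_card hsub
  rw [card_vadd_finset, card_add_pair] at hcard
  have hpos := bd_pos hs (hX.add hY) (by omega)
  have hcd := cauchy_davenport' hX hY (by omega)
  -- Cauchy–Davenport leaves room for one extra element only, so the inclusion is an equality and
  -- the sumset has one run in direction `3 * s`.
  have heq : -s +ᵥ (X + Y + {0, 3 * s}) = X ∪ Y :=
    eq_of_subset_of_card_le hsub (by rw [card_vadd_finset, card_add_pair]; omega)
  have hle := bd_add_pair_le (X + Y) (3 * s)
  rw [← bd_vadd _ (-s), heq, ← bd_compl, ← hZc] at hle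
  have := bd_pos hs hZ (by rw [hZc, card_compl, ZMod.card]; have := card_pos.2 hX; omega)
  omega

/-- The equation is `u + v + w = 0` up to a factor. After `s` joins the class of `-2s`, the three
resulting classes are symmetric under `v ↦ -s - v` and are progressions of difference `3s`. Each has
a center `v` with `2v = -s` or `2v = 2s`: two candidates for three disjoint classes. -/
theorem Quad.false_of_const (h : Quad a C) {s : ZMod p} (hr : C r = {s}) (hs : s ≠ 0)
    (ha : ∀ i, a i = a 0) (hp : 5 ≤ p) : False := by
  have h3s : 3 * s ≠ 0 := natCast_mul_ne hs (n := 3) (by norm_num) (by omega)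
  have hfree : ∀ x y z, x ≠ y → y ≠ z → x ≠ z → ∀ u ∈ C x, ∀ v ∈ C y, -(u + v) ∉ C z := by
    intro x y z hxy hyz hxz u hu v hv hw
    refine h.free x y z hxy hyz hxz 0 1 2 (by decide) (by decide) (by decide) u hu v hv _ hw ?_
    rw [ha 1, ha 2]
    ring
  have hsr : s ∈ C r := by simp [hr]
  have hx : ∃ x, r ≠ x ∧ -(s + s) ∈ C x := by
    obtain ⟨x, y, z, hD⟩ := exists_distinct r
    rcases h.cover hD (-(s + s)) with h1 | h1 | h1 | h1
    · rw [hr, mem_singleton] at h1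
      exact absurd (by linear_combination -h1) h3s
    · exact ⟨x, hD.1, h1⟩
    · exact ⟨y, hD.2.1, h1⟩
    · exact ⟨z, hD.2.2.1, h1⟩
  obtain ⟨x, hrx, hx2⟩ := hx
  obtain ⟨y, z, hD⟩ := exists_distinct_pair hrx
  have hcl : ∀ y z, Distinct r x y z → ∀ v ∈ C y, -s - v ∈ C y := by
    intro y z hD v hv
    obtain ⟨h1, h2, h3, h4, h5, h6⟩ := id hD
    have e : -s - v = -(s + v) := by ring
    rw [e]
    rcases h.cover hD (-(s + v)) with h7 | h7 | h7 | h7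
    · rw [hr, mem_singleton] at h7
      have : v = -(s + s) := by linear_combination -h7
      exact absurd (this ▸ hv) (disjoint_left.1 (h.disj x y h4) hx2)
    · exact absurd h7 (hfree r y x h2 h4.symm h1 s hsr v hv)
    · exact h7
    · exact absurd h7 (hfree r y z h2 h6 h3 s hsr v hv)
  obtain ⟨h1, h2, h3, h4, h5, h6⟩ := id hD
  have cly := hcl y z hD
  have clz := hcl z y hD.swap₃₄
  have clx : ∀ v ∈ insert s (C x), -s - v ∈ insert s (C x) := by
    intro v hv
    have e : -s - v = -(s + v) := by ring
    rw [e]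
    rcases mem_insert.1 hv with rfl | hv
    · exact mem_insert_of_mem hx2
    · rcases h.cover hD (-(s + v)) with h7 | h7 | h7 | h7
      · rw [hr, mem_singleton] at h7
        rw [h7]
        exact mem_insert_self _ _
      · exact mem_insert_of_mem h7
      · exact absurd h7 (hfree r x y h1 h4 h2 s hsr v hv)
      · exact absurd h7 (hfree r x z h1 h5 h3 s hsr v hv)
  have dxy : Disjoint (insert s (C x)) (C y) :=
    disjoint_insert_left.2 ⟨disjoint_left.1 (h.disj r y h2) hsr, h.disj x y h4⟩
  have dxz : Disjoint (insert s (C x)) (C z) :=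
    disjoint_insert_left.2 ⟨disjoint_left.1 (h.disj r z h3) hsr, h.disj x z h5⟩
  have dyz := h.disj y z h6
  have hU : ∀ v, v ∈ insert s (C x) ∨ v ∈ C y ∨ v ∈ C z := by
    intro v
    have := h.cover hD v
    rw [hr, mem_singleton] at this
    rw [mem_insert]
    tauto
  have hyz : ∀ u ∈ C y, ∀ v ∈ C z, -(u + v) ∉ insert s (C x) := by
    intro u hu v hv hw
    rcases mem_insert.1 hw with hw | hw
    · have := cly u hu
      rw [← hw, show - -(u + v) - u = v by ring] at this
      exact disjoint_left.1 dyz this hv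
    · exact hfree y z x h6 h5.symm h4.symm u hu v hv hw
  have key : ∀ u ∈ insert s (C x), ∀ v ∈ C y, ∀ w ∈ C z, u + v + w ≠ 0 := by
    intro u hu v hv w hw he
    refine hyz v hv w hw ?_
    rwa [show -(v + w) = u by linear_combination -he]
  have nx : (insert s (C x)).Nonempty := insert_nonempty _ _
  have bx := bd_third_eq_one h3s dyz (h.pos y) (h.pos z) nx
    (fun v => by have := hU v; tauto) dxy.symm dxz.symm cly clz hyz
  have by' := bd_third_eq_one h3s dxz nx (h.pos z) (h.pos y)
    (fun v => by have := hU v; tauto) dxy dyz.symm clx clz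
    (fun u hu v hv hw => key u hu _ hw v hv (by ring))
  have bz := bd_third_eq_one h3s dxy nx (h.pos y) (h.pos z) hU dxz dyz clx cly
    (fun u hu v hv hw => key u hu v hv _ hw (by ring))
  obtain ⟨u, hu, hu2⟩ := exists_center_mem h3s bx clx
  obtain ⟨v, hv, hv2⟩ := exists_center_mem h3s by' cly
  obtain ⟨w, hw, hw2⟩ := exists_center_mem h3s bz clz
  have nuv : u ≠ v := fun e => disjoint_left.1 dxy hu (e ▸ hv)
  have nuw : u ≠ w := fun e => disjoint_left.1 dxz hu (e ▸ hw)
  have nvw : v ≠ w := fun e => disjoint_left.1 dyz hv (e ▸ hw)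
  have can : ∀ {b c e : ZMod p}, 2 * b = e → 2 * c = e → b = c := fun h1 h2 =>
    two_mul_cancel (by omega) (h1.trans h2.symm)
  rcases hu2 with hu2 | hu2 <;> rcases hv2 with hv2 | hv2 <;> rcases hw2 with hw2 | hw2
  · exact nuv (can hu2 hv2)
  · exact nuv (can hu2 hv2)
  · exact nuw (can hu2 hw2)
  · exact nvw (can hv2 hw2)
  · exact nvw (can hv2 hw2)
  · exact nuw (can hu2 hw2)
  · exact nuv (can hu2 hv2)
  · exact nuv (can hu2 hv2)

/-- For a singleton `{s}`, two exceptional points always avoid one of the three other classes, so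
every pair of coefficients satisfies `Part.singleton_pair`: `s = 0`, or the coefficient sum
vanishes, or all coefficients agree. -/
theorem Quad.two_le_card (h : Quad a C) (hp : 5 ≤ p) (r : Fin 4) : 2 ≤ #(C r) := by
  by_contra hlt
  have hpos := card_pos.2 (h.pos r)
  obtain ⟨s, hs⟩ := card_eq_one.1 (show #(C r) = 1 by omega)
  obtain ⟨x, y, z, hD⟩ := exists_distinct r
  have hpair : ∀ i j k : Fin 3, i ≠ j → j ≠ k → i ≠ k →
      s * (a i + a j + a k) * (a i - a j) = 0 := by
    intro i j k hij hjk hik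
    have hone : ∀ w, ∀ u v : Fin 4, u ≠ v → ¬ (w ∈ C u ∧ w ∈ C v) :=
      fun w u v huv hw => disjoint_left.1 (h.disj u v huv) hw.1 hw.2
    have key : ∀ x y z, Distinct r x y z → -((a i + a k) / a j * s) ∉ C x →
        -((a j + a i) / a k * s) ∉ C x → s * (a i + a j + a k) * (a i - a j) = 0 := by
      intro x y z hD h1 h2
      have h3 := h.part hD
      rw [hs] at h3
      exact h3.singleton_pair hij hjk hik h1 h2
    have kx := key x y z hD
    have ky := key y z x hD.rot
    have kz := key z x y hD.rot.rot
    obtain ⟨h1, h2, h3, h4, h5, h6⟩ := id hD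
    have o1 := hone (-((a i + a k) / a j * s)) x y h4
    have o2 := hone (-((a i + a k) / a j * s)) x z h5
    have o3 := hone (-((a i + a k) / a j * s)) y z h6
    have o4 := hone (-((a j + a i) / a k * s)) x y h4
    have o5 := hone (-((a j + a i) / a k * s)) x z h5
    have o6 := hone (-((a j + a i) / a k * s)) y z h6
    by_cases A1 : -((a i + a k) / a j * s) ∈ C x
    · by_cases B2 : -((a j + a i) / a k * s) ∈ C y
      · exact kz (fun h => o2 ⟨A1, h⟩) (fun h => o6 ⟨B2, h⟩)
      · exact ky (fun h => o1 ⟨A1, h⟩) B2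
    · by_cases B1 : -((a j + a i) / a k * s) ∈ C x
      · by_cases A2 : -((a i + a k) / a j * s) ∈ C y
        · exact kz (fun h => o3 ⟨A2, h⟩) (fun h => o5 ⟨B1, h⟩)
        · exact ky A2 (fun h => o4 ⟨B1, h⟩)
      · exact kx A1 B1
  by_cases hs0 : s = 0
  · exact h.false_of_zero (hs0 ▸ hs) hp
  by_cases hsum : a 0 + a 1 + a 2 = 0
  · refine (h.vadd hsum (-s)).false_of_zero (r := r) ?_ hp
    simp only [hs]
    exact vadd_singleton_neg s
  have h01 := hpair 0 1 2 (by decide) (by decide) (by decide)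
  have h02 := hpair 0 2 1 (by decide) (by decide) (by decide)
  rw [add_right_comm] at h02
  have e1 := sub_eq_zero.1 ((mul_eq_zero.1 h01).resolve_left (mul_ne_zero hs0 hsum))
  have e2 := sub_eq_zero.1 ((mul_eq_zero.1 h02).resolve_left (mul_ne_zero hs0 hsum))
  refine h.false_of_const hs hs0 ?_ hp
  intro i
  fin_cases i
  · rfl
  · exact e1.symm
  · exact e2.symm

theorem Quad.eleven_le (h : Quad a C) (hp : 5 ≤ p) : 11 ≤ p := by
  have hsum := h.sum_card (r := 0) (x := 1) (y := 2) (z := 3) (by decide)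
  have h0 := h.two_le_card hp 0
  have h1 := h.two_le_card hp 1
  have h2 := h.two_le_card hp 2
  have h3 := h.two_le_card hp 3
  have hprime : p.Prime := Fact.out
  by_contra hcon
  have : p = 8 ∨ p = 9 ∨ p = 10 := by omega
  rcases this with rfl | rfl | rfl <;> revert hprime <;> norm_num

end FourClasses
end RainbowNumber

namespace RainbowNumber
open Finset Pointwise

/-! ### Four classes: none of them is a progression -/

section FourClassesLarge

variable {p : ℕ} [Fact p.Prime] {a : Fin 3 → ZMod p} {C : Fin 4 → Finset (ZMod p)}
  {r x y z : Fin 4}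

/-- The number of pairs with difference `d` between `A` and `B`, in either order. -/
def adj (A B : Finset (ZMod p)) (d : ZMod p) : ℕ := #{x ∈ A | x + d ∈ B} + #{x ∈ B | x + d ∈ A}

theorem adj_comm (A B : Finset (ZMod p)) (d : ZMod p) : adj A B d = adj B A d := Nat.add_comm _ _

theorem adj_union {A B B' : Finset (ZMod p)} (h : Disjoint B B') (d : ZMod p) :
    adj A (B ∪ B') d = adj A B d + adj A B' d := by
  have h1 : #{x ∈ A | x + d ∈ B ∪ B'} = #{x ∈ A | x + d ∈ B} + #{x ∈ A | x + d ∈ B'} := by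
    rw [← card_union_of_disjoint, ← filter_or]
    · simp only [mem_union]
    · rw [disjoint_left]
      intro x h1 h2
      exact disjoint_left.1 h (mem_filter.1 h1).2 (mem_filter.1 h2).2
  have h2 : #{x ∈ B ∪ B' | x + d ∈ A} = #{x ∈ B | x + d ∈ A} + #{x ∈ B' | x + d ∈ A} := by
    rw [filter_union, card_union_of_disjoint (disjoint_filter_filter h)]
  unfold adj
  omega

theorem two_mul_bd (X : Finset (ZMod p)) (d : ZMod p) : 2 * bd X d = adj X Xᶜ d := by
  have h := bd_compl X d
  unfold bd at h
  unfold adj bd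
  simp only [mem_compl, not_not] at h ⊢
  omega

theorem Quad.disjoint_union (h : Quad a C) (hD : Distinct r x y z) :
    Disjoint (C r ∪ C x) (C y ∪ C z) := by
  obtain ⟨h1, h2, h3, h4, h5, h6⟩ := hD
  rw [disjoint_union_left, disjoint_union_right, disjoint_union_right]
  exact ⟨⟨h.disj _ _ h2, h.disj _ _ h3⟩, h.disj _ _ h4, h.disj _ _ h5⟩

theorem Quad.compl_union (h : Quad a C) (hD : Distinct r x y z) :
    (C r ∪ C x)ᶜ = C y ∪ C z := by
  have := h.disjoint_union hD
  ext v
  rw [mem_compl]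
  constructor
  · intro hv
    have := h.cover hD v
    rw [mem_union] at hv ⊢
    tauto
  · exact fun hv => disjoint_right.1 this hv

theorem Quad.compl_eq (h : Quad a C) (hD : Distinct r x y z) :
    (C r)ᶜ = C x ∪ (C y ∪ C z) := by
  have h1 := h.part hD
  ext v
  rw [mem_compl]
  constructor
  · intro hv
    have := h1.cover v
    rw [mem_union]
    tauto
  · exact fun hv => disjoint_right.1 (disjoint_union_right.2 ⟨h1.disj₁₂, h1.disj₁₃⟩) hv

theorem Quad.two_mul_bd (h : Quad a C) (hD : Distinct r x y z) (d : ZMod p) :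
    2 * bd (C r) d = adj (C r) (C x) d + adj (C r) (C y) d + adj (C r) (C z) d := by
  rw [RainbowNumber.two_mul_bd, h.compl_eq hD, adj_union (h.part hD).disj₂₃,
    adj_union (h.disj _ _ hD.2.2.2.2.2), add_assoc]

theorem Quad.two_mul_bd_union (h : Quad a C) (hD : Distinct r x y z) (d : ZMod p) :
    2 * bd (C r ∪ C x) d = adj (C r) (C y) d + adj (C r) (C z) d +
      (adj (C x) (C y) d + adj (C x) (C z) d) := by
  have hyz := hD.2.2.2.2.2
  rw [RainbowNumber.two_mul_bd, h.compl_union hD, adj_comm, adj_union (h.disj _ _ hD.1),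
    adj_comm _ (C r), adj_comm _ (C x), adj_union (h.disj _ _ hyz), adj_union (h.disj _ _ hyz)]

theorem Quad.card_add_two_le (h : Quad a C) (hp : 5 ≤ p) (r : Fin 4) : #(C r) + 2 ≤ p := by
  obtain ⟨x, y, z, hD⟩ := exists_distinct r
  have := h.sum_card hD
  have := h.two_le_card hp x
  omega

theorem Quad.bd_pos (h : Quad a C) (hp : 5 ≤ p) (r : Fin 4) {d : ZMod p} (hd : d ≠ 0) :
    0 < bd (C r) d := by
  have := h.card_add_two_le hp r
  exact RainbowNumber.bd_pos hd (h.pos r) (by omega)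

theorem Quad.eq_or_eq_neg (h : Quad a C) (hp : 5 ≤ p) {d e : ZMod p} (hd : d ≠ 0) (he : e ≠ 0)
    (h1 : bd (C r) d = 1) (h2 : bd (C r) e = 1) : e = d ∨ e = -d :=
  eq_or_eq_neg_of_bd_eq_one hd h1 he h2 (h.two_le_card hp r) (h.card_add_two_le hp r)

theorem Quad.bd_le_two (h : Quad a C) (hp : 5 ≤ p) (hrx : r ≠ x) {d : ZMod p} (hd : d ≠ 0)
    (hr : bd (C r) d = 1) {i j : Fin 3} (hij : i ≠ j) : bd (C x) (a i / a j * d) ≤ 2 := by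
  obtain ⟨y, z, hD⟩ := exists_distinct_pair hrx
  exact (h.part hD).swap₁₂.bd_le_two hd hr (h.two_le_card hp r) hij

theorem Quad.bd_union_le_two (h : Quad a C) (hp : 5 ≤ p) (hD : Distinct r x y z) {d : ZMod p}
    (hd : d ≠ 0) (hr : bd (C r) d = 1) {i j : Fin 3} (hij : i ≠ j) :
    bd (C r ∪ C x) (a i / a j * d) ≤ 2 := by
  rw [← bd_compl, h.compl_union hD]
  exact (h.part hD).swap₁₃.swap₂₃.bd_le_two hd hr (h.two_le_card hp r) hij

/-- Here `f` are boundaries of classes, `g` of unions with class 0, and `r`, `s` adjacencies. The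
relations give `rᵢ = f₀ + fᵢ - gᵢ ≥ f₀ + fᵢ - 2`; summing, `f₀ + f₁ + f₂ + f₃ ≤ 6`. A single `fᵢ =
1` forces `f₀ = 1` and equality throughout, so `rᵢ = 0`. -/
theorem boundary_cases {f₀ f₁ f₂ f₃ g₁ g₂ g₃ r₁ r₂ r₃ s₁₂ s₁₃ s₂₃ : ℕ} (p₀ : 0 < f₀)
    (p₁ : 0 < f₁) (p₂ : 0 < f₂) (p₃ : 0 < f₃) (b₁ : f₁ ≤ 2) (b₂ : f₂ ≤ 2) (b₃ : f₃ ≤ 2)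
    (c₁ : g₁ ≤ 2) (c₂ : g₂ ≤ 2) (c₃ : g₃ ≤ 2) (e₀ : 2 * f₀ = r₁ + r₂ + r₃)
    (e₁ : 2 * f₁ = r₁ + s₁₂ + s₁₃) (e₂ : 2 * f₂ = r₂ + s₂₃ + s₁₂)
    (e₃ : 2 * f₃ = r₃ + s₁₃ + s₂₃) (v₁ : 2 * g₁ = r₂ + r₃ + (s₁₂ + s₁₃))
    (v₂ : 2 * g₂ = r₃ + r₁ + (s₂₃ + s₁₂)) (v₃ : 2 * g₃ = r₁ + r₂ + (s₁₃ + s₂₃)) :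
    (f₁ = 1 ∧ f₂ = 1) ∨ (f₁ = 1 ∧ f₃ = 1) ∨ (f₂ = 1 ∧ f₃ = 1) ∨
      (f₀ = 1 ∧ f₁ = 1 ∧ r₁ = 0) ∨ (f₀ = 1 ∧ f₂ = 1 ∧ r₂ = 0) ∨ (f₀ = 1 ∧ f₃ = 1 ∧ r₃ = 0) := by
  have h1 : f₁ = 1 ∨ f₁ = 2 := by omega
  have h2 : f₂ = 1 ∨ f₂ = 2 := by omega
  have h3 : f₃ = 1 ∨ f₃ = 2 := by omega
  rcases h1 with rfl | rfl <;> rcases h2 with rfl | rfl <;> rcases h3 with rfl | rfl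
  · simp
  · simp
  · simp
  · right; right; right; left; omega
  · simp
  · right; right; right; right; left; omega
  · right; right; right; right; right; omega
  · omega

theorem Quad.parallel (h : Quad a C) (hp : 5 ≤ p) {d : ZMod p} (hd : d ≠ 0)
    (hr : bd (C r) d = 1) {i j : Fin 3} (hij : i ≠ j) :
    (∃ u v, u ≠ v ∧ r ≠ u ∧ r ≠ v ∧ bd (C u) (a i / a j * d) = 1 ∧
      bd (C v) (a i / a j * d) = 1) ∨
    (bd (C r) (a i / a j * d) = 1 ∧ ∃ u, r ≠ u ∧ bd (C u) (a i / a j * d) = 1 ∧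
      adj (C r) (C u) (a i / a j * d) = 0) := by
  obtain ⟨x, y, z, hD⟩ := exists_distinct r
  obtain ⟨h1, h2, h3, h4, h5, h6⟩ := id hD
  have he : a i / a j * d ≠ 0 := mul_ne_zero (div_ne_zero (h.ne i) (h.ne j)) hd
  have b1 := h.bd_le_two hp h1 hd hr hij
  have b2 := h.bd_le_two hp h2 hd hr hij
  have b3 := h.bd_le_two hp h3 hd hr hij
  have u1 := h.bd_union_le_two hp hD hd hr hij
  have u2 := h.bd_union_le_two hp hD.rot hd hr hij
  have u3 := h.bd_union_le_two hp hD.rot.rot hd hr hij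
  set e := a i / a j * d
  have p0 := h.bd_pos hp r he
  have p1 := h.bd_pos hp x he
  have p2 := h.bd_pos hp y he
  have p3 := h.bd_pos hp z he
  have e0 := h.two_mul_bd hD e
  have e1 := h.two_mul_bd hD.swap₁₂ e
  have e2 := h.two_mul_bd hD.rot.swap₁₂ e
  have e3 := h.two_mul_bd hD.rot.rot.swap₁₂ e
  have v1 := h.two_mul_bd_union hD e
  have v2 := h.two_mul_bd_union hD.rot e
  have v3 := h.two_mul_bd_union hD.rot.rot e
  rw [adj_comm (C x) (C r)] at e1
  rw [adj_comm (C y) (C r), adj_comm (C y) (C x)] at e2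
  rw [adj_comm (C z) (C r), adj_comm (C z) (C x), adj_comm (C z) (C y)] at e3
  rw [adj_comm (C y) (C x)] at v2
  rw [adj_comm (C z) (C x), adj_comm (C z) (C y)] at v3
  rcases boundary_cases p0 p1 p2 p3 b1 b2 b3 u1 u2 u3 e0 e1 e2 e3 v1 v2 v3 with
    ⟨f1, f2⟩ | ⟨f1, f3⟩ | ⟨f2, f3⟩ | ⟨f0, f1, g⟩ | ⟨f0, f2, g⟩ | ⟨f0, f3, g⟩
  · exact Or.inl ⟨x, y, h4, h1, h2, f1, f2⟩
  · exact Or.inl ⟨x, z, h5, h1, h3, f1, f3⟩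
  · exact Or.inl ⟨y, z, h6, h2, h3, f2, f3⟩
  · exact Or.inr ⟨f0, x, h1, f1, g⟩
  · exact Or.inr ⟨f0, y, h2, f2, g⟩
  · exact Or.inr ⟨f0, z, h3, f3, g⟩

/-- A progression of at least three terms has at most two runs only along `±d` and `±2d`; the ratio
would be `±2`, whose square 4 is not `±1` since 3 and 5 are nonzero modulo `p`. -/
theorem Quad.card_eq_two (h : Quad a C) (hp : 11 ≤ p) (hrx : r ≠ x) {d : ZMod p} (hd : d ≠ 0)
    (hr : bd (C r) d = 1) (hx : bd (C x) d = 1) {i j : Fin 3} (hij : i ≠ j)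
    (h1 : a i / a j ≠ 1) (h2 : a i / a j ≠ -1)
    (h3 : (a i / a j) ^ 2 = 1 ∨ (a i / a j) ^ 2 = -1) : #(C x) = 2 := by
  by_contra hne
  have h4 := h.two_le_card (by omega) x
  obtain ⟨y, z, hD⟩ := exists_distinct_pair hrx
  have h5 := h.sum_card hD
  have h6 := h.two_le_card (by omega) r
  have h7 := h.two_le_card (by omega) y
  have he : a i / a j * d ≠ 0 := mul_ne_zero (div_ne_zero (h.ne i) (h.ne j)) hd
  have n3 := natCast_mul_ne (p := p) (d := 1) one_ne_zero (n := 3) (by norm_num) (by omega)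
  have n5 := natCast_mul_ne (p := p) (d := 1) one_ne_zero (n := 5) (by norm_num) (by omega)
  push_cast at n3 n5
  have can : ∀ c : ZMod p, a i / a j * d = c * d → a i / a j = c :=
    fun c hc => mul_right_cancel₀ hd hc
  have two : a i / a j = 2 ∨ a i / a j = -2 → False := by
    intro h8
    have h9 : (a i / a j) ^ 2 = 4 := by rcases h8 with h8 | h8 <;> rw [h8] <;> ring
    rcases h3 with h3 | h3
    · exact n3 (by linear_combination h3 - h9)
    · exact n5 (by linear_combination h3 - h9)
  rcases mem_four_of_bd_le_two hd hx he (h.bd_le_two (by omega) hrx hd hr hij) (by omega)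
    (by omega) with h8 | h8 | h8 | h8
  · exact h1 (can 1 (by rw [h8, one_mul]))
  · exact h2 (can (-1) (by rw [h8]; ring))
  · exact two (Or.inl (can 2 h8))
  · exact two (Or.inr (can (-2) (by rw [h8]; ring)))

/-- A class has one direction up to sign, so none is a progression along both `e` and `(a i / a j) *
e`. Applying `Quad.parallel` twice splits the classes into two pairs of parallel progressions and
makes the squared ratio `±1`; all four classes then have two elements and `p = 8`. -/
theorem Quad.false_of_ratio (h : Quad a C) (hp : 11 ≤ p) {d : ZMod p} (hd : d ≠ 0)
    (hr : bd (C r) d = 1) {i j : Fin 3} (hij : i ≠ j) (h1 : a i / a j ≠ 1)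
    (h2 : a i / a j ≠ -1) : False := by
  have hp5 : 5 ≤ p := by omega
  have hρ : a i / a j ≠ 0 := div_ne_zero (h.ne i) (h.ne j)
  have hno : ∀ (u : Fin 4) (e : ZMod p), e ≠ 0 → bd (C u) e = 1 →
      bd (C u) (a i / a j * e) = 1 → False := by
    intro u e he hu hu'
    rcases h.eq_or_eq_neg hp5 he (mul_ne_zero hρ he) hu hu' with h3 | h3
    · exact h1 (mul_right_cancel₀ he (by rw [h3, one_mul]))
    · exact h2 (mul_right_cancel₀ he (by rw [h3]; ring))
  rcases h.parallel hp5 hd hr hij with ⟨u, v, huv, hru, hrv, hu, hv⟩ | ⟨h3, -⟩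
  swap
  · exact hno r d hd hr h3
  have hd1 : a i / a j * d ≠ 0 := mul_ne_zero hρ hd
  have hd2 := mul_ne_zero hρ hd1
  rcases h.parallel hp5 hd1 hu hij with ⟨u', v', huv', huu', huv'', hu', hv'⟩ | ⟨h3, -⟩
  swap
  · exact hno u _ hd1 hu h3
  have hu'v : u' ≠ v := by
    rintro rfl
    exact hno _ _ hd1 hv hu'
  have hv'v : v' ≠ v := by
    rintro rfl
    exact hno _ _ hd1 hv hv'
  obtain ⟨w, hD, hr', hw'⟩ : ∃ w, Distinct r u v w ∧ bd (C r) (a i / a j * (a i / a j * d)) = 1 ∧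
      bd (C w) (a i / a j * (a i / a j * d)) = 1 := by
    have : ∀ r u v u' v' : Fin 4, u ≠ v → r ≠ u → r ≠ v → u' ≠ v' → u ≠ u' → u ≠ v' → u' ≠ v →
        v' ≠ v → (u' = r ∧ Distinct r u v v') ∨ (v' = r ∧ Distinct r u v u') := by decide
    rcases this r u v u' v' huv hru hrv huv' huu' huv'' hu'v hv'v with ⟨rfl, hD⟩ | ⟨rfl, hD⟩
    · exact ⟨v', hD, hu', hv'⟩
    · exact ⟨u', hD, hv', hu'⟩
  have hsq := h.eq_or_eq_neg hp5 hd hd2 hr hr'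
  have hw : bd (C w) d = 1 := by
    rcases hsq with h3 | h3
    · rwa [h3] at hw'
    · rwa [h3, bd_neg] at hw'
  have hsq' : (a i / a j) ^ 2 = 1 ∨ (a i / a j) ^ 2 = -1 := by
    refine hsq.imp (fun h3 => ?_) (fun h3 => ?_)
    · exact mul_right_cancel₀ hd (by linear_combination h3)
    · exact mul_right_cancel₀ hd (by linear_combination h3)
  have c1 := h.card_eq_two hp hD.2.2.1 hd hr hw hij h1 h2 hsq'
  have c2 := h.card_eq_two hp hD.2.2.1.symm hd hw hr hij h1 h2 hsq'
  have c3 := h.card_eq_two hp huv hd1 hu hv hij h1 h2 hsq'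
  have c4 := h.card_eq_two hp huv.symm hd1 hv hu hij h1 h2 hsq'
  have := h.sum_card hD
  omega

theorem bd_add_le_mul (X Y : Finset (ZMod p)) (d : ZMod p) : bd (X + Y) d ≤ bd X d * bd Y d := by
  refine (card_le_card ?_).trans (card_add_le (s := {x ∈ X | x + d ∉ X}) (t := {y ∈ Y | y + d ∉ Y}))
  intro v hv
  obtain ⟨hv, hv'⟩ := mem_filter.1 hv
  obtain ⟨x, hx, y, hy, rfl⟩ := mem_add.1 hv
  refine add_mem_add (mem_filter.2 ⟨hx, fun h => hv' ?_⟩) (mem_filter.2 ⟨hy, fun h => hv' ?_⟩)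
  · rw [add_right_comm]
    exact add_mem_add h hy
  · rw [add_assoc]
    exact add_mem_add hx h

/-- Parallel classes are adjacent when all coefficients agree up to sign. -/
theorem Quad.adj_pos (h : Quad a C) (hp : 5 ≤ p)
    (hΛ : ∀ i j : Fin 3, i ≠ j → a i / a j = 1 ∨ a i / a j = -1) (hrx : r ≠ x) {d : ZMod p}
    (hd : d ≠ 0) (hr : bd (C r) d = 1) (hx : bd (C x) d = 1) : 0 < adj (C r) (C x) d := by
  by_contra h0
  obtain ⟨y, z, hD⟩ := exists_distinct_pair hrx
  obtain ⟨h1, h2, h3, h4, h5, h6⟩ := id hD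
  have hsgn : ∀ i (X : Finset (ZMod p)), i ≠ (2 : Fin 3) →
      bd ((-(a i / a 2)) • X) d = bd X d := by
    intro i X hi
    have hne := neg_ne_zero.2 (div_ne_zero (h.ne i) (h.ne 2))
    rw [← bd_smul X d hne]
    rcases hΛ i 2 hi with e | e
    · rw [e, neg_one_mul, bd_neg]
    · rw [e, neg_neg, one_mul]
  have hcs : ∀ i (X : Finset (ZMod p)), #((-(a i / a 2)) • X) = #X := fun i X =>
    card_smul_finset₀ (neg_ne_zero.2 (div_ne_zero (h.ne i) (h.ne 2))) X
  set A := (-(a 0 / a 2)) • C r with hA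
  set B := (-(a 1 / a 2)) • C x with hB
  have hbd : bd (A + B) d ≤ 1 := by
    have := bd_add_le_mul A B d
    rwa [hsgn 0 _ (by decide), hsgn 1 _ (by decide), hr, hx] at this
  have hsub : ∀ v ∈ A + B, v ∈ C r ∨ v ∈ C x := by
    intro v hv
    obtain ⟨u', hu', w', hw', rfl⟩ := mem_add.1 hv
    obtain ⟨u, hu, rfl⟩ := mem_smul_finset.1 hu'
    obtain ⟨w, hw, rfl⟩ := mem_smul_finset.1 hw'
    have hs : a 0 * u + a 1 * w + a 2 * (-(a 0 / a 2) • u + -(a 1 / a 2) • w) = 0 := by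
      have := h.ne 2
      simp only [smul_eq_mul]
      field_simp
      ring
    rcases h.cover hD (-(a 0 / a 2) • u + -(a 1 / a 2) • w) with h7 | h7 | h7 | h7
    · exact Or.inl h7
    · exact Or.inr h7
    · exact absurd hs (h.free r x y h1 h4 h2 0 1 2 (by decide) (by decide) (by decide)
        u hu w hw _ h7)
    · exact absurd hs (h.free r x z h1 h5 h3 0 1 2 (by decide) (by decide) (by decide)
        u hu w hw _ h7)
  have hadj : (∀ v ∈ C r, v + d ∉ C x) ∧ ∀ v ∈ C x, v + d ∉ C r := by
    unfold adj at h0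
    constructor
    · have : #{v ∈ C r | v + d ∈ C x} = 0 := by omega
      simpa [filter_eq_empty_iff] using this
    · have : #{v ∈ C x | v + d ∈ C r} = 0 := by omega
      simpa [filter_eq_empty_iff] using this
  have hcr := h.two_le_card hp r
  have hcx := h.two_le_card hp x
  have hcy := h.two_le_card hp y
  have hsum := h.sum_card hD
  have hcA : #A = #(C r) := hcs 0 _
  have hcB : #B = #(C x) := hcs 1 _
  have hle : #(A + B) ≤ #(C r) + #(C x) := by
    refine (card_le_card (fun v hv => ?_)).trans (card_union_le _ _)
    exact mem_union.2 (hsub v hv)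
  have hcd := cauchy_davenport' (X := A) (Y := B) (card_pos.1 (by omega)) (card_pos.1 (by omega))
    (by omega)
  have hdis : Disjoint ((A + B) ∩ C r) ((A + B) ∩ C x) :=
    (h.disj r x h1).mono inter_subset_right inter_subset_right
  have hsplit : #((A + B) ∩ C r) + #((A + B) ∩ C x) = #(A + B) := by
    rw [← card_union_of_disjoint hdis, ← inter_union_distrib_left, inter_eq_left.2]
    exact fun v hv => mem_union.2 (hsub v hv)
  have i1 : #((A + B) ∩ C r) ≤ #(C r) := card_le_card inter_subset_right
  have i2 : #((A + B) ∩ C x) ≤ #(C x) := card_le_card inter_subset_right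
  have b1 := RainbowNumber.bd_pos hd (X := (A + B) ∩ C r) (card_pos.1 (by omega)) (by omega)
  have b2 := RainbowNumber.bd_pos hd (X := (A + B) ∩ C x) (card_pos.1 (by omega)) (by omega)
  -- The sumset lies in the two classes and meets both. Without adjacency, the runs of the two
  -- traces stay separate, giving boundary at least 2 instead of 1.
  have hfin : bd ((A + B) ∩ C r) d + bd ((A + B) ∩ C x) d ≤ bd (A + B) d := by
    unfold bd
    rw [← card_union_of_disjoint (disjoint_filter_filter hdis)]
    refine card_le_card (fun v hv => ?_)
    rcases mem_union.1 hv with hv | hv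
    · obtain ⟨g1, g2⟩ := mem_filter.1 hv
      obtain ⟨g3, g4⟩ := mem_inter.1 g1
      refine mem_filter.2 ⟨g3, fun g5 => ?_⟩
      rcases hsub _ g5 with g6 | g6
      · exact g2 (mem_inter.2 ⟨g5, g6⟩)
      · exact hadj.1 v g4 g6
    · obtain ⟨g1, g2⟩ := mem_filter.1 hv
      obtain ⟨g3, g4⟩ := mem_inter.1 g1
      refine mem_filter.2 ⟨g3, fun g5 => ?_⟩
      rcases hsub _ g5 with g6 | g6
      · exact hadj.2 v g4 g6
      · exact g2 (mem_inter.2 ⟨g5, g6⟩)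
  omega

/-- With all ratios `±1`, `Quad.parallel` keeps the direction. Three parallel classes, adjacent in
pairs, use up all six run ends among themselves and leave none for the fourth class. -/
theorem Quad.not_isAP (h : Quad a C) (hp : 5 ≤ p) (r : Fin 4) : ¬ IsAP (C r) := by
  rintro ⟨d, hd, hr⟩
  have hp11 := h.eleven_le hp
  by_cases hΛ : ∀ i j : Fin 3, i ≠ j → a i / a j = 1 ∨ a i / a j = -1
  swap
  · push Not at hΛ
    obtain ⟨i, j, hij, h1, h2⟩ := hΛ
    exact h.false_of_ratio hp11 hd hr hij h1 h2
  have hpar := h.parallel hp hd hr (show (0 : Fin 3) ≠ 1 by decide)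
  have hdir : a 0 / a 1 * d = d ∨ a 0 / a 1 * d = -d := by
    rcases hΛ 0 1 (by decide) with e | e <;> rw [e]
    · exact Or.inl (one_mul d)
    · exact Or.inr (by ring)
  have hd' : a 0 / a 1 * d ≠ 0 := by
    rcases hdir with e | e <;> rw [e]
    · exact hd
    · exact neg_ne_zero.2 hd
  have hr' : bd (C r) (a 0 / a 1 * d) = 1 := by
    rcases hdir with e | e <;> rw [e]
    · exact hr
    · rwa [bd_neg]
  rcases hpar with ⟨u, v, huv, hru, hrv, hu, hv⟩ | ⟨-, u, hru, hu, hadj⟩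
  · obtain ⟨w, hD⟩ := exists_fourth hru hrv huv
    have p1 := h.adj_pos hp hΛ hru hd' hr' hu
    have p2 := h.adj_pos hp hΛ hrv hd' hr' hv
    have p3 := h.adj_pos hp hΛ huv hd' hu hv
    have p4 := h.bd_pos hp w hd'
    set e := a 0 / a 1 * d
    have e0 := h.two_mul_bd hD e
    have e1 := h.two_mul_bd hD.swap₁₂ e
    have e2 := h.two_mul_bd hD.rot.swap₁₂ e
    have e3 := h.two_mul_bd hD.rot.rot.swap₁₂ e
    rw [adj_comm (C u) (C r)] at e1
    rw [adj_comm (C v) (C r), adj_comm (C v) (C u)] at e2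
    rw [adj_comm (C w) (C r), adj_comm (C w) (C u), adj_comm (C w) (C v)] at e3
    omega
  · have := h.adj_pos hp hΛ hru hd' hr' hu
    omega

end FourClassesLarge
end RainbowNumber

namespace RainbowNumber
open Finset Pointwise

/-! ### Four classes: contradiction from the boundaries -/

section FourClassesFinal

variable {p : ℕ} [Fact p.Prime] {a : Fin 3 → ZMod p} {C : Fin 4 → Finset (ZMod p)}
  {r x y z : Fin 4}

theorem Quad.three_le_card (h : Quad a C) (hp : 5 ≤ p) (r : Fin 4) : 3 ≤ #(C r) := by
  have h1 := h.two_le_card hp r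
  have h2 : #(C r) ≠ 2 := fun h2 => h.not_isAP hp r (isAP_of_card_two (by omega) h2)
  omega

theorem Quad.two_le_bd (h : Quad a C) (hp : 5 ≤ p) (r : Fin 4) {d : ZMod p} (hd : d ≠ 0) :
    2 ≤ bd (C r) d := by
  have := h.card_add_two_le hp r
  exact RainbowNumber.two_le_bd (h.not_isAP hp r) (h.pos r) (by omega) hd

theorem Quad.card_union (h : Quad a C) (hrx : r ≠ x) : #(C r ∪ C x) = #(C r) + #(C x) :=
  card_union_of_disjoint (h.disj _ _ hrx)

theorem Quad.bd_union_eq (h : Quad a C) (hp : 5 ≤ p) (hD : Distinct r x y z) {d : ZMod p}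
    (h1 : bd (C r) d + 2 ≤ #(C r)) (h2 : bd (C r) d + 2 ≤ #(C y) + #(C z)) :
    bd (C y ∪ C z) d = bd (C r) d := by
  have hu := h.card_union hD.2.2.2.2.2
  have hy := h.two_le_card hp y
  exact (h.part hD).bd_self_eq (h.not_isAP hp x) (h.two_le_card hp r) (h.two_le_card hp x)
    (by omega) h1 (by omega)

theorem Quad.bd_eq_union (h : Quad a C) (hp : 5 ≤ p) (hD : Distinct r x y z) {d : ZMod p}
    (h1 : bd (C y ∪ C z) d + 2 ≤ #(C r)) (h2 : bd (C y ∪ C z) d + 2 ≤ #(C y) + #(C z)) :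
    bd (C r) d = bd (C y ∪ C z) d := by
  have hu := h.card_union hD.2.2.2.2.2
  have hy := h.two_le_card hp y
  exact (h.part hD).swap₁₃.bd_self_eq (h.not_isAP hp x) (by omega) (h.two_le_card hp x)
    (h.two_le_card hp r) (by omega) h1

theorem Quad.exists_bd_add_two_le (h : Quad a C) (hp : 5 ≤ p) (hrx : r ≠ x)
    (hc : #(C r) ≤ #(C x)) (h4 : 4 ≤ #(C x)) : ∃ d ≠ 0, bd (C x) d + 2 ≤ #(C x) := by
  obtain ⟨y, z, hD⟩ := exists_distinct_pair hrx
  have h1 := (h.part hD).swap₁₂.card_add_le (show (0 : Fin 3) ≠ 1 by decide)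
  have hne : ∀ i j, a i / a j ≠ 0 := fun i j => div_ne_zero (h.ne i) (h.ne j)
  have h6 : #((a 0 / a 1) • C x) = #(C x) := card_smul_finset₀ (hne 0 1) _
  obtain ⟨e, he, he2⟩ := RainbowNumber.exists_bd_add_two_le (X := (a 0 / a 1) • C x) (Y := C r)
    (by omega) (h.three_le_card hp r) (by omega) (by omega)
  have e1 : e = a 0 / a 1 * (a 1 / a 0 * e) := by
    have := h.ne 0
    have := h.ne 1
    field_simp
  rw [e1, bd_smul _ _ (hne 0 1), h6] at he2
  exact ⟨_, mul_ne_zero (hne 1 0) he, he2⟩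

/-- Summing `e₁`–`e₃` gives `3m = f + S`, summing `v₁`–`v₃` gives `3m = 2f + S`, with `S` the sum of
the `sᵢⱼ`; hence `f = 0`. -/
theorem boundary_false {m f r₁ r₂ r₃ s₁₂ s₁₃ s₂₃ : ℕ} (hf : 0 < f)
    (e₀ : 2 * f = r₁ + r₂ + r₃) (e₁ : 2 * m = r₁ + s₁₂ + s₁₃) (e₂ : 2 * m = r₂ + s₂₃ + s₁₂)
    (e₃ : 2 * m = r₃ + s₁₃ + s₂₃) (v₁ : 2 * m = r₂ + r₃ + (s₁₂ + s₁₃))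
    (v₂ : 2 * m = r₃ + r₁ + (s₂₃ + s₁₂)) (v₃ : 2 * m = r₁ + r₂ + (s₁₃ + s₂₃)) : False := by
  omega

theorem Quad.false_of_four_le (h : Quad a C) (hp : 5 ≤ p) (hD : Distinct r x y z)
    (h1 : #(C r) ≤ #(C x)) (h2 : #(C x) ≤ #(C y)) (h3 : #(C y) ≤ #(C z)) (h4 : 4 ≤ #(C x)) :
    False := by
  obtain ⟨d, hd, hx⟩ := h.exists_bd_add_two_le hp hD.1 h1 h4
  have c := h.three_le_card hp r
  have g1 := h.bd_union_eq hp hD.swap₁₂ hx (by omega)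
  have g2 := h.bd_union_eq hp hD.swap₁₂.rot hx (by omega)
  have g3 := h.bd_union_eq hp hD.swap₁₂.rot.rot hx (by omega)
  have fy := h.bd_eq_union hp (r := y) (x := x) (y := z) (z := r)
    ⟨hD.2.2.2.1.symm, hD.2.2.2.2.2, hD.2.1.symm, hD.2.2.2.2.1, hD.1.symm, hD.2.2.1.symm⟩ (d := d)
    (by omega) (by omega)
  have fz := h.bd_eq_union hp (r := z) (x := x) (y := r) (z := y)
    ⟨hD.2.2.2.2.1.symm, hD.2.2.1.symm, hD.2.2.2.2.2.symm, hD.1.symm, hD.2.2.2.1, hD.2.1⟩ (d := d)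
    (by omega) (by omega)
  have p0 := h.bd_pos hp r hd
  have e0 := h.two_mul_bd hD d
  have e1 := h.two_mul_bd hD.swap₁₂ d
  have e2 := h.two_mul_bd hD.rot.swap₁₂ d
  have e3 := h.two_mul_bd hD.rot.rot.swap₁₂ d
  have v1 := h.two_mul_bd_union hD d
  have v2 := h.two_mul_bd_union hD.rot d
  have v3 := h.two_mul_bd_union hD.rot.rot d
  rw [← bd_compl, h.compl_union hD, g1] at v1
  rw [g3] at v2
  rw [union_comm, g2] at v3
  rw [fy, g2] at e2
  rw [fz, g3] at e3
  rw [adj_comm (C x) (C r)] at e1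
  rw [adj_comm (C y) (C r), adj_comm (C y) (C x)] at e2
  rw [adj_comm (C z) (C r), adj_comm (C z) (C x), adj_comm (C z) (C y)] at e3
  rw [adj_comm (C y) (C x)] at v2
  rw [adj_comm (C z) (C x), adj_comm (C z) (C y)] at v3
  exact boundary_false p0 e0 e1 e2 e3 v1 v2 v3

theorem boundary_eq {m f₁ f₂ f₃ z₁ z₂ z₃ s₁₂ s₁₃ s₂₃ : ℕ}
    (e₀ : 2 * m = z₁ + z₂ + z₃) (e₁ : 2 * f₁ = z₁ + s₁₂ + s₁₃) (e₂ : 2 * f₂ = z₂ + s₂₃ + s₁₂)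
    (e₃ : 2 * f₃ = z₃ + s₁₃ + s₂₃) (v₁ : 2 * m = z₂ + z₃ + (s₁₂ + s₁₃))
    (v₂ : 2 * m = z₃ + z₁ + (s₂₃ + s₁₂)) (v₃ : 2 * m = z₁ + z₂ + (s₁₃ + s₂₃)) :
    f₁ + f₂ + f₃ = 2 * m ∧ f₁ = s₁₂ + s₁₃ ∧ f₂ = s₁₂ + s₂₃ ∧ f₃ = s₁₃ + s₂₃ := by
  omega

/-- When the boundary of one class is small, that of each union of two classes is the same. -/
theorem Quad.boundary_eq (h : Quad a C) (hp : 5 ≤ p) (hD : Distinct r x y z) {d : ZMod p}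
    (h1 : bd (C r) d + 2 ≤ #(C r)) (h4 : bd (C r) d ≤ 4) :
    (bd (C x) d + bd (C y) d + bd (C z) d = 2 * bd (C r) d ∧
      bd (C x) d = adj (C x) (C y) d + adj (C x) (C z) d ∧
      bd (C y) d = adj (C x) (C y) d + adj (C y) (C z) d ∧
      bd (C z) d = adj (C x) (C z) d + adj (C y) (C z) d) ∧ bd (C x ∪ C y) d = bd (C r) d := by
  have cx := h.three_le_card hp x
  have cy := h.three_le_card hp y
  have cz := h.three_le_card hp z
  have g1 := h.bd_union_eq hp hD h1 (by omega)
  have g2 := h.bd_union_eq hp hD.rot h1 (by omega)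
  have g3 := h.bd_union_eq hp hD.rot.rot h1 (by omega)
  refine ⟨?_, g3⟩
  have e0 := h.two_mul_bd hD d
  have e1 := h.two_mul_bd hD.swap₁₂ d
  have e2 := h.two_mul_bd hD.rot.swap₁₂ d
  have e3 := h.two_mul_bd hD.rot.rot.swap₁₂ d
  have v1 := h.two_mul_bd_union hD d
  have v2 := h.two_mul_bd_union hD.rot d
  have v3 := h.two_mul_bd_union hD.rot.rot d
  rw [← bd_compl, h.compl_union hD, g1] at v1
  rw [← bd_compl, h.compl_union hD.rot, g2] at v2
  rw [← bd_compl, h.compl_union hD.rot.rot, g3] at v3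
  rw [adj_comm (C x) (C r)] at e1
  rw [adj_comm (C y) (C r), adj_comm (C y) (C x)] at e2
  rw [adj_comm (C z) (C r), adj_comm (C z) (C x), adj_comm (C z) (C y)] at e3
  rw [adj_comm (C y) (C x)] at v2
  rw [adj_comm (C z) (C x), adj_comm (C z) (C y)] at v3
  exact RainbowNumber.boundary_eq e0 e1 e2 e3 v1 v2 v3

/-- The other three boundaries sum to twice that of `C r`, and each is at least 2. -/
theorem Quad.boundary_two (h : Quad a C) (hp : 5 ≤ p) (hD : Distinct r x y z) {d : ZMod p}
    (hd : d ≠ 0) (h1 : bd (C r) d + 2 ≤ #(C r)) (h3 : bd (C r) d ≤ 3) :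
    bd (C r) d = 3 ∧ bd (C x) d = 2 ∧ bd (C y) d = 2 ∧ bd (C z) d = 2 ∧
      bd (C x ∪ C y) d = 3 := by
  obtain ⟨⟨h4, -⟩, h5⟩ := h.boundary_eq hp hD h1 (by omega)
  have := h.two_le_bd hp x hd
  have := h.two_le_bd hp y hd
  have := h.two_le_bd hp z hd
  omega

/-- A difference `d` of `C x` puts a translate of `{0, d}` inside `C x`, so the sumset with `C x`,
larger by at most 3, bounds the boundary. -/
theorem Quad.bd_le_three (h : Quad a C) (hrx : r ≠ x) (h3 : #(C x) = 3)
    {d : ZMod p} (hd : d ∈ dirs (C x) 2) {i j : Fin 3} (hij : i ≠ j) :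
    bd (C r) (a i / a j * d) ≤ 3 := by
  obtain ⟨y, z, hD⟩ := exists_distinct_pair hrx
  have hne : ∀ i j, a i / a j ≠ 0 := fun i j => div_ne_zero (h.ne i) (h.ne j)
  have h1 := (h.part hD).card_add_le hij.symm
  have h2 : #((a j / a i) • C r) = #(C r) := card_smul_finset₀ (hne j i) _
  rw [mem_dirs] at hd
  obtain ⟨b, hb⟩ : {u ∈ C x | u + d ∈ C x}.Nonempty := by
    rw [← card_pos]
    have := card_filter_add_card_filter_not (s := C x) (fun u => u + d ∈ C x)
    unfold bd at hd
    omega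
  rw [mem_filter] at hb
  have hsub : b +ᵥ ((a j / a i) • C r + {0, d}) ⊆ (a j / a i) • C r + C x := by
    intro v hv
    rw [mem_vadd_iff] at hv
    obtain ⟨u, hu, e, he, hve⟩ := mem_add.1 hv
    simp only [mem_insert, mem_singleton] at he
    rcases he with rfl | rfl
    · exact mem_add.2 ⟨u, hu, b, hb.1, by linear_combination hve⟩
    · exact mem_add.2 ⟨u, hu, b + e, hb.2, by linear_combination hve⟩
  have h4 := card_le_card hsub
  rw [card_vadd_finset, card_add_pair] at h4
  have h5 : a j / a i * (a i / a j * d) = d := by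
    have := h.ne i
    have := h.ne j
    field_simp
  rw [← bd_smul _ _ (hne j i), h5]
  omega

theorem sub_mem_dirs {X : Finset (ZMod p)} (h3 : #X = 3) {u v : ZMod p} (hu : u ∈ X) (hv : v ∈ X)
    (huv : u ≠ v) : u - v ∈ dirs X 2 := by
  refine mem_dirs.2 ⟨sub_ne_zero.2 huv, ?_⟩
  have := bd_ne_card_of_mem hv hu
  have := bd_le_card X (u - v)
  omega

/-- The three small classes share their differences. A difference common to `C x` and `C y` gives a
shift `c` carrying two elements of `C x` into `C y`. The boundary relations along `c` then make `c`
a difference of `C z`, hence of `C x`, and the boundary of `C x` becomes too small for two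
adjacencies. -/
theorem Quad.false_of_three (h : Quad a C) (hp : 11 ≤ p) (hD : Distinct r x y z)
    (h8 : 8 ≤ #(C r)) (h3 : ∀ u, r ≠ u → #(C u) = 3) : False := by
  have hp5 : 5 ≤ p := by omega
  have hne : ∀ i j, a i / a j ≠ 0 := fun i j => div_ne_zero (h.ne i) (h.ne j)
  have hmul : ∀ u, r ≠ u → ∀ v, r ≠ v → ∀ i j : Fin 3, i ≠ j → ∀ d ∈ dirs (C u) 2,
      a i / a j * d ∈ dirs (C v) 2 := by
    intro u hu v hv i j hij d hd
    obtain ⟨y, z, hD⟩ := exists_distinct_pair hv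
    have h1 := h.bd_le_three hu (h3 u hu) hd hij
    have hd' := mul_ne_zero (hne i j) (mem_dirs.1 hd).1
    exact mem_dirs.2 ⟨hd', (h.boundary_two hp5 hD hd' (by omega) h1).2.1.le⟩
  have hsub : ∀ u, r ≠ u → ∀ v, r ≠ v → dirs (C u) 2 ⊆ dirs (C v) 2 := by
    intro u hu v hv d hd
    have h1 := hmul u hu v hv 1 0 (by decide) _ (hmul u hu u hu 0 1 (by decide) d hd)
    convert h1 using 1
    have := h.ne 0
    have := h.ne 1
    field_simp
  obtain ⟨hrx, hry, hrz, hxy, hxz, hyz⟩ := id hD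
  obtain ⟨x₁, hx1, x₂, hx2, hx12⟩ := one_lt_card.1 (by have := h3 x hrx; omega : 1 < #(C x))
  have hδ := hsub x hrx y hry (sub_mem_dirs (h3 x hrx) hx1 hx2 hx12)
  obtain ⟨w, hw⟩ : {u ∈ C y | u + (x₁ - x₂) ∈ C y}.Nonempty := by
    rw [← card_pos]
    have := card_filter_add_card_filter_not (s := C y) (fun u => u + (x₁ - x₂) ∈ C y)
    have h2 := (mem_dirs.1 hδ).2
    have h4 := h3 y hry
    unfold bd at h2
    omega
  rw [mem_filter] at hw
  have hc0 : w - x₂ ≠ 0 := by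
    intro e
    exact disjoint_left.1 (h.disj x y hxy) hx2 (sub_eq_zero.1 e ▸ hw.1)
  have hadj : 2 ≤ adj (C x) (C y) (w - x₂) := by
    have h1 : ({x₁, x₂} : Finset (ZMod p)) ⊆ {v ∈ C x | v + (w - x₂) ∈ C y} := by
      intro v hv
      simp only [mem_insert, mem_singleton] at hv
      rcases hv with rfl | rfl
      · refine mem_filter.2 ⟨hx1, ?_⟩
        rw [show v + (w - x₂) = w + (v - x₂) by ring]
        exact hw.2
      · refine mem_filter.2 ⟨hx2, ?_⟩
        simpa using hw.1
    have h2 := card_le_card h1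
    rw [card_pair hx12] at h2
    unfold adj
    omega
  have bx := bd_le_card (C x) (w - x₂)
  have by' := bd_le_card (C y) (w - x₂)
  have bz := bd_le_card (C z) (w - x₂)
  rw [h3 x hrx] at bx
  rw [h3 y hry] at by'
  rw [h3 z hrz] at bz
  have tx := h.two_le_bd hp5 x hc0
  have ty := h.two_le_bd hp5 y hc0
  have tz := h.two_le_bd hp5 z hc0
  have e1 := h.two_mul_bd hD.swap₁₂.rot (w - x₂)
  have e2 := h.two_mul_bd hD.rot.swap₁₂.rot.rot (w - x₂)
  have v := h.two_mul_bd_union (r := x) (x := y) (y := z) (z := r)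
    ⟨hxy, hxz, hrx.symm, hyz, hry.symm, hrz.symm⟩ (w - x₂)
  rw [adj_comm (C y) (C x)] at e2
  have hg : bd (C x ∪ C y) (w - x₂) ≤ 4 := by omega
  have hrg := h.bd_eq_union hp5 hD.rot.rot (d := w - x₂) (by omega)
    (by rw [h3 x hrx, h3 y hry]; omega)
  obtain ⟨⟨q1, q2, q3, q4⟩, -⟩ := h.boundary_eq hp5 hD (d := w - x₂) (by omega) (by omega)
  have hz : w - x₂ ∈ dirs (C z) 2 := mem_dirs.2 ⟨hc0, by omega⟩
  have hx := (mem_dirs.1 (hsub z hrz x hrx hz)).2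
  omega

theorem Quad.false_of_card_three (h : Quad a C) (hp : 11 ≤ p) (hD : Distinct r x y z)
    (hx : #(C x) = 3) (hy : #(C y) = 3) (hzr : #(C z) ≤ #(C r)) : False := by
  have hp5 : 5 ≤ p := by omega
  have hsum := h.sum_card hD
  have hz := h.three_le_card hp5 z
  have hne : ∀ i j, a i / a j ≠ 0 := fun i j => div_ne_zero (h.ne i) (h.ne j)
  have hprime : p.Prime := Fact.out
  have hr4 : 4 ≤ #(C r) := by
    by_contra hlt
    have : p = 12 := by omega
    subst this
    revert hprime
    norm_num
  have hr5 : 5 ≤ #(C r) := by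
    by_contra hlt
    obtain ⟨d, hd, hd2⟩ := h.exists_bd_add_two_le hp5 hD.1.symm (by omega) hr4
    have := h.boundary_two hp5 hD hd hd2 (by omega)
    omega
  obtain ⟨u, hu, v, hv, huv⟩ := one_lt_card.1 (by omega : 1 < #(C x))
  have hδ := sub_mem_dirs hx hu hv huv
  have hδ3 := h.bd_le_three hD.1 hx hδ (show (0 : Fin 3) ≠ 1 by decide)
  have hδ0 := mul_ne_zero (hne 0 1) (mem_dirs.1 hδ).1
  obtain ⟨q1, q2, q3, q4, q5⟩ := h.boundary_two hp5 hD hδ0 (by omega) hδ3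
  -- If `C z` had four elements, its boundary 2 would equal that of `C x ∪ C y`, which is 3.
  have hz3 : #(C z) = 3 := by
    by_contra hz3
    have := h.bd_union_eq hp5 hD.rot.rot.swap₁₂ (d := a 0 / a 1 * (u - v)) (by omega) (by omega)
    omega
  refine h.false_of_three hp hD ?_ ?_
  · by_contra hlt
    have : p = 14 ∨ p = 15 ∨ p = 16 := by omega
    rcases this with rfl | rfl | rfl <;> revert hprime <;> norm_num
  · intro w hw
    have : w = x ∨ w = y ∨ w = z := by
      have : w ∈ ({r, x, y, z} : Finset (Fin 4)) := hD.univ_eq ▸ mem_univ w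
      simp only [mem_insert, mem_singleton] at this
      exact this.resolve_left hw.symm
    rcases this with rfl | rfl | rfl <;> assumption

theorem exists_sorted (f : Fin 4 → ℕ) :
    ∃ r x y z, Distinct r x y z ∧ f r ≤ f x ∧ f x ≤ f y ∧ f y ≤ f z := by
  have hm := Tuple.monotone_sort f
  have hi := (Tuple.sort f).injective
  refine ⟨Tuple.sort f 0, Tuple.sort f 1, Tuple.sort f 2, Tuple.sort f 3, ?_,
    hm (by decide), hm (by decide), hm (by decide)⟩
  refine ⟨?_, ?_, ?_, ?_, ?_, ?_⟩ <;> exact fun e => absurd (hi e) (by decide)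

/-- A coloring with four colors has a rainbow solution when `5 ≤ p`. -/
theorem Quad.false (h : Quad a C) (hp : 5 ≤ p) : False := by
  have hp11 := h.eleven_le hp
  obtain ⟨r, x, y, z, hD, h1, h2, h3⟩ := exists_sorted fun i => #(C i)
  have h4 := h.three_le_card hp r
  rcases Nat.lt_or_ge #(C x) 4 with h5 | h5
  · refine h.false_of_card_three hp11 (r := z) (x := r) (y := x) (z := y) ?_ (by omega)
      (by omega) h3
    obtain ⟨g1, g2, g3, g4, g5, g6⟩ := hD
    exact ⟨g3.symm, g5.symm, g6.symm, g1, g2, g4⟩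
  · exact h.false_of_four_le hp hD h1 h2 h3 h5

end FourClassesFinal
end RainbowNumber

namespace RainbowNumber
open Finset

/-! ### Colorings -/

section Colorings

/-- The coefficients modulo `n`. -/
def coeffs (n : ℕ) (a₁ a₂ a₃ : ℤ) : Fin 3 → ZMod n := ![(a₁ : ZMod n), a₂, a₃]

/-- No solution of the homogeneous equation has members of pairwise distinct colors. -/
def RainbowFree {n : ℕ} {κ : Type*} (a : Fin 3 → ZMod n) (c : ZMod n → κ) : Prop :=
  ∀ i j k : Fin 3, i ≠ j → j ≠ k → i ≠ k → ∀ u v w, c u ≠ c v → c v ≠ c w → c u ≠ c w →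
    a i * u + a j * v + a k * w ≠ 0

theorem rainbowFree_iff {n r : ℕ} {a₁ a₂ a₃ : ℤ} {c : ZMod n → Fin r} :
    RainbowFree (coeffs n a₁ a₂ a₃) c ↔ ¬ HasRainbowSolution ⟨a₁, a₂, a₃, 0⟩ c := by
  constructor
  · rintro h ⟨u, v, w, hs, h1, h2, h3⟩
    refine h 0 1 2 (by decide) (by decide) (by decide) u v w h1 h3 h2 ?_
    simpa [LinEq.IsSolution, coeffs] using hs
  · intro h i j k hij hjk hik u v w h1 h2 h3 hs
    have key : ∀ u v w, c u ≠ c v → c v ≠ c w → c u ≠ c w →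
        (a₁ : ZMod n) * u + a₂ * v + a₃ * w ≠ 0 := fun u v w h1 h2 h3 hs =>
      h ⟨u, v, w, by simpa [LinEq.IsSolution] using hs, h1, h3, h2⟩
    fin_cases i <;> fin_cases j <;> fin_cases k <;> simp [coeffs] at hij hjk hik hs
    · exact key u v w h1 h2 h3 hs
    · exact key u w v h3 h2.symm h1 (by linear_combination hs)
    · exact key v u w h1.symm h3 h2 (by linear_combination hs)
    · exact key w u v h3.symm h1 h2.symm (by linear_combination hs)
    · exact key v w u h2 h3.symm h1.symm (by linear_combination hs)
    · exact key w v u h2.symm h1.symm h3.symm (by linear_combination hs)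

theorem RainbowFree.comp {n : ℕ} {κ κ' : Type*} {a : Fin 3 → ZMod n} {c : ZMod n → κ}
    (h : RainbowFree a c) (f : κ → κ') : RainbowFree a (f ∘ c) :=
  fun i j k hij hjk hik u v w h1 h2 h3 => h i j k hij hjk hik u v w
    (fun e => h1 (congrArg f e)) (fun e => h2 (congrArg f e)) (fun e => h3 (congrArg f e))

theorem exists_surjective_fin {m n : ℕ} (hn : 0 < n) (h : n ≤ m) :
    ∃ f : Fin m → Fin n, Function.Surjective f :=
  ⟨fun i => ⟨min i (n - 1), by omega⟩, fun j =>
    ⟨⟨j, by omega⟩, by ext; simp only; omega⟩⟩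

/-- Merging colors preserves rainbow-freeness, so a rainbow-free coloring with `q` colors also
defeats every smaller number of colors. -/
theorem lt_rb {n q : ℕ} (hn : n ≠ 0) {a₁ a₂ a₃ : ℤ} {c : ZMod n → Fin q}
    (hc : Function.Surjective c) (h : RainbowFree (coeffs n a₁ a₂ a₃) c) :
    q < rb n ⟨a₁, a₂, a₃, 0⟩ := by
  by_contra hle
  obtain ⟨h0, hf⟩ : rb n ⟨a₁, a₂, a₃, 0⟩ ∈
      {r : ℕ | 0 < r ∧ ForcesRainbow n ⟨a₁, a₂, a₃, 0⟩ r} :=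
    Nat.sInf_mem ⟨n + 1, Nat.succ_pos n, forcesRainbow_succ n hn _⟩
  obtain ⟨f, hfs⟩ := exists_surjective_fin h0 (not_lt.1 hle)
  exact rainbowFree_iff.1 (h.comp f) (hf _ (hfs.comp hc))

theorem exists_rainbowFree {n r : ℕ} {a₁ a₂ a₃ : ℤ} (h0 : 0 < r)
    (h : r < rb n ⟨a₁, a₂, a₃, 0⟩) :
    ∃ c : ZMod n → Fin r, Function.Surjective c ∧ RainbowFree (coeffs n a₁ a₂ a₃) c := by
  have h1 := Nat.notMem_of_lt_sInf h
  simp only [Set.mem_ofPred_eq, not_and, ForcesRainbow, not_forall] at h1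
  obtain ⟨c, hc, hc'⟩ := h1 h0
  exact ⟨c, hc, rainbowFree_iff.2 hc'⟩

theorem rainbowFree_of_two {n : ℕ} {a : Fin 3 → ZMod n} (c : ZMod n → Fin 2) :
    RainbowFree a c := by
  intro i j k _ _ _ u v w h1 h2 h3
  omega

theorem exists_two_coloring {n : ℕ} (hn : 2 ≤ n) :
    ∃ c : ZMod n → Fin 2, Function.Surjective c ∧ ∀ x, c x = c 0 → x = 0 := by
  classical
  have : Fact (1 < n) := ⟨hn⟩
  refine ⟨fun x => if x = 0 then 0 else 1, ?_, ?_⟩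
  · intro j
    fin_cases j
    · exact ⟨0, by simp⟩
    · exact ⟨1, by simp⟩
  · intro x hx
    by_contra h
    simp [h] at hx

theorem three_le_rb {n : ℕ} (hn : 2 ≤ n) (a₁ a₂ a₃ : ℤ) : 3 ≤ rb n ⟨a₁, a₂, a₃, 0⟩ := by
  obtain ⟨c, hc, -⟩ := exists_two_coloring hn
  exact lt_rb (by omega) hc (rainbowFree_of_two c)

end Colorings

/-! ### Prime modulus: isolating zero -/

section PrimeModulus

variable {p : ℕ} [Fact p.Prime] {a : Fin 3 → ZMod p}

theorem RainbowFree.free {κ : Type*} [DecidableEq κ] {c : ZMod p → κ} (h : RainbowFree a c)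
    {i j k : κ} (hij : i ≠ j) (hjk : j ≠ k) (hik : i ≠ k) :
    Free a {x | c x = i} {x | c x = j} {x | c x = k} := by
  intro i' j' k' h1 h2 h3 u hu v hv w hw
  simp only [mem_filter, mem_univ, true_and] at hu hv hw
  subst hu hv hw
  exact h i' j' k' h1 h2 h3 u v w hij hjk hik

theorem disjoint_fibers {κ : Type*} [DecidableEq κ] (c : ZMod p → κ) {i j : κ} (hij : i ≠ j) :
    Disjoint ({x | c x = i} : Finset (ZMod p)) ({x | c x = j} : Finset (ZMod p)) := by
  rw [disjoint_left]
  intro x hx hx'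
  simp only [mem_filter, mem_univ, true_and] at hx hx'
  exact hij (hx.symm.trans hx')

theorem nonempty_fiber {κ : Type*} [DecidableEq κ] {c : ZMod p → κ} (hc : Function.Surjective c)
    (i : κ) : ({x | c x = i} : Finset (ZMod p)).Nonempty := by
  obtain ⟨x, hx⟩ := hc i
  exact ⟨x, by simp [hx]⟩

theorem sum_card_fibers {r : ℕ} (c : ZMod p → Fin r) :
    ∑ i, #({x | c x = i} : Finset (ZMod p)) = p := by
  rw [← card_eq_sum_card_fiberwise (fun x _ => mem_coe.2 (mem_univ (c x))), card_univ, ZMod.card]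

theorem Inv.exists_coloring (ha : ∀ i, a i ≠ 0) (h : Inv a) :
    ∃ c : ZMod p → Fin 3, Function.Surjective c ∧ RainbowFree a c ∧ ∀ x, c x = c 0 → x = 0 := by
  obtain ⟨K, h0, ⟨y, hy⟩, ⟨u, hu0, huK⟩, hK⟩ := h
  have hy0 : y ≠ 0 := fun e => h0 (e ▸ hy)
  set c : ZMod p → Fin 3 := fun x => if x = 0 then 0 else if x ∈ K then 1 else 2 with hc
  have hc0 : ∀ x, c x = 0 → x = 0 := by
    intro x hx
    by_contra hx0
    by_cases hxK : x ∈ K <;> simp [hc, hx0, hxK] at hx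
  have hc1 : ∀ x, c x = 1 → x ∈ K := by
    intro x hx
    by_contra hxK
    by_cases hx0 : x = 0 <;> simp [hc, hx0, hxK] at hx
  have hc2 : ∀ x, c x = 2 → x ∉ K := by
    intro x hx hxK
    by_cases hx0 : x = 0 <;> simp [hc, hx0, hxK] at hx
  refine ⟨c, ?_, ?_, ?_⟩
  · intro j
    fin_cases j
    · exact ⟨0, by simp [hc]⟩
    · exact ⟨y, by simp [hc, hy, hy0]⟩
    · exact ⟨u, by simp [hc, hu0, huK]⟩
  · have key : ∀ i j k : Fin 3, j ≠ k → ∀ u v w, c u = 0 → c v = 1 → c w = 2 →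
        a i * u + a j * v + a k * w ≠ 0 := by
      intro i j k hjk u v w hu hv hw hs
      rw [hc0 u hu, mul_zero, zero_add] at hs
      have h1 := hK j k hjk v (hc1 v hv)
      have h2 : -(a j / a k * v) = w := by
        have := ha k
        field_simp
        linear_combination -hs
      exact hc2 w hw (h2 ▸ h1)
    intro i j k hij hjk hik u v w h1 h2 h3 hs
    have h4 : ∀ q : Fin 3, q = 0 ∨ q = 1 ∨ q = 2 := by decide
    rcases h4 (c u) with e1 | e1 | e1 <;> rcases h4 (c v) with e2 | e2 | e2 <;>
      rcases h4 (c w) with e3 | e3 | e3 <;> rw [e1, e2] at h1 <;> rw [e2, e3] at h2 <;>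
      rw [e1, e3] at h3 <;> try contradiction
    · exact key i j k hjk u v w e1 e2 e3 hs
    · exact key i k j hjk.symm u w v e1 e3 e2 (by linear_combination hs)
    · exact key j i k hik v u w e2 e1 e3 (by linear_combination hs)
    · exact key k i j hij w u v e3 e1 e2 (by linear_combination hs)
    · exact key j k i hik.symm v w u e2 e3 e1 (by linear_combination hs)
    · exact key k j i hij.symm w v u e3 e2 e1 (by linear_combination hs)
  · intro x hx
    exact hc0 x (by rw [hx]; simp [hc])

/-- A rainbow-free exact coloring can be chosen with `0` the only element of its color. -/
theorem exists_rainbowFree_zero (ha : ∀ i, a i ≠ 0) {r : ℕ} (hr : 2 ≤ r) {c : ZMod p → Fin r}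
    (hc : Function.Surjective c) (h : RainbowFree a c) :
    ∃ c : ZMod p → Fin r, Function.Surjective c ∧ RainbowFree a c ∧ ∀ x, c x = c 0 → x = 0 := by
  have hprime : p.Prime := Fact.out
  have hrp : r ≤ p := by
    have := Fintype.card_le_of_surjective c hc
    rwa [ZMod.card, Fintype.card_fin] at this
  rcases Nat.lt_or_ge r 3 with h3 | h3
  · obtain rfl : r = 2 := by omega
    obtain ⟨c', hc', h0⟩ := exists_two_coloring hprime.two_le
    exact ⟨c', hc', rainbowFree_of_two c', h0⟩
  rcases Nat.lt_or_ge p 5 with hp | hp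
  -- At least three colors and a prime below 5 leave only `p = r = 3`, where the coloring is
  -- injective.
  · have hp3 : p = r := by
      have : p ≠ 4 := by
        rintro rfl
        revert hprime
        norm_num
      omega
    have hinj : Function.Injective c :=
      ((Fintype.bijective_iff_surjective_and_card c).2
        ⟨hc, by rw [ZMod.card, Fintype.card_fin, hp3]⟩).1
    exact ⟨c, hc, h, fun x hx => hinj hx⟩
  rcases Nat.lt_or_ge r 4 with h4 | h4
  · obtain rfl : r = 3 := by omega
    have hpart : Part a {x | c x = 0} {x | c x = 1} {x | c x = 2} :=
    { ne := ha
      free := h.free (by decide) (by decide) (by decide)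
      disj₁₂ := disjoint_fibers c (i := 0) (j := 1) (by decide)
      disj₁₃ := disjoint_fibers c (i := 0) (j := 2) (by decide)
      disj₂₃ := disjoint_fibers c (i := 1) (j := 2) (by decide)
      card := by
        have := sum_card_fibers c
        rwa [Fin.sum_univ_three] at this
      pos₁ := nonempty_fiber hc _
      pos₂ := nonempty_fiber hc _
      pos₃ := nonempty_fiber hc _ }
    exact (inv_of_part hpart hp).exists_coloring ha
  · exfalso
    obtain ⟨f, hf⟩ := exists_surjective_fin (n := 4) (by norm_num) h4
    have hquad : Quad a fun i => {x | (f ∘ c) x = i} :=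
    { ne := ha
      free := fun i j k hij hjk hik => (h.comp f).free hij hjk hik
      disj := fun i j hij => disjoint_fibers (f ∘ c) hij
      card := sum_card_fibers (f ∘ c)
      pos := nonempty_fiber (hf.comp hc) }
    exact hquad.false hp

end PrimeModulus

/-! ### The product coloring of `ℤ/ptℤ` -/

section Product

variable {p t : ℕ} {a₁ a₂ a₃ : ℤ}

/-- The sum type keeps the two palettes disjoint; the color of 0 is removed from the second because
`hc0` confines it to the multiples of `p`. -/
theorem exists_product_coloring [Fact p.Prime] (ht : 2 ≤ t)
    (ha : ∀ i, coeffs p a₁ a₂ a₃ i ≠ 0) {r s : ℕ} {c : ZMod p → Fin r}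
    (hc : Function.Surjective c) (hcf : RainbowFree (coeffs p a₁ a₂ a₃) c)
    (hc0 : ∀ x, c x = c 0 → x = 0) {c' : ZMod t → Fin s} (hc' : Function.Surjective c')
    (hcf' : RainbowFree (coeffs t a₁ a₂ a₃) c') :
    ∃ f : ZMod (p * t) → Fin s ⊕ {j : Fin r // j ≠ c 0}, Function.Surjective f ∧
      RainbowFree (coeffs (p * t) a₁ a₂ a₃) f := by
  have hp : 0 < p := (Fact.out : p.Prime).pos
  have : NeZero t := ⟨by omega⟩
  have hpt : p * t ≠ 0 := by positivity
  have : NeZero (p * t) := ⟨hpt⟩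
  set π : ZMod (p * t) →+* ZMod p := ZMod.castHom (dvd_mul_right p t) (ZMod p) with hπ
  have hπval : ∀ x : ZMod (p * t), π x = ((x.val : ℕ) : ZMod p) := by
    intro x
    conv_lhs => rw [← ZMod.natCast_zmod_val x]
    rw [map_natCast]
  have hπa : ∀ i, π (coeffs (p * t) a₁ a₂ a₃ i) = coeffs p a₁ a₂ a₃ i := by
    intro i
    fin_cases i <;> simp [coeffs]
  have hdvd : ∀ x, π x = 0 → p * (x.val / p) = x.val := by
    intro x hx
    rw [hπval, ZMod.natCast_eq_zero_iff] at hx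
    exact Nat.mul_div_cancel' hx
  refine ⟨fun x => if hx : π x = 0 then Sum.inl (c' ((x.val / p : ℕ) : ZMod t)) else
    Sum.inr ⟨c (π x), fun h => hx (hc0 _ h)⟩, ?_, ?_⟩
  · rintro (j | ⟨j, hj⟩)
    · obtain ⟨y, rfl⟩ := hc' j
      have hv : (((p * y.val : ℕ) : ZMod (p * t))).val = p * y.val := by
        rw [ZMod.val_natCast, Nat.mod_eq_of_lt]
        exact Nat.mul_lt_mul_of_pos_left (ZMod.val_lt y) hp
      refine ⟨((p * y.val : ℕ) : ZMod (p * t)), ?_⟩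
      have h0 : π ((p * y.val : ℕ) : ZMod (p * t)) = 0 := by
        rw [map_natCast]
        simp
      beta_reduce
      rw [dif_pos h0, hv, Nat.mul_div_cancel_left _ hp, ZMod.natCast_zmod_val]
    · obtain ⟨y, rfl⟩ := hc j
      have h1 : π ((y.val : ℕ) : ZMod (p * t)) = y := by
        rw [map_natCast, ZMod.natCast_zmod_val]
      refine ⟨((y.val : ℕ) : ZMod (p * t)), ?_⟩
      have hy : y ≠ 0 := by
        rintro rfl
        exact hj rfl
      beta_reduce
      rw [dif_neg (show ¬ π ((y.val : ℕ) : ZMod (p * t)) = 0 by rwa [h1])]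
      simp only [h1]
  · intro i j k hij hjk hik u v w h1 h2 h3 hs
    have hsp := congrArg π hs
    simp only [map_add, map_mul, map_zero, hπa] at hsp
    -- For three multiples of `p` the equation is lifted to integers and divided by `p`, leaving a
    -- congruence modulo `t`. Otherwise at most one member is a multiple of `p`, and distinct colors
    -- remain distinct after reduction modulo `p`.
    by_cases hall : π u = 0 ∧ π v = 0 ∧ π w = 0
    · obtain ⟨hu, hv, hw⟩ := hall
      simp only [dif_pos hu, dif_pos hv, dif_pos hw] at h1 h2 h3
      refine hcf' i j k hij hjk hik _ _ _ (fun e => h1 (by rw [e])) (fun e => h2 (by rw [e]))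
        (fun e => h3 (by rw [e])) ?_
      have hcz : ∀ (n : ℕ) (l : Fin 3), coeffs n a₁ a₂ a₃ l = ((![a₁, a₂, a₃] l : ℤ) : ZMod n) := by
        intro n l
        fin_cases l <;> rfl
      have hval : ∀ x : ZMod (p * t), π x = 0 →
          x = (((p : ℤ) * ((x.val / p : ℕ) : ℤ) : ℤ) : ZMod (p * t)) := by
        intro x hx
        have : ((p : ℤ) * ((x.val / p : ℕ) : ℤ) : ℤ) = ((x.val : ℕ) : ℤ) := by
          rw [← Nat.cast_mul, hdvd x hx]
        rw [this, Int.cast_natCast, ZMod.natCast_zmod_val]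
      rw [hval u hu, hval v hv, hval w hw, hcz, hcz, hcz, ← Int.cast_mul, ← Int.cast_mul,
        ← Int.cast_mul, ← Int.cast_add, ← Int.cast_add, ZMod.intCast_zmod_eq_zero_iff_dvd] at hs
      have hs' : (t : ℤ) ∣ ![a₁, a₂, a₃] i * ((u.val / p : ℕ) : ℤ) +
          ![a₁, a₂, a₃] j * ((v.val / p : ℕ) : ℤ) + ![a₁, a₂, a₃] k * ((w.val / p : ℕ) : ℤ) := by
        refine Int.dvd_of_mul_dvd_mul_left (a := (p : ℤ)) (by exact_mod_cast hp.ne') ?_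
        have e : ((p * t : ℕ) : ℤ) = (p : ℤ) * t := by push_cast; ring
        rw [e] at hs
        convert hs using 1
        ring
      rw [← ZMod.intCast_zmod_eq_zero_iff_dvd] at hs'
      rw [hcz, hcz, hcz]
      simpa only [Int.cast_add, Int.cast_mul, Int.cast_natCast] using hs'
    · have ne_of : ∀ x y : ZMod (p * t), (π x = 0 → π y = 0 → False) →
          ((if hx : π x = 0 then Sum.inl (c' ((x.val / p : ℕ) : ZMod t)) else
            Sum.inr ⟨c (π x), fun h => hx (hc0 _ h)⟩ : Fin s ⊕ {j : Fin r // j ≠ c 0}) ≠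
          if hx : π y = 0 then Sum.inl (c' ((y.val / p : ℕ) : ZMod t)) else
            Sum.inr ⟨c (π y), fun h => hx (hc0 _ h)⟩) → c (π x) ≠ c (π y) := by
        intro x y hxy hne e
        by_cases hx : π x = 0
        · rw [hx] at e
          exact hxy hx (hc0 _ e.symm)
        · by_cases hy : π y = 0
          · rw [hy] at e
            exact hxy (hc0 _ e) hy
          · rw [dif_neg hx, dif_neg hy] at hne
            simp [e] at hne
      refine hcf i j k hij hjk hik _ _ _ (ne_of u v (fun hu hv => hall ⟨hu, hv, ?_⟩) h1)
        (ne_of v w (fun hv hw => hall ⟨?_, hv, hw⟩) h2)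
        (ne_of u w (fun hu hw => hall ⟨hu, ?_, hw⟩) h3) hsp
      · simpa [hu, hv, ha k] using hsp
      · simpa [hv, hw, ha i] using hsp
      · simpa [hu, hw, ha j] using hsp

end Product

end RainbowNumber

theorem mainTheorem6 (p t : ℕ) (hp : p.Prime) (ht : 2 ≤ t) (a₁ a₂ a₃ : ℤ)
    (ha : IsUnit ((a₁ * a₂ * a₃ : ℤ) : ZMod p)) :
    (RainbowNumber.rb p ⟨a₁, a₂, a₃, 0⟩ : ℤ) + (RainbowNumber.rb t ⟨a₁, a₂, a₃, 0⟩ : ℤ) - 2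
      ≤ (RainbowNumber.rb (p * t) ⟨a₁, a₂, a₃, 0⟩ : ℤ) := by
  have : Fact p.Prime := ⟨hp⟩
  have h0 := ha.ne_zero
  push_cast at h0
  have hne : ∀ i, RainbowNumber.coeffs p a₁ a₂ a₃ i ≠ 0 := by
    intro i
    fin_cases i
    · exact left_ne_zero_of_mul (left_ne_zero_of_mul h0)
    · exact right_ne_zero_of_mul (left_ne_zero_of_mul h0)
    · exact right_ne_zero_of_mul h0
  have hrp := RainbowNumber.three_le_rb hp.two_le a₁ a₂ a₃
  have hrt := RainbowNumber.three_le_rb ht a₁ a₂ a₃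
  obtain ⟨c₀, hc₀, hcf₀⟩ := RainbowNumber.exists_rainbowFree (n := p)
    (r := RainbowNumber.rb p ⟨a₁, a₂, a₃, 0⟩ - 1) (a₁ := a₁) (a₂ := a₂) (a₃ := a₃)
    (by omega) (by omega)
  obtain ⟨c, hc, hcf, hcz⟩ := RainbowNumber.exists_rainbowFree_zero hne (by omega) hc₀ hcf₀
  obtain ⟨c', hc', hcf'⟩ := RainbowNumber.exists_rainbowFree (n := t)
    (r := RainbowNumber.rb t ⟨a₁, a₂, a₃, 0⟩ - 1) (a₁ := a₁) (a₂ := a₂) (a₃ := a₃)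
    (by omega) (by omega)
  obtain ⟨f, hf, hff⟩ := RainbowNumber.exists_product_coloring ht hne hc hcf hcz hc' hcf'
  have hcard : Fintype.card (Fin (RainbowNumber.rb t ⟨a₁, a₂, a₃, 0⟩ - 1) ⊕
      {j : Fin (RainbowNumber.rb p ⟨a₁, a₂, a₃, 0⟩ - 1) // j ≠ c 0}) =
      RainbowNumber.rb t ⟨a₁, a₂, a₃, 0⟩ - 1 + (RainbowNumber.rb p ⟨a₁, a₂, a₃, 0⟩ - 1 - 1) := by
    rw [Fintype.card_sum, Fintype.card_fin, Fintype.card_subtype_compl, Fintype.card_fin,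
      Fintype.card_subtype_eq]
  -- The product coloring has `(rb t - 1) + (rb p - 2)` colors; both rainbow numbers are at least 3,
  -- so the natural subtractions are exact.
  have hlt := RainbowNumber.lt_rb (Nat.mul_ne_zero hp.ne_zero (by omega))
    ((Fintype.equivFinOfCardEq hcard).surjective.comp hf) (hff.comp _)
  omega
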